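/- Let $G$ be a Carnot group, i.e. a connected and simply connected Lie group whose Lie algebra (of left-invariant vector fields) has a direct sum decomposition $\mathfrak g=V_1\oplus\cdots\oplus V_r$ with $V_{j}=[V_1,V_{j-1}]$ for $2\le j\le r$ and $[V_1,V_r]=\{0\}$. Assume $\dim V_1\ge 2$, fix an inner product on $V_1$, and let $X_1,\dots,X_m$ be an orthonormal basis of $V_1$. Let $\Omega\subset G$ be a nonempty open set and let $L^2(\Omega)$ be the space of complex-valued square-integrable functions with respect to Haar measure. Let $S^1(\Omega)$ be the space of all $u\in L^2(\Omega)$ such that the distribution $Xu$ belongs to $L^2(\Omega)$ for every $X\in V_1$, with norm $\big(\|u\|^2+\sum_{\ell=1}^m\|X_\ell u\|^2\big)^{1/2}$, and let $S^1_0(\Omega)$ be the closure in $S^1(\Omega)$ of the functions in $S^1(\Omega)$ that vanish outside a compact subset of $\Omega$. Let $-\Delta^{\rm N}_\Omega$ and $-\Delta^{\rm D}_\Omega$ be the selfadjoint nonnegative operators in $L^2(\Omega)$ associated with the quadratic form $u\mapsto\sum_{\ell=1}^m\|X_\ell u\|^2$ with form domain $S^1(\Omega)$ and $S^1_0(\Omega)$,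 respectively. Assume that $-\Delta^{\rm N}_\Omega$ has compact resolvent. Then the eigenvalues of $-\Delta^{\rm D}_\Omega$ and of $-\Delta^{\rm N}_\Omega$ can each be enumerated, with multiplicities (which are finite), as a nondecreasing sequence $\lambda_1\le\lambda_2\le\cdots$ tending to infinity, and these sequences satisfy $$\lambda_j(-\Delta^{\rm D}_\Omega)>\lambda_{j+1}(-\Delta^{\rm N}_\Omega)\qquad\text{for all } j\in\{1,2,3,\dots\}.$$ -/

import Mathlib

open MeasureTheory Set Filter Topology
open scoped Manifold ContDiff

set_option linter.unusedSectionVars false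

noncomputable section

namespace Carnot

section Groups

variable {E : Type*} [NormedAddCommGroup E] [NormedSpace ℝ E]
  {G : Type*} [TopologicalSpace G] [ChartedSpace E G] [Group G]

/-- `V 1, …, V r` is a stratification of the Lie algebra `𝔤` of the Lie group `G`:
`𝔤 = V 1 ⊕ ⋯ ⊕ V r`, `V (j + 1) = [V 1, V j]` for `1 ≤ j < r`, and `[V 1, V r] = 0`.
Only the values `V 1, …, V r` matter. -/
structure IsStratification (r : ℕ) (V : ℕ → Submodule ℝ (GroupLieAlgebra 𝓘(ℝ, E) G)) : Prop where
  one_le : 1 ≤ r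
  isInternal : DirectSum.IsInternal (fun i : Fin r => V ((i : ℕ) + 1))
  bracket_eq : ∀ j : ℕ, 1 ≤ j → j < r →
    V (j + 1) = Submodule.span ℝ {z | ∃ x ∈ V 1, ∃ y ∈ V j, z = ⁅x, y⁆}
  bracket_last : ∀ x ∈ V 1, ∀ y ∈ V r, ⁅x, y⁆ = 0

/-- The derivative `Y φ` of a function `φ` along the left-invariant vector field on `G` whose value
at the identity is `Y`. -/
def invDeriv (Y : GroupLieAlgebra 𝓘(ℝ, E) G) (φ : G → ℂ) (x : G) : ℂ :=
  mfderiv 𝓘(ℝ, E) 𝓘(ℝ, ℂ) φ x (mulInvariantVectorField Y x)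

variable (E) in
/-- `φ ∈ C_c^∞(Ω)`, complex valued. -/
structure IsTestFunction (Ω : Set G) (φ : G → ℂ) : Prop where
  smooth : ContMDiff 𝓘(ℝ, E) 𝓘(ℝ, ℂ) ∞ φ
  compact_supp : HasCompactSupport φ
  supp_subset : tsupport φ ⊆ Ω

theorem continuous_invDeriv [LieGroup 𝓘(ℝ, E) ∞ G] (Y : GroupLieAlgebra 𝓘(ℝ, E) G) {φ : G → ℂ}
    (hφ : ContMDiff 𝓘(ℝ, E) 𝓘(ℝ, ℂ) ∞ φ) : Continuous (invDeriv Y φ) := by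
  have : LieGroup 𝓘(ℝ, E) (minSmoothness ℝ 3) G :=
    LieGroup.of_le (n := ∞) (by
      rw [minSmoothness_of_isRCLikeNormedField]
      exact WithTop.coe_le_coe.2 (le_top : (3 : ℕ∞) ≤ ⊤))
  have : IsManifold 𝓘(ℝ, E) 1 G := IsManifold.of_le (n := ∞) (by exact mod_cast le_top)
  have h1 : Continuous (fun g : G => (mulInvariantVectorField Y g : TangentBundle 𝓘(ℝ, E) G)) :=
    (contMDiff_mulInvariantVectorField (I := 𝓘(ℝ, E)) Y).continuous
  have h2 : Continuous (tangentMap 𝓘(ℝ, E) 𝓘(ℝ, ℂ) φ) :=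
    (hφ.of_le (m := 1) (by exact mod_cast le_top)).continuous_tangentMap le_rfl
  exact ((tangentBundleModelSpaceHomeomorph 𝓘(ℝ, ℂ)).continuous.comp (h2.comp h1)).snd

theorem hasCompactSupport_invDeriv (Y : GroupLieAlgebra 𝓘(ℝ, E) G) {φ : G → ℂ}
    (hφ : HasCompactSupport φ) : HasCompactSupport (invDeriv Y φ) := by
  refine hφ.mono' fun x hx => ?_
  by_contra h
  apply hx
  have h0 : φ =ᶠ[𝓝 x] fun _ => 0 := by
    rw [notMem_tsupport_iff_eventuallyEq] at h
    exact h
  rw [invDeriv, h0.mfderiv_eq, mfderiv_const]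
  rfl

end Groups

section Operators

variable {H : Type*} [NormedAddCommGroup H] [InnerProductSpace ℂ H]

/-- The eigenspace `ker (A - z)` of an unbounded operator `A`. -/
def eigenspace (A : H →ₗ.[ℂ] H) (z : ℂ) : Submodule ℂ H :=
  (LinearMap.ker (A.toFun - z • A.domain.subtype)).map A.domain.subtype

/-- The unbounded operator `A` has compact resolvent: for some `z`, the map
`A - z : dom A → H` is bijective and its inverse `R` is a compact operator on `H`. -/
def HasCompactResolvent (A : H →ₗ.[ℂ] H) : Prop :=
  ∃ (z : ℂ) (R : H →L[ℂ] H), IsCompactOperator R ∧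
    (∀ f : H, ∃ h : R f ∈ A.domain, A ⟨R f, h⟩ - z • R f = f) ∧
    (∀ u : A.domain, R (A u - z • (u : H)) = u)

/-- `l 0 ≤ l 1 ≤ l 2 ≤ ⋯ → ∞` is the list of all eigenvalues of `A`, each one repeated according to
its (finite) multiplicity. So `l k` is the `(k + 1)`-st eigenvalue of `A`. -/
structure IsEigenvalueEnumeration (A : H →ₗ.[ℂ] H) (l : ℕ → ℝ) : Prop where
  monotone : Monotone l
  tendsto : Tendsto l atTop atTop
  finiteDimensional : ∀ z : ℂ, FiniteDimensional ℂ (eigenspace A z)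
  multiplicity : ∀ z : ℂ, Module.finrank ℂ (eigenspace A z) = {k : ℕ | (l k : ℂ) = z}.ncard

end Operators

section SubLaplacian

variable {E : Type*} [NormedAddCommGroup E] [NormedSpace ℝ E]
  {G : Type*} [TopologicalSpace G] [ChartedSpace E G] [Group G]
  [MeasurableSpace G]

/-- The Hilbert space `L²(Ω)` of complex-valued functions. -/
abbrev L2 (μ : Measure G) (Ω : Set G) : Type _ := Lp ℂ 2 (μ.restrict Ω)

/-- `v = Y u` in the sense of distributions on `Ω`. As Haar measure on the groups considered here is
bi-invariant, the formal transpose of the vector field `Y` is `-Y`. -/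
def IsWeakDeriv (μ : Measure G) (Ω : Set G) (Y : GroupLieAlgebra 𝓘(ℝ, E) G) (u v : L2 μ Ω) : Prop :=
  ∀ φ : G → ℂ, IsTestFunction E Ω φ →
    ∫ x in Ω, u x * invDeriv Y φ x ∂μ = - ∫ x in Ω, v x * φ x ∂μ

variable [BorelSpace G]

theorem memLp_two_of_continuous {μ : Measure G} [IsFiniteMeasureOnCompacts μ] {f : G → ℂ}
    (hf : Continuous f) (hc : HasCompactSupport f) (Ω : Set G) : MemLp f 2 (μ.restrict Ω) :=
  (hf.memLp_of_hasCompactSupport (μ := μ) (p := 2) hc).restrict Ω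

variable [LieGroup 𝓘(ℝ, E) ∞ G]
  {μ : Measure G} [IsFiniteMeasureOnCompacts μ] {Ω : Set G} {Y : GroupLieAlgebra 𝓘(ℝ, E) G}

theorem isWeakDeriv_zero : IsWeakDeriv μ Ω Y 0 0 := by
  intro φ _
  have h : ((0 : L2 μ Ω) : G → ℂ) =ᵐ[μ.restrict Ω] 0 := Lp.coeFn_zero _ _ _
  rw [integral_congr_ae (g := fun _ => (0 : ℂ)) (h.mono fun x hx => by
      simp only [hx, Pi.zero_apply, zero_mul]),
    integral_congr_ae (f := fun x => ((0 : L2 μ Ω) : G → ℂ) x * φ x) (g := fun _ => (0 : ℂ))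
      (h.mono fun x hx => by
      simp only [hx, Pi.zero_apply, zero_mul])]
  simp

theorem IsWeakDeriv.add {u v u' v' : L2 μ Ω} (h : IsWeakDeriv μ Ω Y u v)
    (h' : IsWeakDeriv μ Ω Y u' v') : IsWeakDeriv μ Ω Y (u + u') (v + v') := by
  intro φ hφ
  have key : ∀ (a b : L2 μ Ω) (f : G → ℂ), MemLp f 2 (μ.restrict Ω) →
      ∫ x in Ω, (a + b : L2 μ Ω) x * f x ∂μ = ∫ x in Ω, a x * f x ∂μ + ∫ x in Ω, b x * f x ∂μ := by
    intro a b f hf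
    have ha : Integrable (fun x => a x * f x) (μ.restrict Ω) := (Lp.memLp a).integrable_mul hf
    have hb : Integrable (fun x => b x * f x) (μ.restrict Ω) := (Lp.memLp b).integrable_mul hf
    rw [← integral_add ha hb]
    refine integral_congr_ae ((Lp.coeFn_add a b).mono fun x hx => ?_)
    simp only [hx, Pi.add_apply, add_mul]
  rw [key _ _ _ (memLp_two_of_continuous (continuous_invDeriv Y hφ.smooth)
      (hasCompactSupport_invDeriv Y hφ.compact_supp) Ω),
    key _ _ _ (memLp_two_of_continuous hφ.smooth.continuous hφ.compact_supp Ω), h φ hφ, h' φ hφ]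
  ring

theorem IsWeakDeriv.smul {u v : L2 μ Ω} (c : ℂ) (h : IsWeakDeriv μ Ω Y u v) :
    IsWeakDeriv μ Ω Y (c • u) (c • v) := by
  intro φ hφ
  have key : ∀ (a : L2 μ Ω) (f : G → ℂ),
      ∫ x in Ω, (c • a : L2 μ Ω) x * f x ∂μ = c * ∫ x in Ω, a x * f x ∂μ := by
    intro a f
    rw [← integral_const_mul]
    refine integral_congr_ae ((Lp.coeFn_smul c a).mono fun x hx => ?_)
    simp only [hx, Pi.smul_apply, smul_eq_mul, mul_assoc]
  rw [key, key, h φ hφ]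
  ring

variable (μ Ω)

/-- The Folland–Stein–Sobolev space `S¹(Ω)`: all `u ∈ L²(Ω)` such that the distribution `Y u` belongs
to `L²(Ω)` for every `Y` in the first layer `V₁`. -/
def S1 (V₁ : Submodule ℝ (GroupLieAlgebra 𝓘(ℝ, E) G)) : Submodule ℂ (L2 μ Ω) where
  carrier := {u | ∀ Y ∈ V₁, ∃ v, IsWeakDeriv μ Ω Y u v}
  zero_mem' := fun _ _ => ⟨0, isWeakDeriv_zero⟩
  add_mem' := fun hu hu' Y hY => by
    obtain ⟨v, hv⟩ := hu Y hY
    obtain ⟨v', hv'⟩ := hu' Y hY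
    exact ⟨v + v', hv.add hv'⟩
  smul_mem' := fun c _ hu Y hY => by
    obtain ⟨v, hv⟩ := hu Y hY
    exact ⟨c • v, hv.smul c⟩

variable {V₁ : Submodule ℝ (GroupLieAlgebra 𝓘(ℝ, E) G)} {m : ℕ}

/-- `p = (X₁ u, …, X_m u)` in the sense of distributions on `Ω`. -/
def IsWeakGradient (X : Module.Basis (Fin m) ℝ V₁) (u : L2 μ Ω) (p : Fin m → L2 μ Ω) : Prop :=
  ∀ i, IsWeakDeriv μ Ω (X i : GroupLieAlgebra 𝓘(ℝ, E) G) u (p i)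

/-- `u` vanishes (almost everywhere) outside of a compact subset of `Ω`. -/
def VanishesOutsideCompact (u : L2 μ Ω) : Prop :=
  ∃ K : Set G, IsCompact K ∧ K ⊆ Ω ∧ ∀ᵐ x ∂(μ.restrict Ω), x ∉ K → u x = 0

variable {μ Ω}

theorem VanishesOutsideCompact.add {u w : L2 μ Ω} (hu : VanishesOutsideCompact μ Ω u)
    (hw : VanishesOutsideCompact μ Ω w) : VanishesOutsideCompact μ Ω (u + w) := by
  obtain ⟨K, hK, hKΩ, h⟩ := hu
  obtain ⟨K', hK', hKΩ', h'⟩ := hw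
  refine ⟨K ∪ K', hK.union hK', union_subset hKΩ hKΩ', ?_⟩
  filter_upwards [h, h', Lp.coeFn_add u w] with x hx hx' hs hxK
  rw [hs, Pi.add_apply, hx fun hh => hxK (Or.inl hh), hx' fun hh => hxK (Or.inr hh), add_zero]

theorem VanishesOutsideCompact.smul {u : L2 μ Ω} (c : ℂ) (hu : VanishesOutsideCompact μ Ω u) :
    VanishesOutsideCompact μ Ω (c • u) := by
  obtain ⟨K, hK, hKΩ, h⟩ := hu
  refine ⟨K, hK, hKΩ, ?_⟩
  filter_upwards [h, Lp.coeFn_smul c u] with x hx hs hxK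
  rw [hs, Pi.smul_apply, hx hxK, smul_zero]

theorem vanishesOutsideCompact_zero : VanishesOutsideCompact μ Ω 0 :=
  ⟨∅, isCompact_empty, empty_subset _, (Lp.coeFn_zero ℂ 2 (μ.restrict Ω)).mono fun x hx _ => by
    rw [hx]; rfl⟩

variable (μ Ω)

/-- The space `S¹₀(Ω)`: the closure in `S¹(Ω)`, for the norm
`(‖u‖² + ∑ᵢ ‖Xᵢ u‖²)^{1/2}`, of the functions in `S¹(Ω)` that vanish outside of a compact subset
of `Ω`. -/
def S10 (X : Module.Basis (Fin m) ℝ V₁) : Submodule ℂ (L2 μ Ω) where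
  carrier := {u | u ∈ S1 μ Ω V₁ ∧ ∀ ε : ℝ, 0 < ε → ∃ w ∈ S1 μ Ω V₁, VanishesOutsideCompact μ Ω w ∧
    ∃ p, IsWeakGradient μ Ω X (u - w) p ∧ ‖u - w‖ ^ 2 + ∑ i, ‖p i‖ ^ 2 < ε ^ 2}
  zero_mem' := ⟨zero_mem _, fun ε hε => ⟨0, zero_mem _, vanishesOutsideCompact_zero, 0,
    fun i => by simpa using isWeakDeriv_zero, by simpa using pow_pos hε 2⟩⟩
  add_mem' := by
    rintro u u' ⟨hu, h⟩ ⟨hu', h'⟩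
    refine ⟨add_mem hu hu', fun ε hε => ?_⟩
    obtain ⟨w, hw, hwc, p, hp, hlt⟩ := h (ε / 2) (half_pos hε)
    obtain ⟨w', hw', hwc', p', hp', hlt'⟩ := h' (ε / 2) (half_pos hε)
    have e : u + u' - (w + w') = (u - w) + (u' - w') := by abel
    have sq : ∀ a b : L2 μ Ω, ‖a + b‖ ^ 2 ≤ 2 * ‖a‖ ^ 2 + 2 * ‖b‖ ^ 2 := fun a b => by
      nlinarith [norm_add_le a b, norm_nonneg (a + b), norm_nonneg a, norm_nonneg b,
        sq_nonneg (‖a‖ - ‖b‖)]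
    refine ⟨w + w', add_mem hw hw', hwc.add hwc', p + p', fun i => ?_, ?_⟩
    · rw [e]; exact (hp i).add (hp' i)
    · rw [e]
      have h1 := sq (u - w) (u' - w')
      have h2 : ∑ i, ‖(p + p') i‖ ^ 2 ≤ 2 * ∑ i, ‖p i‖ ^ 2 + 2 * ∑ i, ‖p' i‖ ^ 2 := by
        rw [Finset.mul_sum, Finset.mul_sum, ← Finset.sum_add_distrib]
        exact Finset.sum_le_sum fun i _ => sq _ _
      nlinarith
  smul_mem' := by
    rintro c u ⟨hu, h⟩
    refine ⟨Submodule.smul_mem _ c hu, fun ε hε => ?_⟩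
    have hc : 0 < ‖c‖ + 1 := by positivity
    obtain ⟨w, hw, hwc, p, hp, hlt⟩ := h (ε / (‖c‖ + 1)) (div_pos hε hc)
    refine ⟨c • w, Submodule.smul_mem _ c hw, hwc.smul c, c • p, fun i => ?_, ?_⟩
    · rw [← smul_sub]; exact (hp i).smul c
    · rw [← smul_sub]
      have e : ‖c • (u - w)‖ ^ 2 + ∑ i, ‖(c • p) i‖ ^ 2
          = ‖c‖ ^ 2 * (‖u - w‖ ^ 2 + ∑ i, ‖p i‖ ^ 2) := by
        simp only [Pi.smul_apply, norm_smul, mul_pow, mul_add, Finset.mul_sum]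
      have hn : 0 ≤ ‖u - w‖ ^ 2 + ∑ i, ‖p i‖ ^ 2 := by positivity
      rw [e]
      calc ‖c‖ ^ 2 * (‖u - w‖ ^ 2 + ∑ i, ‖p i‖ ^ 2)
          ≤ (‖c‖ + 1) ^ 2 * (‖u - w‖ ^ 2 + ∑ i, ‖p i‖ ^ 2) := by
            gcongr; linarith
        _ < (‖c‖ + 1) ^ 2 * (ε / (‖c‖ + 1)) ^ 2 := by gcongr
        _ = ε ^ 2 := by field_simp

/-- The graph of the operator associated with the quadratic form `u ↦ ∑ᵢ ‖Xᵢ u‖²` with form domain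
`Q`: the pairs `(u, f)` such that `u ∈ Q` and `∑ᵢ ⟨Xᵢ v, Xᵢ u⟩ = ⟨v, f⟩` for all `v ∈ Q`. -/
def formGraph (X : Module.Basis (Fin m) ℝ V₁) (Q : Submodule ℂ (L2 μ Ω)) :
    Submodule ℂ (L2 μ Ω × L2 μ Ω) where
  carrier := {a | a.1 ∈ Q ∧ ∃ p, IsWeakGradient μ Ω X a.1 p ∧
    ∀ v ∈ Q, ∀ q, IsWeakGradient μ Ω X v q → ∑ i, inner ℂ (q i) (p i) = inner ℂ v a.2}
  zero_mem' := ⟨zero_mem _, 0, fun _ => isWeakDeriv_zero, fun v _ q _ => by simp⟩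
  add_mem' := by
    rintro a b ⟨ha, p, hp, h⟩ ⟨hb, p', hp', h'⟩
    refine ⟨add_mem ha hb, p + p', fun i => (hp i).add (hp' i), fun v hv q hq => ?_⟩
    simp only [Pi.add_apply, inner_add_right, Finset.sum_add_distrib, h v hv q hq, h' v hv q hq,
      Prod.snd_add]
  smul_mem' := by
    rintro c a ⟨ha, p, hp, h⟩
    refine ⟨Submodule.smul_mem _ c ha, c • p, fun i => (hp i).smul c, fun v hv q hq => ?_⟩
    simp only [Pi.smul_apply, inner_smul_right, ← Finset.mul_sum, h v hv q hq, Prod.smul_snd]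

/-- The Neumann sub-Laplacian `-Δ_Ω^N`: the operator of the form with domain `S¹(Ω)`. -/
def neumannSubLaplacian (X : Module.Basis (Fin m) ℝ V₁) : L2 μ Ω →ₗ.[ℂ] L2 μ Ω :=
  (formGraph μ Ω X (S1 μ Ω V₁)).toLinearPMap

/-- The Dirichlet sub-Laplacian `-Δ_Ω^D`: the operator of the form with domain `S¹₀(Ω)`. -/
def dirichletSubLaplacian (X : Module.Basis (Fin m) ℝ V₁) : L2 μ Ω →ₗ.[ℂ] L2 μ Ω :=
  (formGraph μ Ω X (S10 μ Ω X)).toLinearPMap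

end SubLaplacian

end Carnot

end

/-! The argument is Filonov's. Let `c` be the `j`-th Dirichlet eigenvalue, counted from one, and
consider the hermitian form of `-Δ - c` on S¹(Ω). It is nonpositive on the span of the first `j`
Dirichlet eigenfunctions. The Neumann eigenspace for `c` lies in its radical. Finally, let `U` be a
function of energy `c‖U‖²` that solves `-ΔU = cU`, so that the form vanishes at `U` and between `U`
and S¹₀(Ω). On the sum of the three spaces the form is still nonpositive. If the sum is direct, the
variational principle gives at least `j + 1 + dim ker(-Δ^N - c)` Neumann eigenvalues `≤ c`, hence at
least `j + 1` of them `< c` (`IsFormOperator.enumeration_lt`).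

The solutions are waves `exp(iF)`, where `F` has constant derivatives along left-invariant fields. A
linear functional on `V₁`, extended by zero to the higher layers, vanishes on brackets. It is thus a
closed left-invariant one-form, and it has a primitive `F` because the group is simply connected
(`exists_global_primitive`). The weak equation needs left-invariant fields to be divergence free for
Haar measure, which holds because `ad` is traceless in a stratified algebra
(`IsLieStratification.trace_ad`, `integral_invDeriv_eq_zero`). Waves belong to S¹(Ω) because
compactness of the embedding S¹(Ω) → L²(Ω) forces Ω to have finite volume
(`IsRellich.measure_lt_top`).

Directness has two ingredients. To separate `U` from the rest, rotate its frequency slightly. The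
new wave `U'` is again form-orthogonal to S¹₀(Ω), and so is every Neumann eigenfunction to
everything, but the form does not vanish between `U` and `U'` (`exists_waves`); the rotation needs
`dim V₁ ≥ 2` and `c > 0`. To separate Dirichlet from Neumann functions, extend a common element by
zero: it solves `-Δa = ca` on the whole group. In place of a unique continuation theorem,
compactness shows that the space of such extensions is invariant under small left translations,
hence under all of them. A function all of whose translates live in a set of finite volume is zero
(`exists_invariant_of_compact`, `eq_zero_of_mem_eigenDomain`). -/

noncomputable section

namespace Carnot

/-! ### Group multiplication and invariant frames in a chart at the identity. -/

section LocalCoordinates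

variable (E : Type*) [NormedAddCommGroup E] [NormedSpace ℝ E]
  (G : Type*) [TopologicalSpace G] [ChartedSpace E G] [Group G]

/-- The preferred chart of `G` at the identity. -/
abbrev idChart : PartialEquiv G E := extChartAt 𝓘(ℝ, E) (1 : G)

/-- The coordinate of the identity. -/
abbrev idPt : E := idChart E G 1

/-- Multiplication read in the chart at the identity. -/
def chartMul (p : E × E) : E :=
  idChart E G ((idChart E G).symm p.1 * (idChart E G).symm p.2)

/-- The domain on which `chartMul` represents multiplication. -/
def chartMulDomain : Set (E × E) :=
  {p | p.1 ∈ (idChart E G).target ∧ p.2 ∈ (idChart E G).target ∧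
    (idChart E G).symm p.1 * (idChart E G).symm p.2 ∈ (idChart E G).source}

/-- The derivative at the identity of left multiplication, read in the chart. -/
def leftFrame (ξ : E) : E →L[ℝ] E :=
  (fderiv ℝ (chartMul E G) (ξ, idPt E G)).comp (ContinuousLinearMap.inr ℝ E E)

/-- The derivative at the identity of right multiplication, read in the chart. -/
def rightFrame (ξ : E) : E →L[ℝ] E :=
  (fderiv ℝ (chartMul E G) (idPt E G, ξ)).comp (ContinuousLinearMap.inl ℝ E E)

variable {E G}

theorem idPt_mem : idPt E G ∈ (idChart E G).target := mem_extChartAt_target 1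

@[simp] theorem idChart_symm_idPt : (idChart E G).symm (idPt E G) = 1 := extChartAt_to_inv 1

theorem isOpen_idChart_target : IsOpen (idChart E G).target := isOpen_extChartAt_target 1

theorem mem_chartMulDomain_right {ξ : E} (hξ : ξ ∈ (idChart E G).target) :
    (ξ, idPt E G) ∈ chartMulDomain E G := by
  refine ⟨hξ, idPt_mem, ?_⟩
  simp only [idChart_symm_idPt, mul_one]
  exact (idChart E G).map_target hξ

theorem mem_chartMulDomain_left {ξ : E} (hξ : ξ ∈ (idChart E G).target) :
    (idPt E G, ξ) ∈ chartMulDomain E G := by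
  refine ⟨idPt_mem, hξ, ?_⟩
  simp only [idChart_symm_idPt, one_mul]
  exact (idChart E G).map_target hξ

variable [LieGroup 𝓘(ℝ, E) ∞ G]

theorem contMDiffOn_idChart_symm :
    ContMDiffOn 𝓘(ℝ, E) 𝓘(ℝ, E) ∞ (idChart E G).symm (idChart E G).target :=
  contMDiffOn_extChartAt_symm 1

theorem contMDiffAt_idChart_symm {ξ : E} (hξ : ξ ∈ (idChart E G).target) :
    ContMDiffAt 𝓘(ℝ, E) 𝓘(ℝ, E) ∞ (idChart E G).symm ξ :=
  contMDiffOn_idChart_symm.contMDiffAt (isOpen_idChart_target.mem_nhds hξ)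

theorem contMDiffAt_idChart {x : G} (hx : x ∈ (idChart E G).source) :
    ContMDiffAt 𝓘(ℝ, E) 𝓘(ℝ, E) ∞ (idChart E G) x :=
  contMDiffAt_extChartAt' (by simpa using hx)

theorem contMDiffOn_chartMul_aux :
    ContMDiffOn (𝓘(ℝ, E).prod 𝓘(ℝ, E)) 𝓘(ℝ, E) ∞
      (fun p : E × E => (idChart E G).symm p.1 * (idChart E G).symm p.2)
      ((idChart E G).target ×ˢ (idChart E G).target) :=
  (contMDiffOn_idChart_symm.comp contMDiffOn_fst fun _ hp => hp.1).mul
    (contMDiffOn_idChart_symm.comp contMDiffOn_snd fun _ hp => hp.2)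

theorem isOpen_chartMulDomain : IsOpen (chartMulDomain E G) := by
  have h := (contMDiffOn_chartMul_aux (E := E) (G := G)).continuousOn.isOpen_inter_preimage
    (isOpen_idChart_target.prod isOpen_idChart_target) (isOpen_extChartAt_source (I := 𝓘(ℝ, E)) (1 : G))
  convert h using 1
  ext p
  simp only [chartMulDomain, mem_ofPred_eq, mem_inter_iff, mem_prod, mem_preimage, and_assoc]

theorem contDiffOn_chartMul : ContDiffOn ℝ ∞ (chartMul E G) (chartMulDomain E G) := by
  have h : ContMDiffOn (𝓘(ℝ, E).prod 𝓘(ℝ, E)) 𝓘(ℝ, E) ∞ (chartMul E G) (chartMulDomain E G) := by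
    intro p hp
    have h1 := ((contMDiffOn_chartMul_aux (E := E) (G := G)) p ⟨hp.1, hp.2.1⟩).mono
      (show chartMulDomain E G ⊆ _ from fun q hq => ⟨hq.1, hq.2.1⟩)
    exact (contMDiffAt_idChart hp.2.2).comp_contMDiffWithinAt p h1
  rw [← contMDiffOn_iff_contDiffOn, modelWithCornersSelf_prod, ← chartedSpaceSelf_prod]
  exact h

theorem contDiffAt_chartMul {p : E × E} (hp : p ∈ chartMulDomain E G) :
    ContDiffAt ℝ ∞ (chartMul E G) p :=
  contDiffOn_chartMul.contDiffAt (isOpen_chartMulDomain.mem_nhds hp)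

theorem contDiffAt_fderiv_chartMul {p : E × E} (hp : p ∈ chartMulDomain E G) :
    ContDiffAt ℝ ∞ (fderiv ℝ (chartMul E G)) p :=
  (contDiffAt_chartMul hp).fderiv_right (by simp)

theorem contDiffOn_leftFrame : ContDiffOn ℝ ∞ (leftFrame E G) (idChart E G).target := by
  intro ξ hξ
  have h : ContDiffAt ℝ ∞ (fun ξ : E => fderiv ℝ (chartMul E G) (ξ, idPt E G)) ξ :=
    ContDiffAt.comp ξ (contDiffAt_fderiv_chartMul (mem_chartMulDomain_right hξ))
      (contDiffAt_id.prodMk contDiffAt_const)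
  exact (h.clm_comp contDiffAt_const).contDiffWithinAt

theorem contDiffOn_rightFrame : ContDiffOn ℝ ∞ (rightFrame E G) (idChart E G).target := by
  intro ξ hξ
  have h : ContDiffAt ℝ ∞ (fun ξ : E => fderiv ℝ (chartMul E G) (idPt E G, ξ)) ξ :=
    ContDiffAt.comp ξ (contDiffAt_fderiv_chartMul (mem_chartMulDomain_left hξ))
      (contDiffAt_const.prodMk contDiffAt_id)
  exact (h.clm_comp contDiffAt_const).contDiffWithinAt

theorem chartMul_idPt_right {ξ : E} (hξ : ξ ∈ (idChart E G).target) :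
    chartMul E G (ξ, idPt E G) = ξ := by
  simp only [chartMul, idChart_symm_idPt, mul_one]
  exact (idChart E G).right_inv hξ

theorem chartMul_idPt_left {ξ : E} (hξ : ξ ∈ (idChart E G).target) :
    chartMul E G (idPt E G, ξ) = ξ := by
  simp only [chartMul, idChart_symm_idPt, one_mul]
  exact (idChart E G).right_inv hξ

theorem mfderiv_idChart_symm_idPt :
    mfderiv 𝓘(ℝ, E) 𝓘(ℝ, E) (idChart E G).symm (idPt E G) = ContinuousLinearMap.id ℝ E := by
  have : IsManifold 𝓘(ℝ, E) 1 G := IsManifold.of_le (n := ∞) (by exact mod_cast le_top)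
  have h := mfderivWithin_range_extChartAt_symm (I := 𝓘(ℝ, E)) (x := (1 : G))
  rw [show range 𝓘(ℝ, E) = univ from by simp, mfderivWithin_univ] at h
  exact h

theorem mdifferentiable_mul_left (x y : G) :
    MDifferentiableAt 𝓘(ℝ, E) 𝓘(ℝ, E) (fun z : G => x * z) y :=
  (contMDiff_mul_left (I := 𝓘(ℝ, E)) (n := ∞)).mdifferentiableAt (by simp)

theorem mdifferentiable_mul_right (x y : G) :
    MDifferentiableAt 𝓘(ℝ, E) 𝓘(ℝ, E) (fun z : G => z * x) y :=
  (contMDiff_mul_right (I := 𝓘(ℝ, E)) (n := ∞)).mdifferentiableAt (by simp)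

theorem mdifferentiableAt_idChart_symm {ξ : E} (hξ : ξ ∈ (idChart E G).target) :
    MDifferentiableAt 𝓘(ℝ, E) 𝓘(ℝ, E) (idChart E G).symm ξ :=
  (contMDiffAt_idChart_symm hξ).mdifferentiableAt (by simp)

/-- Near the identity coordinate in `η`, the inverse chart turns `chartMul (ξ, η)` into the product
of the two group elements. Differentiate both sides in `η`; the inverse chart has derivative `id` at
`idPt`. -/
theorem mfderiv_symm_leftFrame {ξ : E} (hξ : ξ ∈ (idChart E G).target)
    (Y : GroupLieAlgebra 𝓘(ℝ, E) G) :
    mfderiv 𝓘(ℝ, E) 𝓘(ℝ, E) (idChart E G).symm ξ (leftFrame E G ξ Y)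
      = mulInvariantVectorField Y ((idChart E G).symm ξ) := by
  set x := (idChart E G).symm ξ with hx
  have hdom := mem_chartMulDomain_right (G := G) hξ
  have h1 : HasFDerivAt (fun η : E => chartMul E G (ξ, η)) (leftFrame E G ξ) (idPt E G) :=
    HasFDerivAt.comp (idPt E G) ((contDiffAt_chartMul hdom).differentiableAt (by simp)).hasFDerivAt
      (hasFDerivAt_prodMk_right ξ (idPt E G))
  have e : (fun η : E => (idChart E G).symm (chartMul E G (ξ, η))) =ᶠ[𝓝 (idPt E G)]
      fun η => x * (idChart E G).symm η := by
    have : Tendsto (fun η : E => (ξ, η)) (𝓝 (idPt E G)) (𝓝 (ξ, idPt E G)) :=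
      (Continuous.prodMk_right ξ).tendsto _
    filter_upwards [this (isOpen_chartMulDomain.mem_nhds hdom)] with η hη
    exact (idChart E G).left_inv hη.2.2
  have h2 : HasMFDerivAt 𝓘(ℝ, E) 𝓘(ℝ, E) (idChart E G).symm (chartMul E G (ξ, idPt E G))
      (mfderiv 𝓘(ℝ, E) 𝓘(ℝ, E) (idChart E G).symm ξ) := by
    rw [chartMul_idPt_right hξ]
    exact (mdifferentiableAt_idChart_symm hξ).hasMFDerivAt
  have h3 := h2.comp (idPt E G) h1.hasMFDerivAt
  have h4 : HasMFDerivAt 𝓘(ℝ, E) 𝓘(ℝ, E) (fun z : G => x * z) ((idChart E G).symm (idPt E G))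
      (mfderiv 𝓘(ℝ, E) 𝓘(ℝ, E) (fun z : G => x * z) 1) := by
    rw [idChart_symm_idPt]
    exact (mdifferentiable_mul_left x 1).hasMFDerivAt
  have h5 := h4.comp (idPt E G) (mdifferentiableAt_idChart_symm idPt_mem).hasMFDerivAt
  rw [mfderiv_idChart_symm_idPt] at h5
  have h6 := hasMFDerivAt_unique (h3.congr_of_eventuallyEq e.symm) h5
  exact DFunLike.congr_fun h6 Y

theorem mfderiv_symm_rightFrame {ξ : E} (hξ : ξ ∈ (idChart E G).target) (v : E) :
    mfderiv 𝓘(ℝ, E) 𝓘(ℝ, E) (idChart E G).symm ξ (rightFrame E G ξ v)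
      = mfderiv 𝓘(ℝ, E) 𝓘(ℝ, E) (fun z : G => z * (idChart E G).symm ξ) 1 v := by
  set x := (idChart E G).symm ξ with hx
  have hdom := mem_chartMulDomain_left (G := G) hξ
  have h1 : HasFDerivAt (fun η : E => chartMul E G (η, ξ)) (rightFrame E G ξ) (idPt E G) :=
    HasFDerivAt.comp (f := fun η : E => (η, ξ)) (idPt E G)
      ((contDiffAt_chartMul hdom).differentiableAt (by simp)).hasFDerivAt
      (hasFDerivAt_prodMk_left (idPt E G) ξ)
  have e : (fun η : E => (idChart E G).symm (chartMul E G (η, ξ))) =ᶠ[𝓝 (idPt E G)]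
      fun η => (idChart E G).symm η * x := by
    have : Tendsto (fun η : E => (η, ξ)) (𝓝 (idPt E G)) (𝓝 (idPt E G, ξ)) :=
      (Continuous.prodMk_left ξ).tendsto _
    filter_upwards [this (isOpen_chartMulDomain.mem_nhds hdom)] with η hη
    exact (idChart E G).left_inv hη.2.2
  have h2 : HasMFDerivAt 𝓘(ℝ, E) 𝓘(ℝ, E) (idChart E G).symm (chartMul E G (idPt E G, ξ))
      (mfderiv 𝓘(ℝ, E) 𝓘(ℝ, E) (idChart E G).symm ξ) := by
    rw [chartMul_idPt_left hξ]
    exact (mdifferentiableAt_idChart_symm hξ).hasMFDerivAt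
  have h3 := h2.comp (idPt E G) h1.hasMFDerivAt
  have h4 : HasMFDerivAt 𝓘(ℝ, E) 𝓘(ℝ, E) (fun z : G => z * x) ((idChart E G).symm (idPt E G))
      (mfderiv 𝓘(ℝ, E) 𝓘(ℝ, E) (fun z : G => z * x) 1) := by
    rw [idChart_symm_idPt]
    exact (mdifferentiable_mul_right x 1).hasMFDerivAt
  have h5 := h4.comp (idPt E G) (mdifferentiableAt_idChart_symm idPt_mem).hasMFDerivAt
  rw [mfderiv_idChart_symm_idPt] at h5
  have h6 := hasMFDerivAt_unique (h3.congr_of_eventuallyEq e.symm) h5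
  exact DFunLike.congr_fun h6 v

end LocalCoordinates

end Carnot

end


noncomputable section

namespace Carnot

/-! ### The adjoint representation and its derivative. -/

section Adjoint

variable {E : Type*} [NormedAddCommGroup E] [NormedSpace ℝ E] [FiniteDimensional ℝ E]
  {G : Type*} [TopologicalSpace G] [ChartedSpace E G] [Group G] [LieGroup 𝓘(ℝ, E) ∞ G]

theorem lieGroup_three : LieGroup 𝓘(ℝ, E) (minSmoothness ℝ 3) G :=
  LieGroup.of_le (n := ∞) (by
    rw [minSmoothness_of_isRCLikeNormedField]
    exact WithTop.coe_le_coe.2 (le_top : (3 : ℕ∞) ≤ ⊤))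

variable (G) in
/-- The Lie bracket of `G`, on the model space of its tangent spaces. -/
def modelBracket (v w : E) : E :=
  (⁅(show GroupLieAlgebra 𝓘(ℝ, E) G from v), (show GroupLieAlgebra 𝓘(ℝ, E) G from w)⁆ :
    GroupLieAlgebra 𝓘(ℝ, E) G)

theorem isInvertible_mfderiv_idChart_symm {ξ : E} (hξ : ξ ∈ (idChart E G).target) :
    (mfderiv 𝓘(ℝ, E) 𝓘(ℝ, E) (idChart E G).symm ξ).IsInvertible := by
  have : IsManifold 𝓘(ℝ, E) 1 G := IsManifold.of_le (n := ∞) (by exact mod_cast le_top)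
  have h := isInvertible_mfderivWithin_extChartAt_symm (I := 𝓘(ℝ, E)) (x := (1 : G)) hξ
  rw [show range 𝓘(ℝ, E) = univ from by simp, mfderivWithin_univ] at h
  exact h

theorem mpullback_mulInvariantVectorField_idChart {ξ : E} (hξ : ξ ∈ (idChart E G).target)
    (Y : GroupLieAlgebra 𝓘(ℝ, E) G) :
    VectorField.mpullback 𝓘(ℝ, E) 𝓘(ℝ, E) (idChart E G).symm (mulInvariantVectorField Y) ξ
      = leftFrame E G ξ Y := by
  exact ((isInvertible_mfderiv_idChart_symm hξ).inverse_apply_eq).2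
    (mfderiv_symm_leftFrame hξ Y).symm

/-- The structure equation of the left-invariant frame in the chart at the identity. -/
theorem leftFrame_bracket {ξ : E} (hξ : ξ ∈ (idChart E G).target)
    (Y Z : E) : leftFrame E G ξ (modelBracket G Y Z) = fderiv ℝ (fun η => leftFrame E G η Z) ξ (leftFrame E G ξ Y)
      - fderiv ℝ (fun η => leftFrame E G η Y) ξ (leftFrame E G ξ Z) := by
  have := lieGroup_three (E := E) (G := G)
  have hev : ∀ W : GroupLieAlgebra 𝓘(ℝ, E) G,
      VectorField.mpullback 𝓘(ℝ, E) 𝓘(ℝ, E) (idChart E G).symm (mulInvariantVectorField W)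
        =ᶠ[𝓝 ξ] fun η => leftFrame E G η W := fun W => by
    filter_upwards [isOpen_idChart_target.mem_nhds hξ] with η hη
    exact mpullback_mulInvariantVectorField_idChart hη W
  refine (mpullback_mulInvariantVectorField_idChart hξ _).symm.trans ?_
  rw [modelBracket, GroupLieAlgebra.bracket_def, mulInvariantVector_mlieBracket]
  -- The bracket of vector fields is natural under pullback by the inverse chart, and in the vector
  -- space `E` it is the difference of directional derivatives.
  have key := VectorField.mpullback_mlieBracket (n := (minSmoothness ℝ 3)) (I := 𝓘(ℝ, E)) (I' := 𝓘(ℝ, E))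
    (x₀ := ξ) (f := (idChart E G).symm)
    (mdifferentiableAt_mulInvariantVectorField (I := 𝓘(ℝ, E)) Y)
    (mdifferentiableAt_mulInvariantVectorField (I := 𝓘(ℝ, E)) Z)
    ((contMDiffAt_idChart_symm hξ).of_le (by
      rw [minSmoothness_of_isRCLikeNormedField]
      exact WithTop.coe_le_coe.2 (le_top : (3 : ℕ∞) ≤ ⊤)))
    (minSmoothness_monotone (by norm_cast))
  refine key.trans ?_
  rw [← VectorField.mlieBracketWithin_univ, VectorField.mlieBracketWithin_eq_lieBracketWithin]
  refine (congrFun VectorField.lieBracketWithin_univ ξ).trans ?_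
  exact Filter.EventuallyEq.lieBracket_vectorField_eq (hev Y) (hev Z)

theorem leftFrame_idPt : leftFrame E G (idPt E G) = ContinuousLinearMap.id ℝ E := by
  ext v
  have h := mfderiv_symm_leftFrame (G := G) idPt_mem v
  rw [mfderiv_idChart_symm_idPt] at h
  refine h.trans ?_
  have : (fun z : G => 1 * z) = id := by ext z; simp
  have h2 : mfderiv 𝓘(ℝ, E) 𝓘(ℝ, E) (fun z : G => 1 * z) 1 = ContinuousLinearMap.id ℝ E := by
    rw [this, mfderiv_id]; rfl
  rw [idChart_symm_idPt]
  exact DFunLike.congr_fun h2 v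

theorem rightFrame_idPt : rightFrame E G (idPt E G) = ContinuousLinearMap.id ℝ E := by
  ext v
  have h := mfderiv_symm_rightFrame (G := G) idPt_mem v
  rw [mfderiv_idChart_symm_idPt] at h
  refine h.trans ?_
  rw [idChart_symm_idPt]
  have : (fun z : G => z * 1) = id := by ext z; simp
  rw [this, mfderiv_id]
  rfl

/-- The adjoint representation. -/
def Ad (x : G) : E →L[ℝ] E := mfderiv 𝓘(ℝ, E) 𝓘(ℝ, E) (fun y : G => x * y * x⁻¹) 1

theorem hasMFDerivAt_conj (x : G) :
    HasMFDerivAt 𝓘(ℝ, E) 𝓘(ℝ, E) (fun y : G => x * y * x⁻¹) 1 (Ad (E := E) x) :=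
  (((contMDiff_mul_right (I := 𝓘(ℝ, E)) (n := ∞) (a := x⁻¹)).comp
    (contMDiff_mul_left (I := 𝓘(ℝ, E)) (n := ∞) (a := x))).mdifferentiableAt (by simp)).hasMFDerivAt

theorem Ad_one : Ad (E := E) (1 : G) = ContinuousLinearMap.id ℝ E := by
  have : (fun y : G => 1 * y * 1⁻¹) = id := by ext z; simp
  rw [Ad, this, mfderiv_id]
  rfl

theorem Ad_mul (x y : G) : Ad (E := E) (x * y) = (Ad x).comp (Ad y) := by
  have h1 : HasMFDerivAt 𝓘(ℝ, E) 𝓘(ℝ, E) (fun z : G => x * z * x⁻¹) (y * 1 * y⁻¹) (Ad (E := E) x) := by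
    rw [show y * 1 * y⁻¹ = 1 by group]
    exact hasMFDerivAt_conj x
  have h2 := h1.comp 1 (hasMFDerivAt_conj y)
  have e : (fun z : G => x * z * x⁻¹) ∘ (fun z : G => y * z * y⁻¹)
      = fun z : G => (x * y) * z * (x * y)⁻¹ := by
    ext z; simp [mul_assoc]
  rw [e] at h2
  exact hasMFDerivAt_unique (hasMFDerivAt_conj (x * y)) h2

/-- Since `x z = (x z x⁻¹) x`, a left-invariant field is a combination of right-invariant ones whose
coefficients are the coordinates of `Ad x Y`. This is how left-invariance of the measure will give
information about left-invariant fields. -/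
theorem mulInvariantVectorField_eq_Ad (x : G) (Y : GroupLieAlgebra 𝓘(ℝ, E) G) :
    mulInvariantVectorField Y x
      = mfderiv 𝓘(ℝ, E) 𝓘(ℝ, E) (fun z : G => z * x) 1 (Ad (E := E) x Y) := by
  have h1 : HasMFDerivAt 𝓘(ℝ, E) 𝓘(ℝ, E) (fun z : G => z * x) (x * 1 * x⁻¹)
      (mfderiv 𝓘(ℝ, E) 𝓘(ℝ, E) (fun z : G => z * x) 1) := by
    rw [show x * 1 * x⁻¹ = 1 by group]
    exact (mdifferentiable_mul_right x 1).hasMFDerivAt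
  have h2 := h1.comp 1 (hasMFDerivAt_conj x)
  have e : (fun z : G => z * x) ∘ (fun z : G => x * z * x⁻¹) = fun z : G => x * z := by
    ext z; simp [mul_assoc]
  rw [e] at h2
  have h3 := hasMFDerivAt_unique (mdifferentiable_mul_left x 1).hasMFDerivAt h2
  exact DFunLike.congr_fun h3 Y

theorem leftFrame_eq_rightFrame_comp_Ad {ξ : E} (hξ : ξ ∈ (idChart E G).target) :
    leftFrame E G ξ = (rightFrame E G ξ).comp (Ad ((idChart E G).symm ξ)) := by
  ext v
  have hinj := (isInvertible_mfderiv_idChart_symm (G := G) hξ).bijective.1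
  apply hinj
  have h1 := mfderiv_symm_leftFrame (G := G) hξ v
  have h2 := mfderiv_symm_rightFrame (G := G) hξ (Ad ((idChart E G).symm ξ) v)
  exact h1.trans ((mulInvariantVectorField_eq_Ad _ _).trans h2.symm)

theorem hasFDerivAt_leftFrame_idPt (w : E) :
    HasFDerivAt (fun ξ => leftFrame E G ξ w)
      (((fderiv ℝ (fderiv ℝ (chartMul E G)) (idPt E G, idPt E G)).flip (0, w)).comp
        (ContinuousLinearMap.inl ℝ E E)) (idPt E G) := by
  have h0 := (contDiffAt_fderiv_chartMul
    (mem_chartMulDomain_right (E := E) (G := G) idPt_mem)).differentiableAt (by simp)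
  have h1 := HasFDerivAt.comp (f := fun η : E => (η, idPt E G)) (idPt E G) h0.hasFDerivAt
      (hasFDerivAt_prodMk_left (idPt E G) (idPt E G))
  exact (h1.clm_apply (hasFDerivAt_const ((0 : E), w) _)).congr_fderiv (by ext v; simp)

theorem hasFDerivAt_rightFrame_idPt (w : E) :
    HasFDerivAt (fun ξ => rightFrame E G ξ w)
      (((fderiv ℝ (fderiv ℝ (chartMul E G)) (idPt E G, idPt E G)).flip (w, 0)).comp
        (ContinuousLinearMap.inr ℝ E E)) (idPt E G) := by
  have h0 := (contDiffAt_fderiv_chartMul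
    (mem_chartMulDomain_right (E := E) (G := G) idPt_mem)).differentiableAt (by simp)
  have h1 := HasFDerivAt.comp (f := fun η : E => (idPt E G, η)) (idPt E G) h0.hasFDerivAt
      (hasFDerivAt_prodMk_right (idPt E G) (idPt E G))
  exact (h1.clm_apply (hasFDerivAt_const (w, (0 : E)) _)).congr_fderiv (by ext v; simp)

/-- In the chart `Ad = R⁻¹ L` for the right and left frames `R`, `L`. Both are smooth, and operator
inversion is smooth at `R = id`. -/
theorem contDiffAt_Ad_symm : ContDiffAt ℝ ∞ (fun ξ : E => Ad (E := E) ((idChart E G).symm ξ))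
    (idPt E G) := by
  have hR : ContDiffAt ℝ ∞ (rightFrame E G) (idPt E G) :=
    contDiffOn_rightFrame.contDiffAt (isOpen_idChart_target.mem_nhds idPt_mem)
  have hB : ContDiffAt ℝ ∞ (leftFrame E G) (idPt E G) :=
    contDiffOn_leftFrame.contDiffAt (isOpen_idChart_target.mem_nhds idPt_mem)
  have hinv : ContDiffAt ℝ ∞ (fun ξ : E => (rightFrame E G ξ).inverse) (idPt E G) := by
    refine ContDiffAt.comp (g := ContinuousLinearMap.inverse) (idPt E G) ?_ hR
    rw [rightFrame_idPt]
    exact contDiffAt_map_inverse (ContinuousLinearEquiv.refl ℝ E)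
  refine (hinv.clm_comp hB).congr_of_eventuallyEq ?_
  have hinvt : ∀ᶠ ξ in 𝓝 (idPt E G), (rightFrame E G ξ).IsInvertible := by
    have : {f : E →L[ℝ] E | f.IsInvertible} ∈ 𝓝 (rightFrame E G (idPt E G)) := by
      rw [rightFrame_idPt]
      exact ContinuousLinearEquiv.nhds (ContinuousLinearEquiv.refl ℝ E)
    exact hR.continuousAt this
  filter_upwards [hinvt, isOpen_idChart_target.mem_nhds idPt_mem] with ξ hi hξ
  rw [leftFrame_eq_rightFrame_comp_Ad hξ, ← ContinuousLinearMap.comp_assoc,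
    hi.inverse_comp_self, ContinuousLinearMap.id_comp]

/-- The derivative of the adjoint representation at the identity is the bracket. -/
theorem hasFDerivAt_Ad_symm (w : E) :
    ∃ L : E →L[ℝ] E, HasFDerivAt (fun ξ : E => Ad (E := E) ((idChart E G).symm ξ) w) L (idPt E G) ∧
      ∀ v : E, L v = modelBracket G v w := by
  set A := fun ξ : E => Ad (E := E) ((idChart E G).symm ξ) with hAdef
  have hA : HasFDerivAt A (fderiv ℝ A (idPt E G)) (idPt E G) :=
    (contDiffAt_Ad_symm.differentiableAt (by simp)).hasFDerivAt
  refine ⟨(fderiv ℝ A (idPt E G)).flip w, ?_, fun v => ?_⟩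
  · exact (hA.clm_apply (hasFDerivAt_const w _)).congr_fderiv (by ext v; simp)
  have hR : HasFDerivAt (rightFrame E G) (fderiv ℝ (rightFrame E G) (idPt E G)) (idPt E G) :=
    ((contDiffOn_rightFrame.contDiffAt (isOpen_idChart_target.mem_nhds idPt_mem)).differentiableAt
      (by simp)).hasFDerivAt
  have hA0 : A (idPt E G) = ContinuousLinearMap.id ℝ E := by
    simp only [hAdef, idChart_symm_idPt, Ad_one]
  have h1 := hR.clm_apply (hA.clm_apply (hasFDerivAt_const w (idPt E G)))
  -- Differentiating `L = R ∘ Ad` at the identity gives `D Ad(v) w = DL(v) w - DR(v) w`. Both terms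
  -- on the right are mixed second derivatives of the multiplication; their symmetry gives `DR(v) w
  -- = DL(w) v`, and the structure equation identifies the difference with the bracket.
  have h2 : HasFDerivAt (fun ξ => leftFrame E G ξ w) _ (idPt E G) :=
    h1.congr_of_eventuallyEq (by
      filter_upwards [isOpen_idChart_target.mem_nhds idPt_mem] with ξ hξ
      rw [leftFrame_eq_rightFrame_comp_Ad hξ]; rfl)
  have h3 := DFunLike.congr_fun (h2.unique (hasFDerivAt_leftFrame_idPt w)) v
  have h4 : fderiv ℝ (rightFrame E G) (idPt E G) v w =
      fderiv ℝ (fderiv ℝ (chartMul E G)) (idPt E G, idPt E G) (0, v) (w, 0) := by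
    have := DFunLike.congr_fun (((hR.clm_apply (hasFDerivAt_const w (idPt E G)))).unique
      (hasFDerivAt_rightFrame_idPt w)) v
    simpa [ContinuousLinearMap.comp_apply] using this
  have hsymm : IsSymmSndFDerivAt ℝ (chartMul E G) (idPt E G, idPt E G) :=
    (contDiffAt_chartMul (mem_chartMulDomain_right (G := G) idPt_mem)).isSymmSndFDerivAt
      (by rw [minSmoothness_of_isRCLikeNormedField]
          exact WithTop.coe_le_coe.2 (le_top : (2 : ℕ∞) ≤ ⊤))
  have h5 := leftFrame_bracket (G := G) idPt_mem v w
  rw [(hasFDerivAt_leftFrame_idPt w).fderiv, (hasFDerivAt_leftFrame_idPt v).fderiv,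
    leftFrame_idPt] at h5
  simp [hA0, rightFrame_idPt, h4] at h3 h5
  have h6 := hsymm.eq (0, v) (w, 0)
  change fderiv ℝ A (idPt E G) v w = _
  rw [h5, ← h6, ← h3]
  abel

end Adjoint

end Carnot

end


noncomputable section

namespace Carnot

/-! ### Derivatives along invariant fields, computed with curves through the identity. -/

section Curves

variable {E : Type*} [NormedAddCommGroup E] [NormedSpace ℝ E] [FiniteDimensional ℝ E]
  {G : Type*} [TopologicalSpace G] [ChartedSpace E G] [Group G]

variable (G) in
theorem exists_coordCurve (v : E) : ∃ γ : ℝ → E, ContDiff ℝ ∞ γ ∧ γ 0 = idPt E G ∧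
    HasDerivAt γ v 0 ∧ ∀ s, γ s ∈ (idChart E G).target := by
  have hc : Tendsto (fun t : ℝ => idPt E G + t • v) (𝓝 0) (𝓝 (idPt E G)) := by
    have : Continuous fun t : ℝ => idPt E G + t • v := by fun_prop
    simpa using this.tendsto 0
  obtain ⟨ε, hε, hball⟩ := Metric.eventually_nhds_iff.1
    (hc (isOpen_idChart_target.mem_nhds (idPt_mem (E := E) (G := G))))
  -- The sine keeps the curve inside the chart for all times. Only the velocity at `0` matters, so
  -- this replaces the exponential map.
  refine ⟨fun s => idPt E G + (ε / 2 * Real.sin (s / (ε / 2))) • v, ?_, by simp, ?_, fun s => ?_⟩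
  · have : ContDiff ℝ ∞ fun s : ℝ => Real.sin (s / (ε / 2)) :=
      Real.contDiff_sin.comp (contDiff_id.div_const _)
    exact contDiff_const.add ((contDiff_const.mul this).smul contDiff_const)
  · have h1 : HasDerivAt (fun s : ℝ => s / (ε / 2)) (1 / (ε / 2)) 0 :=
      (hasDerivAt_id 0).div_const _
    have h2 := ((h1.sin.const_mul (ε / 2)).smul_const v).const_add (idPt E G)
    refine h2.congr_deriv ?_
    simp [hε.ne']
  · apply hball
    rw [dist_zero_right, Real.norm_eq_abs, abs_mul, abs_of_pos (half_pos hε)]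
    have := Real.abs_sin_le_one (s / (ε / 2))
    nlinarith

variable (G) in
/-- A smooth curve in the chart at the identity, with velocity `v` at the identity. -/
def coordCurve (v : E) : ℝ → E := (exists_coordCurve G v).choose

variable (G) in
/-- A smooth curve in `G`, with velocity `v` at the identity. -/
def idCurve (v : E) (s : ℝ) : G := (idChart E G).symm (coordCurve G v s)

theorem contDiff_coordCurve (v : E) : ContDiff ℝ ∞ (coordCurve G v) :=
  (exists_coordCurve G v).choose_spec.1

theorem coordCurve_zero (v : E) : coordCurve G v 0 = idPt E G :=
  (exists_coordCurve G v).choose_spec.2.1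

theorem hasDerivAt_coordCurve (v : E) : HasDerivAt (coordCurve G v) v 0 :=
  (exists_coordCurve G v).choose_spec.2.2.1

theorem coordCurve_mem (v : E) (s : ℝ) : coordCurve G v s ∈ (idChart E G).target :=
  (exists_coordCurve G v).choose_spec.2.2.2 s

@[simp] theorem idCurve_zero (v : E) : idCurve G v 0 = 1 := by
  rw [idCurve, coordCurve_zero, idChart_symm_idPt]

variable [LieGroup 𝓘(ℝ, E) ∞ G]

theorem contMDiff_idCurve (v : E) : ContMDiff 𝓘(ℝ, ℝ) 𝓘(ℝ, E) ∞ (idCurve G v) := fun s =>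
  (contMDiffAt_idChart_symm (coordCurve_mem v s)).comp s (contDiff_coordCurve v).contMDiff.contMDiffAt

theorem hasMFDerivAt_idCurve (v : E) :
    HasMFDerivAt 𝓘(ℝ, ℝ) 𝓘(ℝ, E) (idCurve G v) 0 (ContinuousLinearMap.toSpanSingleton ℝ v) := by
  have h1 : HasMFDerivAt 𝓘(ℝ, E) 𝓘(ℝ, E) (idChart E G).symm (coordCurve G v 0)
      (ContinuousLinearMap.id ℝ E) := by
    rw [coordCurve_zero, ← mfderiv_idChart_symm_idPt (G := G)]
    exact (mdifferentiableAt_idChart_symm idPt_mem).hasMFDerivAt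
  exact h1.comp 0 (hasDerivAt_coordCurve (G := G) v).hasFDerivAt.hasMFDerivAt

variable {W : Type*} [NormedAddCommGroup W] [NormedSpace ℝ W]

theorem hasDerivAt_mul_idCurve {f : G → W} {x : G} (hf : MDifferentiableAt 𝓘(ℝ, E) 𝓘(ℝ, W) f x)
    (v : E) : HasDerivAt (fun s => f (x * idCurve G v s))
      (mfderiv 𝓘(ℝ, E) 𝓘(ℝ, W) f x (mulInvariantVectorField (G := G) (I := 𝓘(ℝ, E)) v x)) 0 := by
  have h1 : HasMFDerivAt 𝓘(ℝ, E) 𝓘(ℝ, E) (fun z : G => x * z) (idCurve G v 0)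
      (mfderiv 𝓘(ℝ, E) 𝓘(ℝ, E) (fun z : G => x * z) 1) := by
    rw [idCurve_zero]; exact (mdifferentiable_mul_left x 1).hasMFDerivAt
  have h2 : HasMFDerivAt 𝓘(ℝ, E) 𝓘(ℝ, W) f (x * idCurve G v 0) (mfderiv 𝓘(ℝ, E) 𝓘(ℝ, W) f x) := by
    rw [idCurve_zero, mul_one]; exact hf.hasMFDerivAt
  let L₁ : ℝ →L[ℝ] E := ContinuousLinearMap.toSpanSingleton ℝ v
  let L₂ : E →L[ℝ] E := mfderiv 𝓘(ℝ, E) 𝓘(ℝ, E) (fun z : G => x * z) 1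
  let L₃ : E →L[ℝ] W := mfderiv 𝓘(ℝ, E) 𝓘(ℝ, W) f x
  have h3 : HasFDerivAt (fun s => f (x * idCurve G v s)) (L₃.comp (L₂.comp L₁)) 0 :=
    (h2.comp 0 (h1.comp 0 (hasMFDerivAt_idCurve v))).hasFDerivAt
  refine h3.hasDerivAt.congr_deriv ?_
  change L₃ (L₂ (L₁ 1)) = _
  rw [show L₁ 1 = v from ContinuousLinearMap.toSpanSingleton_apply_one ℝ v]
  rfl

/-- The derivative of `f` along the right-invariant vector field with value `v` at the identity. -/
def rightDeriv (v : E) (f : G → W) (x : G) : W :=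
  mfderiv 𝓘(ℝ, E) 𝓘(ℝ, W) f x (mfderiv 𝓘(ℝ, E) 𝓘(ℝ, E) (fun z : G => z * x) 1 v)

theorem hasDerivAt_idCurve_mul {f : G → W} {x : G} (hf : MDifferentiableAt 𝓘(ℝ, E) 𝓘(ℝ, W) f x)
    (v : E) : HasDerivAt (fun s => f (idCurve G v s * x)) (rightDeriv v f x) 0 := by
  have h1 : HasMFDerivAt 𝓘(ℝ, E) 𝓘(ℝ, E) (fun z : G => z * x) (idCurve G v 0)
      (mfderiv 𝓘(ℝ, E) 𝓘(ℝ, E) (fun z : G => z * x) 1) := by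
    rw [idCurve_zero]; exact (mdifferentiable_mul_right x 1).hasMFDerivAt
  have h2 : HasMFDerivAt 𝓘(ℝ, E) 𝓘(ℝ, W) f (idCurve G v 0 * x) (mfderiv 𝓘(ℝ, E) 𝓘(ℝ, W) f x) := by
    rw [idCurve_zero, one_mul]; exact hf.hasMFDerivAt
  let L₁ : ℝ →L[ℝ] E := ContinuousLinearMap.toSpanSingleton ℝ v
  let L₂ : E →L[ℝ] E := mfderiv 𝓘(ℝ, E) 𝓘(ℝ, E) (fun z : G => z * x) 1
  let L₃ : E →L[ℝ] W := mfderiv 𝓘(ℝ, E) 𝓘(ℝ, W) f x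
  have h3 : HasFDerivAt (fun s => f (idCurve G v s * x)) (L₃.comp (L₂.comp L₁)) 0 :=
    (h2.comp 0 (h1.comp 0 (hasMFDerivAt_idCurve v))).hasFDerivAt
  refine h3.hasDerivAt.congr_deriv ?_
  change L₃ (L₂ (L₁ 1)) = _
  rw [show L₁ 1 = v from ContinuousLinearMap.toSpanSingleton_apply_one ℝ v]
  rfl

theorem hasDerivAt_invDeriv {f : G → ℂ} {x : G} (hf : MDifferentiableAt 𝓘(ℝ, E) 𝓘(ℝ, ℂ) f x)
    (Y : GroupLieAlgebra 𝓘(ℝ, E) G) :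
    HasDerivAt (fun s => f (x * idCurve G (E := E) Y s)) (invDeriv Y f x) 0 :=
  hasDerivAt_mul_idCurve hf Y

theorem invDeriv_mul {f g : G → ℂ} {x : G} (hf : MDifferentiableAt 𝓘(ℝ, E) 𝓘(ℝ, ℂ) f x)
    (hg : MDifferentiableAt 𝓘(ℝ, E) 𝓘(ℝ, ℂ) g x) (hfg : MDifferentiableAt 𝓘(ℝ, E) 𝓘(ℝ, ℂ) (fun x => f x * g x) x)
    (Y : GroupLieAlgebra 𝓘(ℝ, E) G) :
    invDeriv Y (fun x => f x * g x) x = invDeriv Y f x * g x + f x * invDeriv Y g x := by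
  have h := (hasDerivAt_invDeriv hf Y).mul (hasDerivAt_invDeriv hg Y)
  have h' := (hasDerivAt_invDeriv hfg Y).unique h
  have e : x * idCurve G (E := E) Y 0 = x := by
    rw [show idCurve G (E := E) Y 0 = 1 from idCurve_zero (E := E) Y, mul_one]
  simpa only [e] using h'

theorem invDeriv_comp_mul_left {f : G → ℂ} (hf : ContMDiff 𝓘(ℝ, E) 𝓘(ℝ, ℂ) ∞ f) (g x : G)
    (Y : GroupLieAlgebra 𝓘(ℝ, E) G) :
    invDeriv Y (fun x => f (g * x)) x = invDeriv Y f (g * x) := by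
  have h1 : ContMDiff 𝓘(ℝ, E) 𝓘(ℝ, ℂ) ∞ (fun x => f (g * x)) := hf.comp contMDiff_mul_left
  have h2 := hasDerivAt_invDeriv (h1.mdifferentiableAt (by simp) (x := x)) Y
  have h3 := hasDerivAt_invDeriv (hf.mdifferentiableAt (by simp) (x := g * x)) Y
  refine h2.unique ?_
  simpa only [mul_assoc] using h3

end Curves

end Carnot

end


noncomputable section

namespace Carnot

/-! ### Left-invariant fields are divergence free when `ad` is traceless. -/

section Unimodular

variable {E : Type*} [NormedAddCommGroup E] [NormedSpace ℝ E] [FiniteDimensional ℝ E]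
  {G : Type*} [TopologicalSpace G] [ChartedSpace E G] [Group G] [LieGroup 𝓘(ℝ, E) ∞ G]
  {W : Type*} [NormedAddCommGroup W] [NormedSpace ℝ W]

theorem isManifold_one : IsManifold 𝓘(ℝ, E) 1 G :=
  IsManifold.of_le (n := ∞) (by exact mod_cast le_top)

/-- A function that is `C¹` on `ℝ × G` has a jointly continuous derivative in the real variable. -/
theorem exists_continuous_hasDerivAt_fst {Φ : ℝ × G → W}
    (hΦ : ContMDiff (𝓘(ℝ, ℝ).prod 𝓘(ℝ, E)) 𝓘(ℝ, W) 1 Φ) :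
    ∃ D : ℝ × G → W, Continuous D ∧ ∀ s x, HasDerivAt (fun t => Φ (t, x)) (D (s, x)) s := by
  have := isManifold_one (E := E) (G := G)
  -- The field `∂/∂s` on `ℝ × G` as a continuous section; the derivative sought is the tangent map
  -- of `Φ` along it.
  let σ : ℝ × G → TangentBundle (𝓘(ℝ, ℝ).prod 𝓘(ℝ, E)) (ℝ × G) := fun p =>
    (equivTangentBundleProd 𝓘(ℝ, ℝ) ℝ 𝓘(ℝ, E) G).symm
      (⟨p.1, (1 : ℝ)⟩, Bundle.TotalSpace.mk' E p.2 0)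
  have hσ : Continuous σ := by
    have h1 : Continuous (fun p : ℝ × G => (⟨p.1, (1 : ℝ)⟩ : TangentBundle 𝓘(ℝ, ℝ) ℝ)) :=
      (tangentBundleModelSpaceHomeomorph 𝓘(ℝ, ℝ)).symm.continuous.comp
        (continuous_fst.prodMk continuous_const)
    have h2 : Continuous (fun p : ℝ × G => (Bundle.TotalSpace.mk' E p.2 0 : TangentBundle 𝓘(ℝ, E) G)) :=
      (Bundle.contMDiff_zeroSection ℝ (TangentSpace 𝓘(ℝ, E) (M := G)) (n := 0)
        (IB := 𝓘(ℝ, E))).continuous.comp continuous_snd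
    exact (contMDiff_equivTangentBundleProd_symm (n := 0)).continuous.comp (h1.prodMk h2)
  let D : ℝ × G → W := fun p =>
    mfderiv (𝓘(ℝ, ℝ).prod 𝓘(ℝ, E)) 𝓘(ℝ, W) Φ p ((1 : ℝ), (0 : E))
  refine ⟨D, ?_, fun s x => ?_⟩
  · have h2 : Continuous (tangentMap (𝓘(ℝ, ℝ).prod 𝓘(ℝ, E)) 𝓘(ℝ, W) Φ) :=
      hΦ.continuous_tangentMap le_rfl
    exact ((tangentBundleModelSpaceHomeomorph 𝓘(ℝ, W)).continuous.comp (h2.comp hσ)).snd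
  · have h1 : HasMFDerivAt (𝓘(ℝ, ℝ).prod 𝓘(ℝ, E)) 𝓘(ℝ, W) Φ (s, x)
        (mfderiv (𝓘(ℝ, ℝ).prod 𝓘(ℝ, E)) 𝓘(ℝ, W) Φ (s, x)) :=
      (hΦ.mdifferentiableAt (by simp)).hasMFDerivAt
    have h2 : HasMFDerivAt 𝓘(ℝ, ℝ) (𝓘(ℝ, ℝ).prod 𝓘(ℝ, E)) (fun t : ℝ => (t, x)) s
        ((ContinuousLinearMap.id ℝ ℝ).prod (0 : ℝ →L[ℝ] E)) :=
      (hasMFDerivAt_id s).prodMk (hasMFDerivAt_const x s)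
    let L : ℝ × E →L[ℝ] W := mfderiv (𝓘(ℝ, ℝ).prod 𝓘(ℝ, E)) 𝓘(ℝ, W) Φ (s, x)
    have h3 : HasFDerivAt (fun t => Φ (t, x))
        (L.comp ((ContinuousLinearMap.id ℝ ℝ).prod (0 : ℝ →L[ℝ] E))) s :=
      (h1.comp s h2).hasFDerivAt
    exact h3.hasDerivAt

variable [MeasurableSpace G] [BorelSpace G] {μ : Measure G}

/-- Differentiation under the integral sign of a left-invariant integral. -/
theorem integral_rightDeriv_eq_zero [T2Space G] [SecondCountableTopology G] [μ.IsHaarMeasure] (v : E) {f : G → ℂ}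
    (hf : ContMDiff 𝓘(ℝ, E) 𝓘(ℝ, ℂ) 1 f) (hc : HasCompactSupport f) :
    Continuous (rightDeriv v f) ∧ HasCompactSupport (rightDeriv v f) ∧
      ∫ x, rightDeriv v f x ∂μ = 0 := by
  have : IsTopologicalGroup G := topologicalGroup_of_lieGroup 𝓘(ℝ, E) ∞
  have := isManifold_one (E := E) (G := G)
  let c := idCurve G v
  have hcs : Continuous c := (contMDiff_idCurve v).continuous
  have hΦ : ContMDiff (𝓘(ℝ, ℝ).prod 𝓘(ℝ, E)) 𝓘(ℝ, ℂ) 1 (fun p : ℝ × G => f (c p.1 * p.2)) :=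
    hf.comp (ContMDiff.of_le (((contMDiff_idCurve v).comp contMDiff_fst).mul contMDiff_snd)
      (by exact mod_cast le_top))
  obtain ⟨D, hD, hderiv⟩ := exists_continuous_hasDerivAt_fst hΦ
  have hD0 : ∀ x, D (0, x) = rightDeriv v f x := fun x =>
    (hderiv 0 x).unique (hasDerivAt_idCurve_mul (hf.mdifferentiableAt (by simp)) v)
  -- For `|s| ≤ 1` all the functions `x ↦ f (c s * x)` are supported in this one compact set, which
  -- provides the dominating function.
  let K : Set G := (fun p : ℝ × G => (c p.1)⁻¹ * p.2) '' (Icc (-1) 1 ×ˢ tsupport f)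
  have hK : IsCompact K := (isCompact_Icc.prod hc.isCompact).image (by fun_prop)
  have hzero : ∀ x, x ∉ K → ∀ s ∈ Metric.ball (0 : ℝ) 1, D (s, x) = 0 := by
    intro x hx s hs
    have : (fun t => f (c t * x)) =ᶠ[𝓝 s] fun _ => 0 := by
      filter_upwards [Metric.isOpen_ball.mem_nhds hs] with t ht
      by_contra h
      apply hx
      rw [mem_ball_zero_iff, Real.norm_eq_abs, abs_lt] at ht
      exact ⟨(t, c t * x), ⟨⟨ht.1.le, ht.2.le⟩, subset_tsupport _ h⟩, by simp⟩
    exact (hderiv s x).unique ((hasDerivAt_const s (0 : ℂ)).congr_of_eventuallyEq this)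
  obtain ⟨C, hC⟩ := (isCompact_Icc (a := (-1 : ℝ)) (b := 1)).prod hK |>.exists_bound_of_continuousOn
    hD.continuousOn
  have hcont : Continuous (rightDeriv v f) := by
    have : Continuous fun x => D (0, x) := hD.comp (by fun_prop)
    simpa only [hD0] using this
  have hsupp : HasCompactSupport (rightDeriv v f) := by
    refine HasCompactSupport.intro hK fun x hx => ?_
    rw [← hD0]
    exact hzero x hx 0 (by simp)
  refine ⟨hcont, hsupp, ?_⟩
  have hmain := hasDerivAt_integral_of_dominated_loc_of_deriv_le (μ := μ)
    (F := fun s x => f (c s * x)) (F' := fun s x => D (s, x)) (x₀ := (0 : ℝ))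
    (bound := K.indicator fun _ => C) (s := Metric.ball 0 1)
    (Metric.ball_mem_nhds _ one_pos)
    (Eventually.of_forall fun s => (hf.continuous.comp (by fun_prop)).aestronglyMeasurable)
    (by
      simp only [c, idCurve_zero, one_mul]
      exact hf.continuous.integrable_of_hasCompactSupport hc)
    (hD.comp (by fun_prop)).aestronglyMeasurable
    (Eventually.of_forall fun x s hs => by
      by_cases hx : x ∈ K
      · rw [indicator_of_mem hx]
        rw [mem_ball_zero_iff, Real.norm_eq_abs, abs_lt] at hs
        exact hC (s, x) ⟨⟨hs.1.le, hs.2.le⟩, hx⟩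
      · rw [hzero x hx s hs, indicator_of_notMem hx, norm_zero])
    ((integrable_indicator_iff hK.measurableSet).2 (integrableOn_const hK.measure_lt_top.ne))
    (Eventually.of_forall fun x s _ => hderiv s x)
  -- Moving along a right-invariant field is a left translation, so the integral does not depend on
  -- `s`.
  have hconst : (fun s => ∫ x, f (c s * x) ∂μ) = fun _ => ∫ x, f x ∂μ := by
    ext s
    exact integral_mul_left_eq_self f (c s)
  rw [hconst] at hmain
  have h := hmain.2.unique (hasDerivAt_const (0 : ℝ) (∫ x, f x ∂μ))
  simpa only [hD0] using h

/-- Smoothness at the identity spreads to `x₀` through `Ad x = Ad (x x₀⁻¹) ∘ Ad x₀`. -/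
theorem contMDiff_Ad : ContMDiff 𝓘(ℝ, E) 𝓘(ℝ, E →L[ℝ] E) ∞ (Ad (E := E) (G := G)) := by
  have h1 : ContMDiffAt 𝓘(ℝ, E) 𝓘(ℝ, E →L[ℝ] E) ∞ (Ad (E := E) (G := G)) 1 := by
    have h : ContMDiffAt 𝓘(ℝ, E) 𝓘(ℝ, E →L[ℝ] E) ∞
        (fun x : G => Ad (E := E) ((idChart E G).symm (idChart E G x))) 1 :=
      (contDiffAt_Ad_symm (E := E) (G := G)).contMDiffAt.comp (1 : G)
        (contMDiffAt_idChart (mem_extChartAt_source 1))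
    refine h.congr_of_eventuallyEq ?_
    filter_upwards [extChartAt_source_mem_nhds (I := 𝓘(ℝ, E)) (1 : G)] with x hx
    rw [(idChart E G).left_inv hx]
  intro x₀
  have h2 : ContMDiffAt 𝓘(ℝ, E) 𝓘(ℝ, E →L[ℝ] E) ∞ (fun x : G => Ad (E := E) (x * x₀⁻¹)) x₀ := by
    have h1' : ContMDiffAt 𝓘(ℝ, E) 𝓘(ℝ, E →L[ℝ] E) ∞ (Ad (E := E) (G := G)) (x₀ * x₀⁻¹) := by
      rwa [mul_inv_cancel]
    exact h1'.comp x₀ contMDiff_mul_right.contMDiffAt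
  have h3 : ContMDiffAt 𝓘(ℝ, E) 𝓘(ℝ, E →L[ℝ] E) ∞
      (fun x : G => (Ad (E := E) (x * x₀⁻¹)).comp (Ad (E := E) x₀)) x₀ :=
    h2.clm_comp contMDiffAt_const
  refine h3.congr_of_eventuallyEq (Eventually.of_forall fun x => ?_)
  simp only [← Ad_mul, inv_mul_cancel_right]

theorem hasDerivAt_Ad_idCurve_mul (v w : E) (x : G) :
    HasDerivAt (fun s => Ad (E := E) (idCurve G v s * x) w)
      (modelBracket G v (Ad (E := E) x w)) 0 := by
  obtain ⟨L, hL, hLv⟩ := hasFDerivAt_Ad_symm (G := G) (Ad (E := E) x w)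
  rw [← coordCurve_zero v] at hL
  have h := hL.comp_hasDerivAt (0 : ℝ) (hasDerivAt_coordCurve (G := G) v)
  rw [hLv] at h
  refine h.congr_of_eventuallyEq (Eventually.of_forall fun s => ?_)
  change Ad (E := E) (idCurve G v s * x) w = Ad (E := E) (idCurve G v s) (Ad (E := E) x w)
  rw [Ad_mul]
  rfl

/-- If the adjoint representation of the Lie algebra is traceless, then left-invariant vector fields
are divergence free for Haar measure. -/
theorem integral_invDeriv_eq_zero [T2Space G] [SecondCountableTopology G] [μ.IsHaarMeasure]
    {ι : Type*} [Fintype ι] (e : Module.Basis ι ℝ E)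
    (htr : ∀ w : E, ∑ i, e.coord i (modelBracket G (e i) w) = 0)
    (Y : GroupLieAlgebra 𝓘(ℝ, E) G) {f : G → ℂ}
    (hf : ContMDiff 𝓘(ℝ, E) 𝓘(ℝ, ℂ) ∞ f) (hc : HasCompactSupport f) :
    ∫ x, invDeriv Y f x ∂μ = 0 := by
  -- Write `Y = ∑ bᵢ Rᵢ` with right-invariant `Rᵢ`. The sum `∑ Rᵢ bᵢ` is the trace in `htr` at `w =
  -- Ad x Y`, hence zero. So `Y f = ∑ Rᵢ (bᵢ f)`, and every summand has integral zero.
  let b : ι → G → ℝ := fun i x => e.coord i (Ad (E := E) x Y)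
  have hb : ∀ i, ContMDiff 𝓘(ℝ, E) 𝓘(ℝ, ℝ) ∞ (b i) := fun i => by
    have h1 : ContMDiff 𝓘(ℝ, E) 𝓘(ℝ, E) ∞ (fun x : G => Ad (E := E) x (Y : E)) :=
      contMDiff_Ad.clm_apply contMDiff_const
    exact (LinearMap.toContinuousLinearMap (e.coord i)).contDiff.contMDiff.comp h1
  have hbf : ∀ i, ContMDiff 𝓘(ℝ, E) 𝓘(ℝ, ℂ) ∞ (fun x => b i x • f x) := fun i => (hb i).smul hf
  have hfd : ∀ x, MDifferentiableAt 𝓘(ℝ, E) 𝓘(ℝ, ℂ) f x := fun x => hf.mdifferentiableAt (by simp)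
  have h1 : ∀ x, invDeriv Y f x = ∑ i, b i x • rightDeriv (e i) f x := by
    intro x
    have hY : (Ad (E := E) x (Y : E)) = ∑ i, b i x • e i := (e.sum_repr _).symm
    let L₂ : E →L[ℝ] E := mfderiv 𝓘(ℝ, E) 𝓘(ℝ, E) (fun z : G => z * x) 1
    let L₃ : E →L[ℝ] ℂ := mfderiv 𝓘(ℝ, E) 𝓘(ℝ, ℂ) f x
    have h2 : invDeriv Y f x = L₃ (L₂ (Ad (E := E) x (Y : E))) :=
      congrArg L₃ (mulInvariantVectorField_eq_Ad x Y)
    rw [h2, hY]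
    simp only [map_sum, map_smul]
    rfl
  have h2 : ∀ i x, rightDeriv (e i) (fun x => b i x • f x) x = b i x • rightDeriv (e i) f x
      + e.coord i (modelBracket G (e i) (Ad (E := E) x (Y : E))) • f x := by
    intro i x
    have hd1 := hasDerivAt_idCurve_mul (E := E) ((hbf i).mdifferentiableAt (by simp) (x := x)) (e i)
    have hd2 := hasDerivAt_idCurve_mul (hfd x) (e i)
    have hd3 : HasDerivAt (fun s => b i (idCurve G (e i) s * x))
        (e.coord i (modelBracket G (e i) (Ad (E := E) x (Y : E)))) 0 :=
      (LinearMap.toContinuousLinearMap (e.coord i)).hasFDerivAt.comp_hasDerivAt (0 : ℝ)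
        (hasDerivAt_Ad_idCurve_mul (e i) (Y : E) x)
    have := hd1.unique (hd3.smul hd2)
    simpa only [idCurve_zero, one_mul] using this
  have h3 : ∀ x, invDeriv Y f x = ∑ i, rightDeriv (e i) (fun x => b i x • f x) x := by
    intro x
    simp only [h1, h2, Finset.sum_add_distrib, ← Finset.sum_smul, htr, zero_smul, add_zero]
  have h4 := fun i => integral_rightDeriv_eq_zero (μ := μ) (e i)
    ((hbf i).of_le (by exact mod_cast le_top)) (hc.smul_left (f' := f) (f := b i))
  simp only [h3]
  rw [integral_finsetSum _ fun i _ => (h4 i).1.integrable_of_hasCompactSupport (h4 i).2.1]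
  exact Finset.sum_eq_zero fun i _ => (h4 i).2.2

end Unimodular

end Carnot

end


noncomputable section

namespace Carnot

/-! ### Stratified Lie algebras: traceless `ad`, functionals vanishing on brackets. -/

section LieAlgebras

/-- `IsStratification` for an abstract Lie algebra. -/
structure IsLieStratification {L : Type*} [LieRing L] [LieAlgebra ℝ L] (r : ℕ)
    (V : ℕ → Submodule ℝ L) : Prop where
  one_le : 1 ≤ r
  isInternal : DirectSum.IsInternal (fun i : Fin r => V ((i : ℕ) + 1))
  bracket_eq : ∀ j : ℕ, 1 ≤ j → j < r →
    V (j + 1) = Submodule.span ℝ {z | ∃ x ∈ V 1, ∃ y ∈ V j, z = ⁅x, y⁆}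
  bracket_last : ∀ x ∈ V 1, ∀ y ∈ V r, ⁅x, y⁆ = 0

variable {L : Type*} [LieRing L] [LieAlgebra ℝ L] {r : ℕ} {V : ℕ → Submodule ℝ L}

namespace IsLieStratification

theorem iSup_eq_top (h : IsLieStratification r V) : ⨆ i : Fin r, V ((i : ℕ) + 1) = ⊤ :=
  h.isInternal.submodule_iSup_eq_top

theorem mem_of_layers (h : IsLieStratification r V) {p : Submodule ℝ L}
    (hp : ∀ j, 1 ≤ j → j ≤ r → V j ≤ p) (x : L) : x ∈ p := by
  have : (⊤ : Submodule ℝ L) ≤ p := by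
    rw [← h.iSup_eq_top]
    exact iSup_le fun i => hp _ (by omega) (by omega)
  exact this trivial

theorem lie_mem (h : IsLieStratification r V) {j : ℕ} (h1 : 1 ≤ j) (hr : j < r) {x y : L}
    (hx : x ∈ V 1) (hy : y ∈ V j) : ⁅x, y⁆ ∈ V (j + 1) := by
  rw [h.bracket_eq j h1 hr]
  exact Submodule.subset_span ⟨x, hx, y, hy, rfl⟩

theorem trace_ad_of_mem_one [FiniteDimensional ℝ L] (h : IsLieStratification r V) {x : L}
    (hx : x ∈ V 1) : LinearMap.trace ℝ L (LieAlgebra.ad ℝ L x) = 0 := by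
  -- With a single layer the algebra is commutative. This case is separate because the shift of
  -- indices used below must have no fixed point.
  rcases h.one_le.eq_or_lt with hr | hr
  · have : LieAlgebra.ad ℝ L x = 0 := by
      ext y
      have hy : y ∈ V 1 := h.mem_of_layers (fun j h1 h2 => by
        obtain rfl : j = 1 := by omega
        exact le_rfl) y
      subst hr
      simpa using h.bracket_last x hx y hy
    rw [this, map_zero]
  · have : NeZero r := ⟨by omega⟩
    -- `ad x` raises the degree by one, so it has no diagonal blocks. It kills the last layer, whose
    -- target index is therefore arbitrary; it is taken to be `0`.
    let σ : Fin r → Fin r := fun i => ⟨if (i : ℕ) + 1 < r then i + 1 else 0, by split_ifs <;> omega⟩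
    refine LinearMap.trace_eq_zero_of_mapsTo_ne h.isInternal σ (fun i hi => ?_) fun i y hy => ?_
    · have := congrArg Fin.val hi
      simp only [σ] at this
      split_ifs at this <;> omega
    · rw [LieAlgebra.ad_apply]
      have hi := i.2
      by_cases hlt : (i : ℕ) + 1 < r
      · have e : ((σ i : Fin r) : ℕ) = i + 1 := by simp [σ, hlt]
        simp only [e]
        exact h.lie_mem (by omega) hlt hx hy
      · have e : (i : ℕ) + 1 = r := by omega
        simp only [e] at hy
        rw [h.bracket_last x hx y hy]
        exact zero_mem _

theorem trace_ad [FiniteDimensional ℝ L] (h : IsLieStratification r V) (x : L) :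
    LinearMap.trace ℝ L (LieAlgebra.ad ℝ L x) = 0 := by
  let τ : L →ₗ[ℝ] ℝ := (LinearMap.trace ℝ L).comp (LieAlgebra.ad ℝ L : L →ₗ[ℝ] Module.End ℝ L)
  refine h.mem_of_layers (p := LinearMap.ker τ) (fun j h1 hr y hy => ?_) x
  rcases h1.eq_or_lt with rfl | hj
  · exact h.trace_ad_of_mem_one hy
  · obtain ⟨k, rfl⟩ : ∃ k, j = k + 1 := ⟨j - 1, by omega⟩
    rw [h.bracket_eq k (by omega) (by omega)] at hy
    refine Submodule.span_le.2 ?_ hy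
    rintro _ ⟨a, -, b, -, rfl⟩
    change LinearMap.trace ℝ L (LieAlgebra.ad ℝ L ⁅a, b⁆) = 0
    -- Layers of degree at least two are spanned by brackets, and `ad` of a bracket is a commutator,
    -- of trace zero.
    have e : LieAlgebra.ad ℝ L ⁅a, b⁆ = LieAlgebra.ad ℝ L a * LieAlgebra.ad ℝ L b
        - LieAlgebra.ad ℝ L b * LieAlgebra.ad ℝ L a := by
      ext z
      simp
    rw [e, map_sub, LinearMap.trace_mul_comm, sub_self]

/-- The sum of the layers of degree at least two. -/
def higher (r : ℕ) (V : ℕ → Submodule ℝ L) : Submodule ℝ L :=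
  ⨆ i : Fin r, ⨆ _ : (i : ℕ) ≠ 0, V ((i : ℕ) + 1)

theorem le_higher {j : ℕ} (h2 : 2 ≤ j) (hr : j ≤ r) : V j ≤ higher r V := by
  obtain ⟨k, rfl⟩ : ∃ k, j = k + 1 := ⟨j - 1, by omega⟩
  exact le_iSup₂_of_le (f := fun (i : Fin r) (_ : (i : ℕ) ≠ 0) => V ((i : ℕ) + 1))
    (⟨k, by omega⟩ : Fin r) (show k ≠ 0 by omega) le_rfl

theorem lie_mem_higher_of_mem_one (h : IsLieStratification r V) {x : L} (hx : x ∈ V 1) (y : L) :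
    ⁅x, y⁆ ∈ higher r V := by
  refine h.mem_of_layers (p := (higher r V).comap (LieAlgebra.ad ℝ L x)) (fun j h1 hr z hz => ?_) y
  change ⁅x, z⁆ ∈ higher r V
  rcases hr.eq_or_lt with rfl | hlt
  · rw [h.bracket_last x hx z hz]
    exact zero_mem _
  · exact le_higher (by omega) (by omega) (h.lie_mem h1 hlt hx hz)

/-- Induction on the degree of the left entry. By the Jacobi identity `⁅⁅a, b⁆, y⁆ = ⁅a, ⁅b, y⁆⁆ -
⁅b, ⁅a, y⁆⁆`, with `a` of degree one and `b` of smaller degree than `⁅a, b⁆`. -/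
theorem lie_mem_higher (h : IsLieStratification r V) (x y : L) : ⁅x, y⁆ ∈ higher r V := by
  have key : ∀ j, 1 ≤ j → j ≤ r → ∀ x ∈ V j, ∀ y : L, ⁅x, y⁆ ∈ higher r V := by
    intro j h1
    induction j, h1 using Nat.le_induction with
    | base => exact fun _ x hx y => h.lie_mem_higher_of_mem_one hx y
    | succ j h1 ih =>
      intro hr x hx y
      rw [h.bracket_eq j h1 (by omega)] at hx
      refine Submodule.span_induction ?_ ?_ ?_ ?_ hx
      · rintro _ ⟨a, ha, b, hb, rfl⟩
        rw [lie_lie]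
        exact sub_mem (h.lie_mem_higher_of_mem_one ha _) (ih (by omega) b hb _)
      · rw [zero_lie]; exact zero_mem _
      · intro a b _ _ ha hb
        rw [add_lie]; exact add_mem ha hb
      · intro c a _ ha
        rw [smul_lie]; exact Submodule.smul_mem _ c ha
  have := h.mem_of_layers (p := (higher r V).comap
    ((LieAlgebra.ad ℝ L : L →ₗ[ℝ] Module.End ℝ L).flip y)) (fun j h1 hr z hz => key j h1 hr z hz y) x
  exact this

theorem isCompl_higher (h : IsLieStratification r V) : IsCompl (V 1) (higher r V) := by
  have hr := h.one_le
  have hind := h.isInternal.submodule_iSupIndep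
  have e : higher r V = ⨆ j : Fin r, ⨆ _ : j ≠ ⟨0, hr⟩, V ((j : ℕ) + 1) := by
    simp only [higher, ne_eq, Fin.ext_iff]
  constructor
  · rw [e]; exact hind ⟨0, hr⟩
  · rw [codisjoint_iff_le_sup, ← h.iSup_eq_top]
    refine iSup_le fun i => ?_
    by_cases hi : (i : ℕ) = 0
    · rw [hi]; exact le_sup_left
    · exact le_sup_of_le_right (le_higher (by omega) (by omega))

/-- Linear functionals on the first layer extend to functionals that vanish on brackets. -/
theorem exists_functional (h : IsLieStratification r V) (ℓ : V 1 →ₗ[ℝ] ℝ) :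
    ∃ α : L →ₗ[ℝ] ℝ, (∀ x : V 1, α x = ℓ x) ∧ ∀ x y : L, α ⁅x, y⁆ = 0 := by
  refine ⟨ℓ.comp (Submodule.projectionOnto _ _ h.isCompl_higher), fun x => ?_, fun x y => ?_⟩
  · simp
  · rw [LinearMap.comp_apply, (Submodule.projectionOnto_apply_eq_zero_iff _).2
      (h.lie_mem_higher x y), map_zero]

theorem sum_coord_bracket [FiniteDimensional ℝ L] (h : IsLieStratification r V) {ι : Type*}
    [Fintype ι] (e : Module.Basis ι ℝ L) (w : L) : ∑ i, e.coord i ⁅e i, w⁆ = 0 := by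
  classical
  have h1 := h.trace_ad w
  rw [LinearMap.trace_eq_matrix_trace ℝ e, Matrix.trace] at h1
  simp only [Matrix.diag_apply, LinearMap.toMatrix_apply, LieAlgebra.ad_apply] at h1
  rw [← neg_eq_zero, ← Finset.sum_neg_distrib, ← h1]
  refine Finset.sum_congr rfl fun i _ => ?_
  have e' : (⁅w, e i⁆ : L) = -⁅e i, w⁆ := (lie_skew w (e i)).symm
  rw [e', map_neg, Finsupp.neg_apply, Module.Basis.coord_apply]

end IsLieStratification

end LieAlgebras

/-! ### Transfer of these facts to the Lie algebra of the group. -/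

section StratifiedGroups

variable {E : Type*} [NormedAddCommGroup E] [NormedSpace ℝ E] [FiniteDimensional ℝ E]
  {G : Type*} [TopologicalSpace G] [ChartedSpace E G] [Group G] [LieGroup 𝓘(ℝ, E) ∞ G]
  {r : ℕ} {V : ℕ → Submodule ℝ (GroupLieAlgebra 𝓘(ℝ, E) G)}

theorem IsStratification.exists_functional (hV : IsStratification r V) (ℓ : V 1 →ₗ[ℝ] ℝ) :
    ∃ α : E →ₗ[ℝ] ℝ, (∀ x : V 1, α (x : GroupLieAlgebra 𝓘(ℝ, E) G) = ℓ x) ∧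
      ∀ x y : E, α (modelBracket G x y) = 0 := by
  have := lieGroup_three (E := E) (G := G)
  have h : IsLieStratification r V := ⟨hV.1, hV.2, hV.3, hV.4⟩
  exact h.exists_functional ℓ

theorem IsStratification.sum_coord_bracket (hV : IsStratification r V) {ι : Type*} [Fintype ι]
    (e : Module.Basis ι ℝ E) (w : E) : ∑ i, e.coord i (modelBracket G (e i) w) = 0 := by
  have := lieGroup_three (E := E) (G := G)
  have h : IsLieStratification r V := ⟨hV.1, hV.2, hV.3, hV.4⟩
  have : FiniteDimensional ℝ (GroupLieAlgebra 𝓘(ℝ, E) G) := inferInstanceAs (FiniteDimensional ℝ E)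
  exact h.sum_coord_bracket (L := GroupLieAlgebra 𝓘(ℝ, E) G) e w

variable [T2Space G] [SecondCountableTopology G] [MeasurableSpace G] [BorelSpace G]
  {μ : Measure G} [μ.IsHaarMeasure]

/-- Left-invariant vector fields on a stratified group are divergence free. -/
theorem IsStratification.integral_invDeriv (hV : IsStratification r V)
    (Y : GroupLieAlgebra 𝓘(ℝ, E) G) {f : G → ℂ}
    (hf : ContMDiff 𝓘(ℝ, E) 𝓘(ℝ, ℂ) ∞ f) (hc : HasCompactSupport f) :
    ∫ x, invDeriv Y f x ∂μ = 0 :=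
  integral_invDeriv_eq_zero (Module.finBasis ℝ E) (hV.sum_coord_bracket _) Y hf hc

end StratifiedGroups

end Carnot

end


noncomputable section

namespace Carnot

/-! ### Gluing local functions on a simply connected space. -/

section Monodromy

/-- The reals with the discrete topology. -/
@[ext] structure DiscreteReal where
  /-- The underlying real number. -/
  val : ℝ

instance : TopologicalSpace DiscreteReal := ⊥

instance : DiscreteTopology DiscreteReal := ⟨rfl⟩

variable {X ι : Type*} [TopologicalSpace X]

/-- The covering space of germs of functions that differ by a constant from the given local
functions. -/
def germCore (U : ι → Set X) (hU : ∀ i, IsOpen (U i)) (idx : X → ι) (hidx : ∀ x, x ∈ U (idx x))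
    (f : ι → X → ℝ) (hf : ∀ i j, ∀ x ∈ U i ∩ U j, ∀ᶠ y in 𝓝 x, f i y - f j y = f i x - f j x) :
    FiberBundleCore ι X DiscreteReal where
  baseSet := U
  isOpen_baseSet := hU
  indexAt := idx
  mem_baseSet_at := hidx
  -- The coordinate `s` over `U i` stands for the germ of `f i` plus a constant whose value at `x`
  -- is `f i x + s`. The transition keeps this value fixed.
  coordChange i j x s := ⟨s.val + (f i x - f j x)⟩
  coordChange_self i x _ s := by
    ext
    simp
  continuousOn_coordChange i j := by
    rintro ⟨x, s⟩ ⟨hx, -⟩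
    apply ContinuousAt.continuousWithinAt
    have h1 : ∀ᶠ p : X × DiscreteReal in 𝓝 (x, s), p.2 = s ∧ f i p.1 - f j p.1 = f i x - f j x := by
      rw [nhds_prod_eq]
      refine ((hf i j x hx).prod_mk (show ∀ᶠ t in 𝓝 s, t = s by simp [nhds_discrete])).mono ?_
      exact fun p hp => ⟨hp.2, hp.1⟩
    refine continuousAt_const.congr (f := fun _ => (⟨s.val + (f i x - f j x)⟩ : DiscreteReal)) ?_
    filter_upwards [h1] with p hp
    rw [hp.2, hp.1]
  coordChange_comp i j k x _ s := by
    ext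
    change s.val + (f i x - f j x) + (f j x - f k x) = s.val + (f i x - f k x)
    ring

/-- On a simply connected space, local functions that agree up to locally constant functions glue to
a global one. -/
theorem exists_global_of_locally_const_sub [SimplyConnectedSpace X] [LocallyPathConnectedSpace X]
    (U : ι → Set X) (hU : ∀ i, IsOpen (U i)) (idx : X → ι) (hidx : ∀ x, x ∈ U (idx x))
    (f : ι → X → ℝ) (hf : ∀ i j, ∀ x ∈ U i ∩ U j, ∀ᶠ y in 𝓝 x, f i y - f j y = f i x - f j x) :
    ∃ F : X → ℝ, ∀ i, ∀ x ∈ U i, ∀ᶠ y in 𝓝 x, F y - f i y = F x - f i x := by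
  let Z := germCore U hU idx hidx f hf
  obtain ⟨x₀⟩ : Nonempty X := inferInstance
  have cov : IsCoveringMap Z.proj :=
    IsFiberBundle.isCoveringMap fun x => ⟨Z.localTriv (idx x), hidx x⟩
  -- Simple connectedness lifts the identity through the covering: a choice of germs at all points
  -- that is continuous into discrete fibres, hence locally consistent.
  obtain ⟨s, ⟨-, hs⟩, -⟩ := cov.existsUnique_continuousMap_lifts (ContinuousMap.id X) x₀
    (⟨x₀, (⟨0⟩ : DiscreteReal)⟩ : Z.TotalSpace) rfl
  have hs1 : ∀ x, (s x).1 = x := fun x => congrFun hs x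
  let val : Z.TotalSpace → ℝ := fun p => DiscreteReal.val p.2
  refine ⟨fun x => f (idx x) x + val (s x), fun i x hx => ?_⟩
  have hc : ContinuousAt (fun y => (Z.localTriv i (s y)).2) x := by
    have h1 : ContinuousAt (Z.localTriv i) (s x) :=
      (Z.localTriv i).continuousOn.continuousAt ((Z.localTriv i).open_source.mem_nhds (by
        rw [Z.mem_localTriv_source, hs1]; exact hx))
    exact continuous_snd.continuousAt.comp (h1.comp s.continuous.continuousAt)
  have hval : ∀ y, DiscreteReal.val (Z.localTriv i (s y)).2 = val (s y) + (f (idx y) y - f i y) := by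
    intro y
    change val (s y) + (f (idx (s y).1) (s y).1 - f i (s y).1) = _
    rw [hs1]
  have hev : ∀ᶠ y in 𝓝 x, (Z.localTriv i (s y)).2 = (Z.localTriv i (s x)).2 := by
    have := hc (show {(Z.localTriv i (s x)).2} ∈ 𝓝 _ from by simp [nhds_discrete])
    exact this
  filter_upwards [hev] with y hy
  have : val (s y) + (f (idx y) y - f i y) = val (s x) + (f (idx x) x - f i x) := by
    rw [← hval, ← hval, hy]
  linarith

end Monodromy

/-! ### Primitives of closed left-invariant one-forms. -/

section Primitives

variable {E : Type*} [NormedAddCommGroup E] [NormedSpace ℝ E] [FiniteDimensional ℝ E]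
  {G : Type*} [TopologicalSpace G] [ChartedSpace E G] [Group G] [LieGroup 𝓘(ℝ, E) ∞ G]

theorem mulInvariantVectorField_injective (x : G) {v : E}
    (h : mulInvariantVectorField (I := 𝓘(ℝ, E)) (G := G) v x = (0 : E)) : v = 0 := by
  have h1 : HasMFDerivAt 𝓘(ℝ, E) 𝓘(ℝ, E) (fun z : G => x⁻¹ * z) (x * 1)
      (mfderiv 𝓘(ℝ, E) 𝓘(ℝ, E) (fun z : G => x⁻¹ * z) (x * 1)) :=
    (mdifferentiable_mul_left _ _).hasMFDerivAt
  have h2 := h1.comp 1 (mdifferentiable_mul_left x 1).hasMFDerivAt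
  have e : (fun z : G => x⁻¹ * z) ∘ (fun z : G => x * z) = id := by ext z; simp
  rw [e] at h2
  have h3 := DFunLike.congr_fun (hasMFDerivAt_unique h2 (hasMFDerivAt_id 1)) v
  refine Eq.trans (Eq.symm h3) ?_
  refine (congrArg (mfderiv 𝓘(ℝ, E) 𝓘(ℝ, E) (fun z : G => x⁻¹ * z) (x * 1)) h).trans ?_
  exact map_zero _

theorem leftFrame_injective {ξ : E} (hξ : ξ ∈ (idChart E G).target) :
    Function.Injective (leftFrame E G ξ) := by
  rw [injective_iff_map_eq_zero]
  intro v hv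
  have h := mfderiv_symm_leftFrame (G := G) hξ v
  rw [hv] at h
  exact mulInvariantVectorField_injective ((idChart E G).symm ξ) (h.symm.trans (map_zero _))

/-- The left-invariant frame, as an isomorphism. -/
def leftFrameEquiv {ξ : E} (hξ : ξ ∈ (idChart E G).target) : E ≃L[ℝ] E :=
  (LinearEquiv.ofInjectiveEndo (leftFrame E G ξ : E →ₗ[ℝ] E)
    (leftFrame_injective hξ)).toContinuousLinearEquiv

theorem coe_leftFrameEquiv {ξ : E} (hξ : ξ ∈ (idChart E G).target) :
    (leftFrameEquiv hξ : E →L[ℝ] E) = leftFrame E G ξ := by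
  ext v; rfl

theorem exists_mulInvariantVectorField_eq (x : G) (w : E) :
    ∃ v : E, mulInvariantVectorField (I := 𝓘(ℝ, E)) (G := G) v x = w := by
  let L : E →L[ℝ] E := mfderiv 𝓘(ℝ, E) 𝓘(ℝ, E) (fun z : G => x * z) 1
  have hinj : Function.Injective (L : E →ₗ[ℝ] E) := by
    rw [injective_iff_map_eq_zero]
    exact fun v hv => mulInvariantVectorField_injective x hv
  exact LinearMap.injective_iff_surjective.1 hinj w

/-- A closed left-invariant one-form has a primitive near the identity. -/
theorem exists_local_primitive (α : E →ₗ[ℝ] ℝ) (hα : ∀ x y : E, α (modelBracket G x y) = 0) :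
    ∃ (U : Set G) (f : G → ℝ), IsOpen U ∧ (1 : G) ∈ U ∧ ∀ x ∈ U,
      ContMDiffAt 𝓘(ℝ, E) 𝓘(ℝ, ℝ) ∞ f x ∧
      ∀ v : E, mfderiv 𝓘(ℝ, E) 𝓘(ℝ, ℝ) f x (mulInvariantVectorField (I := 𝓘(ℝ, E)) v x) = α v := by
  obtain ⟨ε, hε, hball⟩ := Metric.isOpen_iff.1 isOpen_idChart_target _ (idPt_mem (E := E) (G := G))
  set s := Metric.ball (idPt E G) ε with hs
  let αc : E →L[ℝ] ℝ := LinearMap.toContinuousLinearMap α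
  -- The left-invariant one-form with value `α` at the identity, read in the chart.
  let a : E → E →L[ℝ] ℝ := fun ξ => αc.comp (leftFrame E G ξ).inverse
  have ha : ContDiffOn ℝ ∞ a s := by
    intro ξ hξ
    have h1 : ContDiffAt ℝ ∞ (leftFrame E G) ξ :=
      contDiffOn_leftFrame.contDiffAt (isOpen_idChart_target.mem_nhds (hball hξ))
    have h2 : ContDiffAt ℝ ∞ (fun ξ => (leftFrame E G ξ).inverse) ξ := by
      refine ContDiffAt.comp (g := ContinuousLinearMap.inverse) ξ ?_ h1
      rw [← coe_leftFrameEquiv (hball hξ)]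
      exact contDiffAt_map_inverse _
    exact (contDiffAt_const.clm_comp h2).contDiffWithinAt
  have hval : ∀ ξ ∈ s, ∀ w, a ξ (leftFrame E G ξ w) = α w := by
    intro ξ hξ w
    change αc ((leftFrame E G ξ).inverse (leftFrame E G ξ w)) = α w
    rw [← coe_leftFrameEquiv (hball hξ), ContinuousLinearMap.inverse_equiv]
    simp [αc]
  -- Differentiate `a (L w) = α w`, whose right-hand side is constant.
  have hD : ∀ ξ ∈ s, ∀ v w, fderiv ℝ a ξ v (leftFrame E G ξ w)
      = - a ξ (fderiv ℝ (fun η => leftFrame E G η w) ξ v) := by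
    intro ξ hξ v w
    have h1 : HasFDerivAt a (fderiv ℝ a ξ) ξ :=
      ((ha.contDiffAt (Metric.isOpen_ball.mem_nhds hξ)).differentiableAt (by simp)).hasFDerivAt
    have h2 : HasFDerivAt (fun η => leftFrame E G η w) (fderiv ℝ (fun η => leftFrame E G η w) ξ) ξ := by
      have := (contDiffOn_leftFrame (E := E) (G := G)).contDiffAt
        (isOpen_idChart_target.mem_nhds (hball hξ))
      exact ((this.clm_apply contDiffAt_const).differentiableAt (by simp)).hasFDerivAt
    have h3 := h1.clm_apply h2
    have h4 : HasFDerivAt (fun η => a η (leftFrame E G η w)) (0 : E →L[ℝ] ℝ) ξ := by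
      refine (hasFDerivAt_const (α w) ξ).congr_of_eventuallyEq ?_
      filter_upwards [Metric.isOpen_ball.mem_nhds hξ] with η hη
      exact hval η hη w
    have h5 := DFunLike.congr_fun (h3.unique h4) v
    simp at h5
    linarith
  -- By `hD` and the structure equation, the antisymmetric part of `Da` on the frame vectors of `v`,
  -- `w` is, up to sign, `α` of the bracket of `v` and `w`, which vanishes. So the form is closed,
  -- and the Poincaré lemma applies on the ball.
  have hsymm : ∀ ξ ∈ s, ∀ x y, fderiv ℝ a ξ x y = fderiv ℝ a ξ y x := by
    intro ξ hξ x y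
    obtain ⟨v, rfl⟩ : ∃ v, leftFrame E G ξ v = x := (leftFrameEquiv (hball hξ)).surjective x
    obtain ⟨w, rfl⟩ : ∃ w, leftFrame E G ξ w = y := (leftFrameEquiv (hball hξ)).surjective y
    rw [hD ξ hξ, hD ξ hξ, ← sub_eq_zero]
    have h1 := leftFrame_bracket (G := G) (hball hξ) v w
    have h2 := hval ξ hξ (modelBracket G v w)
    rw [h1, hα, map_sub] at h2
    linarith
  obtain ⟨f, hf⟩ := (convex_ball (idPt E G) ε).exists_forall_hasFDerivAt_of_fderiv_symmetric
    Metric.isOpen_ball (ha.differentiableOn (by simp)) hsymm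
  have hfs : ContDiffOn ℝ ∞ f s := by
    rw [contDiffOn_infty_iff_fderiv_of_isOpen Metric.isOpen_ball]
    exact ⟨fun ξ hξ => (hf ξ hξ).differentiableAt.differentiableWithinAt,
      ha.congr fun ξ hξ => (hf ξ hξ).fderiv⟩
  refine ⟨(idChart E G).source ∩ idChart E G ⁻¹' s, f ∘ idChart E G, ?_, ?_, fun x hx => ⟨?_, fun v => ?_⟩⟩
  · exact (continuousOn_extChartAt (I := 𝓘(ℝ, E)) (1 : G)).isOpen_inter_preimage
      (isOpen_extChartAt_source 1) Metric.isOpen_ball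
  · exact ⟨mem_extChartAt_source 1, Metric.mem_ball_self hε⟩
  · exact (hfs.contDiffAt (Metric.isOpen_ball.mem_nhds hx.2)).contMDiffAt.comp x
      (contMDiffAt_idChart hx.1)
  · set ξ := idChart E G x with hξdef
    have hx' : (idChart E G).symm ξ = x := (idChart E G).left_inv hx.1
    have h1 : HasMFDerivAt 𝓘(ℝ, E) 𝓘(ℝ, ℝ) (f ∘ idChart E G) ((idChart E G).symm ξ)
        (mfderiv 𝓘(ℝ, E) 𝓘(ℝ, ℝ) (f ∘ idChart E G) x) := by
      rw [hx']
      exact (((hfs.contDiffAt (Metric.isOpen_ball.mem_nhds hx.2)).contMDiffAt.comp x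
        (contMDiffAt_idChart hx.1)).mdifferentiableAt (by simp)).hasMFDerivAt
    have h2 := h1.comp ξ (mdifferentiableAt_idChart_symm (hball hx.2)).hasMFDerivAt
    have h3 : ((f ∘ idChart E G) ∘ (idChart E G).symm) =ᶠ[𝓝 ξ] f := by
      filter_upwards [isOpen_idChart_target.mem_nhds (hball hx.2)] with η hη
      simp only [Function.comp_apply]
      rw [(idChart E G).right_inv hη]
    have h4 := hasMFDerivAt_unique (h2.congr_of_eventuallyEq h3.symm) (hf ξ hx.2).hasMFDerivAt
    have h5 := DFunLike.congr_fun h4 (leftFrame E G ξ v)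
    have h6 := mfderiv_symm_leftFrame (G := G) (hball hx.2) v
    rw [hx'] at h6
    refine Eq.trans ?_ (hval ξ hx.2 v)
    refine Eq.trans ?_ h5
    exact (congrArg (mfderiv 𝓘(ℝ, E) 𝓘(ℝ, ℝ) (f ∘ idChart E G) x) h6).symm

theorem eventually_eq_of_mfderiv_eq_zero {h : G → ℝ} {U : Set G} (hU : IsOpen U)
    (hh : ∀ x ∈ U, HasMFDerivAt 𝓘(ℝ, E) 𝓘(ℝ, ℝ) h x (0 : E →L[ℝ] ℝ)) {x : G} (hx : x ∈ U) :
    ∀ᶠ y in 𝓝 x, h y = h x := by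
  have := isManifold_one (E := E) (G := G)
  let e := extChartAt 𝓘(ℝ, E) x
  have hopen : IsOpen (e.target ∩ e.symm ⁻¹' U) :=
    (continuousOn_extChartAt_symm (I := 𝓘(ℝ, E)) x).isOpen_inter_preimage
      (isOpen_extChartAt_target x) hU
  have hxe : e x ∈ e.target ∩ e.symm ⁻¹' U := by
    refine ⟨mem_extChartAt_target x, ?_⟩
    change e.symm (e x) ∈ U
    rw [e.left_inv (mem_extChartAt_source x)]
    exact hx
  obtain ⟨ε, hε, hball⟩ := Metric.isOpen_iff.1 hopen _ hxe
  have hd : ∀ ξ ∈ Metric.ball (e x) ε, HasFDerivAt (h ∘ e.symm) (0 : E →L[ℝ] ℝ) ξ := by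
    intro ξ hξ
    have h1 : MDifferentiableAt 𝓘(ℝ, E) 𝓘(ℝ, E) e.symm ξ := by
      have := mdifferentiableWithinAt_extChartAt_symm (I := 𝓘(ℝ, E)) (hball hξ).1
      rwa [show range 𝓘(ℝ, E) = univ from by simp, mdifferentiableWithinAt_univ] at this
    have h2 := (hh _ (hball hξ).2).comp ξ h1.hasMFDerivAt
    refine h2.hasFDerivAt.congr_fderiv ?_
    exact ContinuousLinearMap.zero_comp _
  have hconst : ∀ ξ ∈ Metric.ball (e x) ε, h (e.symm ξ) = h (e.symm (e x)) := fun ξ hξ =>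
    (convex_ball (e x) ε).is_const_of_fderivWithin_eq_zero (𝕜 := ℝ) (f := h ∘ e.symm)
      (fun η hη => (hd η hη).differentiableAt.differentiableWithinAt)
      (fun η hη => by
        rw [fderivWithin_of_isOpen Metric.isOpen_ball hη, (hd η hη).fderiv])
      hξ (Metric.mem_ball_self hε)
  have hcont : ContinuousAt e x := continuousAt_extChartAt x
  filter_upwards [hcont (Metric.ball_mem_nhds _ hε), extChartAt_source_mem_nhds (I := 𝓘(ℝ, E)) x]
    with y hy hys
  have := hconst _ hy
  rwa [e.left_inv hys, e.left_inv (mem_extChartAt_source x)] at this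

/-- A closed left-invariant one-form on a simply connected group has a global primitive. -/
theorem exists_global_primitive [SimplyConnectedSpace G] (α : E →ₗ[ℝ] ℝ)
    (hα : ∀ x y : E, α (modelBracket G x y) = 0) :
    ∃ F : G → ℝ, ContMDiff 𝓘(ℝ, E) 𝓘(ℝ, ℝ) ∞ F ∧ ∀ (x : G) (v : E),
      mfderiv 𝓘(ℝ, E) 𝓘(ℝ, ℝ) F x (mulInvariantVectorField (I := 𝓘(ℝ, E)) v x) = α v := by
  have : IsTopologicalGroup G := topologicalGroup_of_lieGroup 𝓘(ℝ, E) ∞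
  have : LocallyPathConnectedSpace G := ChartedSpace.locallyPathConnectedSpace E G
  obtain ⟨U, f, hU, h1U, hf⟩ := exists_local_primitive α hα
  -- Left translates of one local primitive are local primitives of the same left-invariant form. On
  -- overlaps their difference has zero derivative, so it is locally constant.
  let V : G → Set G := fun g => (fun x => g⁻¹ * x) ⁻¹' U
  let fg : G → G → ℝ := fun g x => f (g⁻¹ * x)
  have hV : ∀ g, IsOpen (V g) := fun g => hU.preimage (continuous_const_mul g⁻¹)
  have hsm : ∀ g, ∀ x ∈ V g, ContMDiffAt 𝓘(ℝ, E) 𝓘(ℝ, ℝ) ∞ (fg g) x := fun g x hx =>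
    ContMDiffAt.comp x (hf _ hx).1 contMDiff_mul_left.contMDiffAt
  have hder : ∀ g, ∀ x ∈ V g, ∀ v : E, mfderiv 𝓘(ℝ, E) 𝓘(ℝ, ℝ) (fg g) x
      (mulInvariantVectorField (I := 𝓘(ℝ, E)) v x) = α v := by
    intro g x hx v
    have h1 := hasDerivAt_mul_idCurve ((hsm g x hx).mdifferentiableAt (by simp)) v
    have h2 := hasDerivAt_mul_idCurve ((hf _ hx).1.mdifferentiableAt (by simp)) v
    rw [← (hf _ hx).2 v]
    refine h1.unique ?_
    simpa only [fg, mul_assoc] using h2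
  have hzero : ∀ i j, ∀ x ∈ V i ∩ V j, HasMFDerivAt 𝓘(ℝ, E) 𝓘(ℝ, ℝ) (fun y => fg i y - fg j y) x
      (0 : E →L[ℝ] ℝ) := by
    intro i j x hx
    have hi := ((hsm i x hx.1).mdifferentiableAt (by simp)).hasMFDerivAt
    have hj := ((hsm j x hx.2).mdifferentiableAt (by simp)).hasMFDerivAt
    let Li : E →L[ℝ] ℝ := mfderiv 𝓘(ℝ, E) 𝓘(ℝ, ℝ) (fg i) x
    let Lj : E →L[ℝ] ℝ := mfderiv 𝓘(ℝ, E) 𝓘(ℝ, ℝ) (fg j) x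
    have e : Li - Lj = 0 := by
      ext w
      obtain ⟨v, hv⟩ := exists_mulInvariantVectorField_eq (G := G) x w
      have h1 : Li w = α v := hv ▸ hder i x hx.1 v
      have h2 : Lj w = α v := hv ▸ hder j x hx.2 v
      simp [h1, h2]
    rw [← e]
    exact hi.sub hj
  obtain ⟨F, hF⟩ := exists_global_of_locally_const_sub V hV id
    (fun x => by simpa [V] using h1U) fg fun i j x hx =>
      eventually_eq_of_mfderiv_eq_zero ((hV i).inter (hV j)) (hzero i j) hx
  have hFe : ∀ x, F =ᶠ[𝓝 x] fun y => fg x y + (F x - fg x x) := by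
    intro x
    filter_upwards [hF x x (by simpa [V] using h1U)] with y hy
    linarith
  have hxx : ∀ x, x ∈ V x := fun x => by simpa [V] using h1U
  have hFs : ∀ x, ContMDiffAt 𝓘(ℝ, E) 𝓘(ℝ, ℝ) ∞ F x := fun x =>
    ((hsm x x (hxx x)).add contMDiffAt_const).congr_of_eventuallyEq (hFe x)
  refine ⟨F, hFs, fun x v => ?_⟩
  have h1 := hasDerivAt_mul_idCurve ((hFs x).mdifferentiableAt (by simp)) v
  have h2 := (hasDerivAt_mul_idCurve ((hsm x x (hxx x)).mdifferentiableAt (by simp)) v).add_const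
    (F x - fg x x)
  rw [← hder x x (hxx x) v]
  refine h1.unique (h2.congr_of_eventuallyEq ?_)
  have hc : Tendsto (fun s => x * idCurve G v s) (𝓝 0) (𝓝 x) := by
    have : Continuous fun s => x * idCurve G v s :=
      continuous_const.mul (contMDiff_idCurve v).continuous
    simpa using this.tendsto 0
  exact hc.eventually (hFe x)

end Primitives

end Carnot

end


noncomputable section

namespace Carnot

/-! ### Compact operators and listing of real families. -/

section CompactOperators

variable {H K : Type*} [NormedAddCommGroup H] [InnerProductSpace ℂ H] [CompleteSpace H]
  [NormedAddCommGroup K] [InnerProductSpace ℂ K] [CompleteSpace K]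

/-- From `‖S x‖² ≤ ‖S* S x‖ ‖x‖`. Differences of points of the unit ball have norm at most `2`, so
an `ε²/2`-net for the image of the ball under `S* S` yields an `ε`-net for its image under `S`. -/
theorem isCompactOperator_of_adjoint_comp (S : H →L[ℂ] K)
    (h : IsCompactOperator (ContinuousLinearMap.adjoint S ∘L S)) : IsCompactOperator S := by
  refine (isCompactOperator_iff_isCompact_closure_image_closedBall (𝕜₁ := ℂ) (S : H →ₗ[ℂ] K)
    zero_lt_one).2 ?_
  have hc := h.isCompact_closure_image_closedBall (𝕜₁ := ℂ)
    (f := ((ContinuousLinearMap.adjoint S ∘L S : H →L[ℂ] H) : H →ₗ[ℂ] H)) 1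
  have htb := hc.totallyBounded.subset subset_closure
  refine TotallyBounded.isCompact_of_isClosed (TotallyBounded.closure ?_) isClosed_closure
  rw [Metric.totallyBounded_iff]
  intro ε hε
  obtain ⟨t, hts, htf, ht⟩ := Metric.finite_approx_of_totallyBounded htb (ε ^ 2 / 2) (by positivity)
  have hts' : ∀ z : H, ∃ y : H, z ∈ t → y ∈ Metric.closedBall (0 : H) 1 ∧
      (ContinuousLinearMap.adjoint S ∘L S) y = z := fun z => by
    by_cases hz : z ∈ t
    · obtain ⟨y, hy⟩ := hts hz
      exact ⟨y, fun _ => hy⟩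
    · exact ⟨0, fun h => absurd h hz⟩
  choose y hy using hts'
  refine ⟨(fun z => S (y z)) '' t, htf.image _, ?_⟩
  rintro _ ⟨x, hx, rfl⟩
  obtain ⟨z, hz, hxz⟩ := mem_iUnion₂.1 (ht ⟨x, hx, rfl⟩)
  refine mem_iUnion₂.2 ⟨S (y z), ⟨z, hz, rfl⟩, ?_⟩
  have hyz := hy z hz
  have hx1 : ‖x‖ ≤ 1 := by simpa using hx
  have hy1 : ‖y z‖ ≤ 1 := by simpa using hyz.1
  rw [← hyz.2] at hxz
  rw [Metric.mem_ball, dist_eq_norm] at hxz ⊢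
  change ‖S x - S (y z)‖ < ε
  change ‖(ContinuousLinearMap.adjoint S ∘L S) x - (ContinuousLinearMap.adjoint S ∘L S) (y z)‖ < _ at hxz
  rw [← map_sub] at hxz ⊢
  have h1 : ‖S (x - y z)‖ ^ 2 ≤ ‖(ContinuousLinearMap.adjoint S ∘L S) (x - y z)‖ * ‖x - y z‖ := by
    have h2 : inner ℂ ((ContinuousLinearMap.adjoint S ∘L S) (x - y z)) (x - y z)
        = inner ℂ (S (x - y z)) (S (x - y z)) := by
      rw [ContinuousLinearMap.comp_apply, ContinuousLinearMap.adjoint_inner_left]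
    have h3 := norm_inner_le_norm (𝕜 := ℂ) ((ContinuousLinearMap.adjoint S ∘L S) (x - y z))
      (x - y z)
    rw [h2, inner_self_eq_norm_sq_to_K] at h3
    simpa using h3
  have h4 : ‖x - y z‖ ≤ 2 := (norm_sub_le _ _).trans (by linarith)
  have h5 : ‖S (x - y z)‖ ^ 2 < ε ^ 2 := by
    refine h1.trans_lt ?_
    nlinarith [norm_nonneg ((ContinuousLinearMap.adjoint S ∘L S) (x - y z)), norm_nonneg (x - y z)]
  exact lt_of_pow_lt_pow_left₀ 2 hε.le h5

theorem isCompactOperator_of_comp_adjoint (S : H →L[ℂ] K)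
    (h : IsCompactOperator (S ∘L ContinuousLinearMap.adjoint S)) : IsCompactOperator S := by
  have h1 : IsCompactOperator (ContinuousLinearMap.adjoint S) := by
    apply isCompactOperator_of_adjoint_comp
    rwa [ContinuousLinearMap.adjoint_adjoint]
  exact isCompactOperator_of_adjoint_comp S (h1.comp_clm S)

/-- An orthonormal family of eigenvectors of a compact operator has only finitely many members
whose eigenvalue is bounded below by a given positive number. -/
theorem finite_of_orthonormal_of_isCompactOperator {ι : Type*} {T : H →L[ℂ] H}
    (hT : IsCompactOperator T) {e : ι → H} (he : Orthonormal ℂ e) {c : ι → ℝ}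
    (hc : ∀ i, T (e i) = (c i : ℂ) • e i) {δ : ℝ} (hδ : 0 < δ) : {i | δ ≤ c i}.Finite := by
  by_contra hinf
  have hinf : {i | δ ≤ c i}.Infinite := hinf
  obtain ⟨f⟩ : Nonempty (ℕ ↪ {i | δ ≤ c i}) := ⟨hinf.natEmbedding⟩
  have hcpt := hT.isCompact_closure_image_closedBall (𝕜₁ := ℂ) (f := (T : H →ₗ[ℂ] H)) 1
  obtain ⟨a, -, φ, hφ, ha⟩ := hcpt.tendsto_subseq (x := fun n => T (e (f n))) fun n =>
    subset_closure ⟨e (f n), by simp [he.1], rfl⟩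
  have hcau := ha.cauchySeq
  obtain ⟨N, hN⟩ := Metric.cauchySeq_iff.1 hcau δ hδ
  have h1 := hN N le_rfl (N + 1) (Nat.le_succ N)
  have hne : (f (φ N) : ι) ≠ f (φ (N + 1)) := fun hh =>
    (hφ (Nat.lt_succ_self N)).ne (f.injective (Subtype.ext hh))
  rw [dist_eq_norm] at h1
  simp only [Function.comp, hc] at h1
  -- Pairing the difference of the two images with one eigenvector isolates its eigenvalue, which is
  -- at least `δ`.
  have h2 : ‖inner ℂ (e (f (φ N)))
      ((c (f (φ N)) : ℂ) • e (f (φ N)) - (c (f (φ (N + 1))) : ℂ) • e (f (φ (N + 1))))‖ < δ := by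
    refine (norm_inner_le_norm _ _).trans_lt ?_
    rw [he.1, one_mul]; exact h1
  rw [inner_sub_right, inner_smul_right, inner_smul_right, he.2 hne, inner_self_eq_norm_sq_to_K,
    he.1] at h2
  have h3 : δ ≤ c (f (φ N)) := (f (φ N)).2
  simp only [RCLike.ofReal_one, one_pow, mul_one, mul_zero, sub_zero, Complex.norm_real,
    Real.norm_eq_abs] at h2
  linarith [le_abs_self (c (f (φ N)))]

end CompactOperators

/-- An infinite family of real numbers with finitely many members below any bound can be listed
in nondecreasing order. -/
theorem exists_equiv_nat_monotone {ι : Type*} [Infinite ι] (val : ι → ℝ)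
    (hfin : ∀ c, {i | val i ≤ c}.Finite) : ∃ e : ℕ ≃ ι, Monotone (val ∘ e) := by
  have hcount : Countable ι := by
    have : (univ : Set ι) = ⋃ n : ℕ, {i | val i ≤ n} := by
      ext i
      obtain ⟨n, hn⟩ := exists_nat_ge (val i)
      simpa using ⟨n, hn⟩
    rw [← Set.countable_univ_iff, this]
    exact countable_iUnion fun n => (hfin n).countable
  obtain ⟨code, hcode⟩ := hcount.exists_injective_nat
  -- Ties between equal values are broken by an injective code. Every element then has finitely many
  -- predecessors, and their number serves as its rank.
  let f : ι → ℝ ×ₗ ℕ := fun i => toLex (val i, code i)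
  have hf : Function.Injective f := fun i j hij => by
    have := congrArg (fun p => (ofLex p).2) hij
    exact hcode this
  have hfin' : ∀ i, {j | f j < f i}.Finite := fun i => (hfin (val i)).subset fun j hj => by
    rcases Prod.Lex.lt_iff.1 hj with h | h
    · exact h.le
    · exact h.1.le
  let rk : ι → ℕ := fun i => {j | f j < f i}.ncard
  have hrk : ∀ i j, f i < f j → rk i < rk j := fun i j hij =>
    Set.ncard_lt_ncard ⟨fun k hk => lt_trans hk hij, fun hh => lt_irrefl (f i) (hh hij)⟩ (hfin' j)
  have hrki : Function.Injective rk := fun i j hij => by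
    rcases lt_trichotomy (f i) (f j) with h | h | h
    · exact absurd hij (hrk _ _ h).ne
    · exact hf h
    · exact absurd hij (hrk _ _ h).ne'
  have : Infinite (range rk) := (Set.infinite_range_of_injective hrki).to_subtype
  classical
  let o := Nat.Subtype.orderIsoOfNat (range rk)
  let g := Equiv.ofInjective rk hrki
  refine ⟨o.toEquiv.trans g.symm, fun a b hab => ?_⟩
  by_contra hlt
  have hlt : val (g.symm (o b)) < val (g.symm (o a)) := not_le.1 hlt
  have h1 := hrk _ _ (show f (g.symm (o b)) < f (g.symm (o a)) from
    Prod.Lex.lt_iff.2 (Or.inl hlt))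
  have h2 : ∀ x, rk (g.symm (o x)) = o x := fun x => congrArg Subtype.val (g.apply_symm_apply (o x))
  rw [h2, h2] at h1
  exact absurd h1 (not_lt.2 (o.monotone hab))

/-! ### Operators of quadratic forms, variational principle and Filonov's comparison. -/

section Forms

variable {H Q : Type*} [NormedAddCommGroup H] [InnerProductSpace ℂ H] [CompleteSpace H]
  [NormedAddCommGroup Q] [InnerProductSpace ℂ Q] [CompleteSpace Q]

/-- The operator `(A + 1)⁻¹`, where `A` is the operator in `H` associated with the quadratic form
`v ↦ ‖v‖² - ‖ι v‖²` on `Q`. -/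
def formResolvent (ι : Q →L[ℂ] H) : H →L[ℂ] H := ι ∘L ContinuousLinearMap.adjoint ι

/-- `A` is the operator in `H` associated with the form `v ↦ ‖v‖² - ‖ι v‖²` on `Q`. -/
def IsFormOperator (ι : Q →L[ℂ] H) (A : H →ₗ.[ℂ] H) : Prop :=
  ∀ u f, (∃ h : u ∈ A.domain, A ⟨u, h⟩ = f) ↔ formResolvent ι (f + u) = u

variable {ι : Q →L[ℂ] H} {A : H →ₗ.[ℂ] H}

theorem formResolvent_inner_left (ι : Q →L[ℂ] H) (u v : H) :
    inner ℂ (formResolvent ι u) v = inner ℂ u (formResolvent ι v) := by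
  simp only [formResolvent, ContinuousLinearMap.comp_apply]
  rw [← ContinuousLinearMap.adjoint_inner_right, ContinuousLinearMap.adjoint_inner_left]

theorem formResolvent_isSymmetric (ι : Q →L[ℂ] H) :
    ((formResolvent ι : H →L[ℂ] H) : H →ₗ[ℂ] H).IsSymmetric :=
  formResolvent_inner_left ι

theorem formResolvent_inner_self (ι : Q →L[ℂ] H) (u : H) :
    inner ℂ u (formResolvent ι u) = ((‖ContinuousLinearMap.adjoint ι u‖ ^ 2 : ℝ) : ℂ) := by
  simp only [formResolvent, ContinuousLinearMap.comp_apply]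
  rw [← ContinuousLinearMap.adjoint_inner_left, inner_self_eq_norm_sq_to_K]
  simp

theorem formResolvent_injective (hι : DenseRange ι) : Function.Injective (formResolvent ι) := by
  rw [injective_iff_map_eq_zero]
  intro u hu
  have h := formResolvent_inner_self ι u
  rw [hu, inner_zero_right] at h
  have h0 : ContinuousLinearMap.adjoint ι u = 0 := by
    have : ‖ContinuousLinearMap.adjoint ι u‖ ^ 2 = 0 := by exact_mod_cast h.symm
    simpa using this
  refine hι.eq_zero_of_inner_left ℂ ?_
  intro v
  rw [← ContinuousLinearMap.adjoint_inner_left, h0, inner_zero_left]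

theorem IsFormOperator.mem_eigenspace_iff (hA : IsFormOperator ι A) {z : ℂ} {u : H} :
    u ∈ eigenspace A z ↔ formResolvent ι ((z + 1) • u) = u := by
  rw [add_smul, one_smul, ← hA]
  simp only [eigenspace, Submodule.mem_map, LinearMap.mem_ker]
  constructor
  · rintro ⟨⟨w, hw⟩, h, rfl⟩
    exact ⟨hw, sub_eq_zero.1 h⟩
  · rintro ⟨h, h'⟩
    exact ⟨⟨u, h⟩, sub_eq_zero.2 h', rfl⟩

theorem IsFormOperator.isCompactOperator (hA : IsFormOperator ι A) (hc : HasCompactResolvent A) :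
    IsCompactOperator ι := by
  obtain ⟨z, R, hR, -, hR2⟩ := hc
  apply isCompactOperator_of_comp_adjoint
  change IsCompactOperator (formResolvent ι)
  -- Resolvent identity: with `T = (A + 1)⁻¹` one has `(A - z) T f = f - (1 + z) T f`. Thus `ι ι*`
  -- is compact, and so is `ι`.
  have h : (formResolvent ι : H → H) =
      R ∘ ((ContinuousLinearMap.id ℂ H - (1 + z) • formResolvent ι : H →L[ℂ] H) : H → H) := by
    funext f
    obtain ⟨h1, h2⟩ := (hA (formResolvent ι f) (f - formResolvent ι f)).2 (by simp)
    have h3 := hR2 ⟨_, h1⟩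
    rw [h2] at h3
    refine h3.symm.trans (congrArg R ?_)
    rw [sub_apply, ContinuousLinearMap.id_apply, smul_apply, add_smul, one_smul]
    abel
  rw [h]
  exact hR.comp_clm _

theorem formResolvent_inner_eq_zero {z z' : ℝ} (hzz : z ≠ z') {u v : H}
    (hu : formResolvent ι (((z : ℂ) + 1) • u) = u)
    (hv : formResolvent ι (((z' : ℂ) + 1) • v) = v) : inner ℂ u v = 0 := by
  rw [map_smul] at hu hv
  have h1 : inner ℂ u v = ((z : ℂ) + 1) * inner ℂ u (formResolvent ι v) := by
    conv_lhs => rw [← hu]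
    rw [inner_smul_left, formResolvent_inner_left]
    simp
  have h2 : inner ℂ u v = ((z' : ℂ) + 1) * inner ℂ u (formResolvent ι v) := by
    conv_lhs => rw [← hv]
    rw [inner_smul_right]
  have h3 : ((z : ℂ) - z') * inner ℂ u (formResolvent ι v) = 0 := by
    linear_combination h2 - h1
  rcases mul_eq_zero.1 h3 with h | h
  · exact absurd (by exact_mod_cast sub_eq_zero.1 h) hzz
  · rw [h1, h, mul_zero]

/-- The eigenvalues of a form operator are nonnegative real numbers shifted by the lower bound. -/
theorem eq_real_of_formResolvent_smul {z : ℂ} {u : H} (hu : formResolvent ι ((z + 1) • u) = u)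
    (h0 : u ≠ 0) : ∃ x : ℝ, 0 < x + 1 ∧ z = x := by
  rw [map_smul] at hu
  have h1 := formResolvent_inner_self ι u
  have h2 : (z + 1) * inner ℂ u (formResolvent ι u) = ((‖u‖ ^ 2 : ℝ) : ℂ) := by
    rw [← inner_smul_right, hu, inner_self_eq_norm_sq_to_K]; simp
  rw [h1] at h2
  have hu0 : 0 < ‖u‖ ^ 2 := by have := norm_pos_iff.2 h0; positivity
  set a := ‖ContinuousLinearMap.adjoint ι u‖ ^ 2 with ha
  have ha0 : a ≠ 0 := by
    intro h
    rw [h, Complex.ofReal_zero, mul_zero] at h2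
    exact hu0.ne (by exact_mod_cast h2)
  have hap : 0 < a := lt_of_le_of_ne (by positivity) ha0.symm
  refine ⟨‖u‖ ^ 2 / a - 1, by have := div_pos hu0 hap; linarith, ?_⟩
  have hac : (a : ℂ) ≠ 0 := by exact_mod_cast ha0
  push_cast
  rw [eq_sub_iff_add_eq, eq_div_iff hac, h2]
  push_cast; rfl

theorem IsFormOperator.eigenspace_eq (hA : IsFormOperator ι A) {z : ℂ} (hz : z + 1 ≠ 0) :
    eigenspace A z = Module.End.eigenspace ((formResolvent ι : H →L[ℂ] H) : H →ₗ[ℂ] H) (z + 1)⁻¹ := by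
  ext u
  rw [hA.mem_eigenspace_iff, Module.End.mem_eigenspace_iff, map_smul]
  change _ ↔ formResolvent ι u = _
  rw [eq_inv_smul_iff₀ hz]

theorem IsFormOperator.finiteDimensional_eigenspace (hA : IsFormOperator ι A)
    (hc : IsCompactOperator ι) (z : ℂ) : FiniteDimensional ℂ (eigenspace A z) := by
  by_cases hz : z + 1 = 0
  · have : eigenspace A z = ⊥ := by
      rw [eq_bot_iff]
      intro u hu
      rw [hA.mem_eigenspace_iff, hz, zero_smul, map_zero] at hu
      exact hu.symm
    rw [this]; infer_instance
  · rw [hA.eigenspace_eq hz]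
    exact ContinuousLinearMap.finite_dimensional_eigenspace (hc.comp_clm _) _ (inv_ne_zero hz)

/-- A subspace containing all eigenspaces with real eigenvalue is dense. -/
theorem IsFormOperator.orthogonal_eq_bot (hA : IsFormOperator ι A) (hc : IsCompactOperator ι)
    (hι : DenseRange ι) {S : Submodule ℂ H} (hS : ∀ z : ℝ, eigenspace A z ≤ S) : Sᗮ = ⊥ := by
  have h := ContinuousLinearMap.orthogonalComplement_iSup_eigenspaces_eq_bot
    (T := formResolvent ι) (hc.comp_clm _) (formResolvent_isSymmetric ι)
  rw [eq_bot_iff, ← h]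
  refine Submodule.orthogonal_le (iSup_le fun c u hu => ?_)
  rw [Module.End.mem_eigenspace_iff] at hu
  change formResolvent ι u = c • u at hu
  by_cases h0 : u = 0
  · rw [h0]; exact zero_mem _
  have hc0 : c ≠ 0 := by
    rintro rfl
    rw [zero_smul] at hu
    exact h0 (formResolvent_injective hι (hu.trans (map_zero _).symm))
  have h1 : formResolvent ι (((c⁻¹ - 1) + 1) • u) = u := by
    rw [sub_add_cancel, map_smul, hu, inv_smul_smul₀ hc0]
  obtain ⟨x, -, hx⟩ := eq_real_of_formResolvent_smul h1 h0
  refine hS x ?_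
  rw [hA.mem_eigenspace_iff, ← hx]; exact h1

/-- Spectral theorem for the compact operator `(A + 1)⁻¹`. Bases of the real eigenspaces together
form an orthonormal family with dense span. It is infinite because `H` is infinite dimensional. Only
finitely many eigenvalues lie below a given bound, since the corresponding values `(z + 1)⁻¹` stay
away from zero. -/
theorem IsFormOperator.exists_enumeration (hA : IsFormOperator ι A) (hc : IsCompactOperator ι)
    (hι : DenseRange ι) (hH : ¬ FiniteDimensional ℂ H) : ∃ l, IsEigenvalueEnumeration A l := by
  have hfd := hA.finiteDimensional_eigenspace hc
  let J : Type := Σ z : ℝ, Fin (Module.finrank ℂ (eigenspace A z))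
  let b : ∀ z : ℝ, OrthonormalBasis (Fin (Module.finrank ℂ (eigenspace A z))) ℂ (eigenspace A z) :=
    fun z => stdOrthonormalBasis ℂ (eigenspace A z)
  let e : J → H := fun a => (b a.1 a.2 : H)
  have hmem : ∀ a : J, formResolvent ι (((a.1 : ℂ) + 1) • e a) = e a := fun a =>
    hA.mem_eigenspace_iff.1 (b a.1 a.2).2
  have hnorm : ∀ a : J, ‖e a‖ = 1 := fun a => (b a.1).orthonormal.1 a.2
  have hne : ∀ a : J, e a ≠ 0 := fun a h => by
    have := hnorm a
    rw [h, norm_zero] at this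
    exact zero_ne_one this
  have hpos : ∀ a : J, 0 < a.1 + 1 := fun a => by
    obtain ⟨x, hx, hx'⟩ := eq_real_of_formResolvent_smul (hmem a) (hne a)
    have : a.1 = x := by exact_mod_cast hx'
    rwa [this]
  have hon : Orthonormal ℂ e := by
    refine ⟨hnorm, ?_⟩
    rintro ⟨z, i⟩ ⟨z', i'⟩ hij
    by_cases hz : z = z'
    · subst hz
      have : i ≠ i' := fun h => hij (by rw [h])
      exact (b z).orthonormal.2 this
    · exact formResolvent_inner_eq_zero hz (hmem ⟨z, i⟩) (hmem ⟨z', i'⟩)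
  have heig : ∀ a : J, formResolvent ι (e a) = (((a.1 + 1)⁻¹ : ℝ) : ℂ) • e a := fun a => by
    have h1 := hmem a
    have h2 : (a.1 : ℂ) + 1 ≠ 0 := by exact_mod_cast (hpos a).ne'
    rw [map_smul] at h1
    push_cast
    rw [eq_inv_smul_iff₀ h2, h1]
  have hfin : ∀ c : ℝ, {a : J | a.1 ≤ c}.Finite := fun c => by
    refine (finite_of_orthonormal_of_isCompactOperator (T := formResolvent ι) (hc.comp_clm _) hon
      heig (δ := (|c| + 1)⁻¹) (by positivity)).subset fun a ha => ?_
    have : a.1 ≤ c := ha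
    exact inv_anti₀ (hpos a) (by linarith [le_abs_self c])
  have hspan : (Submodule.span ℂ (range e))ᗮ = ⊥ := by
    refine hA.orthogonal_eq_bot hc hι fun z u hu => ?_
    have h1 : (⟨u, hu⟩ : eigenspace A z) ∈ Submodule.span ℂ (range (b z)) := by
      have := (b z).toBasis.mem_span ⟨u, hu⟩
      simpa using this
    have h2 := Submodule.mem_map_of_mem (f := (eigenspace A z).subtype) h1
    rw [Submodule.map_span] at h2
    refine Submodule.span_mono ?_ h2
    rintro _ ⟨_, ⟨i, rfl⟩, rfl⟩
    exact ⟨⟨z, i⟩, rfl⟩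
  have hinf : Infinite J := by
    by_contra h
    have hfJ : Finite J := not_infinite_iff_finite.1 h
    have : FiniteDimensional ℂ (Submodule.span ℂ (range e)) :=
      FiniteDimensional.span_of_finite ℂ (Set.finite_range e)
    have h1 := Submodule.orthogonal_eq_bot_iff.1 hspan
    rw [h1] at this
    exact hH (Module.Finite.equiv (Submodule.topEquiv (R := ℂ) (M := H)))
  obtain ⟨f, hf⟩ := exists_equiv_nat_monotone (fun a : J => a.1) hfin
  refine ⟨fun k => (f k).1, hf, ?_, hfd, fun z => ?_⟩
  · rw [← Nat.cofinite_eq_atTop, tendsto_atTop]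
    intro c
    refine Filter.eventually_cofinite.2 (((hfin c).preimage f.injective.injOn).subset fun k hk => ?_)
    exact (not_le.1 hk).le
  · by_cases hz : ∃ x : ℝ, z = x
    · obtain ⟨x, rfl⟩ := hz
      have h1 : {k : ℕ | ((f k).1 : ℂ) = x} = f.symm '' range (fun i => (⟨x, i⟩ : J)) := by
        ext k
        simp only [mem_ofPred_eq, mem_image, mem_range, exists_exists_eq_and]
        constructor
        · intro hk
          have hk : (f k).1 = x := by exact_mod_cast hk
          obtain ⟨i, hi⟩ : ∃ i, (⟨x, i⟩ : J) = f k := by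
            rcases hfk : f k with ⟨y, i⟩
            rw [hfk] at hk
            subst hk
            exact ⟨i, rfl⟩
          exact ⟨i, by rw [hi, Equiv.symm_apply_apply]⟩
        · rintro ⟨i, rfl⟩
          rw [Equiv.apply_symm_apply]
      have h2 : Function.Injective
          (fun i : Fin (Module.finrank ℂ (eigenspace A x)) => (⟨x, i⟩ : J)) :=
        fun i i' h => by
          injection h with _ h'
      rw [h1, Set.ncard_image_of_injective _ f.symm.injective, ← Set.image_univ,
        Set.ncard_image_of_injective _ h2, Set.ncard_univ, Nat.card_fin]
    · have h1 : {k : ℕ | ((f k).1 : ℂ) = z} = ∅ := by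
        ext k
        simp only [mem_ofPred_eq, mem_empty_iff_false, iff_false]
        exact fun h => hz ⟨_, h.symm⟩
      have h2 : eigenspace A z = ⊥ := by
        rw [eq_bot_iff]
        intro u hu
        by_contra h0
        obtain ⟨x, -, hx⟩ := eq_real_of_formResolvent_smul (hA.mem_eigenspace_iff.1 hu) h0
        exact hz ⟨x, hx⟩
      rw [h1, h2, Set.ncard_empty, finrank_bot]

/-- An enumeration of the eigenvalues is realized by an orthonormal sequence of eigenvectors that
contains a basis of every eigenspace. -/
theorem IsFormOperator.exists_orthonormal (hA : IsFormOperator ι A) {l : ℕ → ℝ}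
    (hl : IsEigenvalueEnumeration A l) : ∃ e : ℕ → H, Orthonormal ℂ e ∧
      (∀ k, formResolvent ι (((l k : ℂ) + 1) • e k) = e k) ∧
      ∀ z : ℝ, eigenspace A z ≤ Submodule.span ℂ (range e) := by
  have hfd := hl.finiteDimensional
  have hfin : ∀ z : ℝ, Finite {k : ℕ // l k = z} := fun z => by
    have h1 := (tendsto_atTop.1 hl.tendsto (z + 1))
    rw [← Nat.cofinite_eq_atTop, Filter.eventually_cofinite] at h1
    exact (h1.subset fun k (hk : l k = z) => by simp [hk]).to_subtype
  have hcard : ∀ z : ℝ, Nat.card {k : ℕ // l k = z} = Module.finrank ℂ (eigenspace A z) := fun z => by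
    rw [hl.multiplicity]
    have : {k : ℕ | (l k : ℂ) = z} = {k : ℕ | l k = z} := by ext k; simp
    rw [this]; rfl
  let _ : ∀ z : ℝ, Fintype {k : ℕ // l k = z} := fun z => @Fintype.ofFinite _ (hfin z)
  -- The multiplicity condition lets the positions `k` with `l k = z` index a basis of the
  -- eigenspace, so each position receives its own vector.
  let b : ∀ z : ℝ, OrthonormalBasis {k : ℕ // l k = z} ℂ (eigenspace A z) := fun z =>
    (stdOrthonormalBasis ℂ (eigenspace A z)).reindex (Finite.equivFinOfCardEq (hcard z)).symm
  let e : ℕ → H := fun k => (b (l k) ⟨k, rfl⟩ : H)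
  have he : ∀ (z : ℝ) (k : {k : ℕ // l k = z}), e k = b z k := by
    rintro z ⟨k, rfl⟩; rfl
  have hmem : ∀ k, formResolvent ι (((l k : ℂ) + 1) • e k) = e k := fun k =>
    hA.mem_eigenspace_iff.1 (b (l k) ⟨k, rfl⟩).2
  refine ⟨e, ⟨fun k => (b (l k)).orthonormal.1 _, fun k k' hk => ?_⟩, hmem, fun z u hu => ?_⟩
  · by_cases hz : l k = l k'
    · change inner ℂ (e k) (e k') = 0
      rw [he (l k') ⟨k, hz⟩, he (l k') ⟨k', rfl⟩]
      exact (b (l k')).orthonormal.2 fun h => hk (congrArg Subtype.val h)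
    · exact formResolvent_inner_eq_zero hz (hmem k) (hmem k')
  · have h1 : (⟨u, hu⟩ : eigenspace A z) ∈ Submodule.span ℂ (range (b z)) := by
      have := (b z).toBasis.mem_span ⟨u, hu⟩
      simpa using this
    have h2 := Submodule.mem_map_of_mem (f := (eigenspace A z).subtype) h1
    rw [Submodule.map_span] at h2
    refine Submodule.span_mono ?_ h2
    rintro _ ⟨_, ⟨k, rfl⟩, rfl⟩
    exact ⟨k, he z k⟩

/-- The eigenvector `e` of the form operator, as an element of the form domain. -/
theorem inner_smul_adjoint (c : ℝ) (e : H) (v : Q) :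
    inner ℂ (((c : ℂ) + 1) • ContinuousLinearMap.adjoint ι e) v
      = ((c : ℂ) + 1) * inner ℂ e (ι v) := by
  rw [inner_smul_left, ContinuousLinearMap.adjoint_inner_left]
  simp

theorem map_smul_adjoint {c : ℂ} {e : H} (he : formResolvent ι ((c + 1) • e) = e) :
    ι ((c + 1) • ContinuousLinearMap.adjoint ι e) = e := by
  rw [← map_smul]; exact he

/-- Parseval in `H` gives `‖ι w‖² = ∑ |⟨e k, ι w⟩|²`, and Bessel in `Q` gives `‖w‖² ≥ ∑ (l k + 1)
|⟨e k, ι w⟩|²`. Only indices with `l k > c` contribute. Without strict inequality all coefficients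
vanish, and then `ι w = 0`. -/
theorem norm_sq_gt_of_inner_eq_zero {l : ℕ → ℝ} {e : ℕ → H} (he : Orthonormal ℂ e)
    (hT : ∀ k, formResolvent ι (((l k : ℂ) + 1) • e k) = e k)
    (hspan : (Submodule.span ℂ (range e))ᗮ = ⊥) {c : ℝ} {w : Q} (hw : ι w ≠ 0)
    (horth : ∀ k, l k ≤ c → inner ℂ (e k) (ι w) = 0) : (1 + c) * ‖ι w‖ ^ 2 < ‖w‖ ^ 2 := by
  have hpos : ∀ k, 0 < l k + 1 := fun k => by
    obtain ⟨x, hx, hx'⟩ := eq_real_of_formResolvent_smul (hT k) (he.ne_zero k)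
    have : l k = x := by exact_mod_cast hx'
    rwa [this]
  let s : ℕ → ℝ := fun k => Real.sqrt (l k + 1)
  have hs : ∀ k, s k * s k = l k + 1 := fun k => Real.mul_self_sqrt (hpos k).le
  have hs0 : ∀ k, s k ≠ 0 := fun k => (Real.sqrt_pos.2 (hpos k)).ne'
  -- The element of `Q` above `e k` is `(l k + 1) ι* (e k)`, of norm `√(l k + 1)`; this is its
  -- normalization.
  let f : ℕ → Q := fun k => (s k : ℂ) • ContinuousLinearMap.adjoint ι (e k)
  have hf : ∀ k v, inner ℂ (f k) v = s k * inner ℂ (e k) (ι v) := fun k v => by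
    simp only [f]
    rw [inner_smul_left, ContinuousLinearMap.adjoint_inner_left]
    simp
  have hιf : ∀ k, (s k : ℂ) • ι (f k) = e k := fun k => by
    simp only [f]
    rw [← map_smul, smul_smul, ← Complex.ofReal_mul, hs, ← map_smul]
    have := hT k
    push_cast
    exact this
  have hfo : Orthonormal ℂ f := by
    rw [orthonormal_iff_ite]
    intro j k
    have h1 : (s k : ℂ) * inner ℂ (f j) (f k) = s j * inner ℂ (e j) (e k) := by
      rw [hf, ← hιf k, inner_smul_right]; ring
    have h0 : (s k : ℂ) ≠ 0 := by exact_mod_cast hs0 k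
    rw [orthonormal_iff_ite.1 he] at h1
    split_ifs with hjk
    · subst hjk
      rw [if_pos rfl] at h1
      exact mul_left_cancel₀ h0 h1
    · rw [if_neg hjk, mul_zero] at h1
      exact (mul_eq_zero.1 h1).resolve_left h0
  let B : HilbertBasis ℕ ℂ H := HilbertBasis.mkOfOrthogonalEqBot he hspan
  have hB : ∀ k, B k = e k := fun k => by simp [B]
  have hpars : HasSum (fun k => ‖inner ℂ (e k) (ι w)‖ ^ 2) (‖ι w‖ ^ 2) := by
    have h1 := B.hasSum_inner_mul_inner (ι w) (ι w)
    have h2 := Complex.hasSum_re h1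
    rw [inner_self_eq_norm_sq_to_K] at h2
    convert h2 using 1
    · funext k
      rw [hB, ← inner_conj_symm (ι w), Complex.conj_mul']
      norm_cast
    · simp [← Complex.ofReal_pow]
  have hbes := hfo.inner_products_summable w
  have hbes' := hfo.tsum_inner_products_le w
  have hterm : ∀ k, ‖inner ℂ (f k) w‖ ^ 2 = (l k + 1) * ‖inner ℂ (e k) (ι w)‖ ^ 2 := fun k => by
    rw [hf, norm_mul, mul_pow, Complex.norm_real, Real.norm_eq_abs, sq_abs, pow_two (s k), hs]
  simp only [hterm] at hbes hbes'
  by_contra hle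
  rw [not_lt] at hle
  have hdiff := hbes.hasSum.sub (hpars.mul_left (1 + c))
  have hnn : ∀ k, 0 ≤ (l k + 1) * ‖inner ℂ (e k) (ι w)‖ ^ 2
      - (1 + c) * ‖inner ℂ (e k) (ι w)‖ ^ 2 := fun k => by
    by_cases hk : l k ≤ c
    · rw [horth k hk]; simp
    · rw [← sub_mul]; exact mul_nonneg (by linarith [not_le.1 hk]) (by positivity)
  have hzero : ∀ k, inner ℂ (e k) (ι w) = 0 := fun k => by
    by_cases hk : l k ≤ c
    · exact horth k hk
    · have h1 := le_hasSum hdiff k fun j _ => hnn j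
      have h2 : (l k - c) * ‖inner ℂ (e k) (ι w)‖ ^ 2 ≤ 0 := by nlinarith
      have h3 : 0 < l k - c := by linarith [not_le.1 hk]
      have h4 : ‖inner ℂ (e k) (ι w)‖ ^ 2 ≤ 0 := by
        by_contra h
        exact absurd h2 (not_le.2 (mul_pos h3 (not_le.1 h)))
      exact norm_eq_zero.1 (pow_eq_zero_iff two_ne_zero |>.1 (le_antisymm h4 (by positivity)))
  simp only [hzero, norm_zero, ne_eq, two_ne_zero, not_false_eq_true, zero_pow] at hpars
  have h5 := hpars.unique hasSum_zero
  exact hw (norm_eq_zero.1 (pow_eq_zero_iff two_ne_zero |>.1 h5))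

/-- Glazman's form of the variational principle. If the form is at most `c` on `L`, no nonzero
element of `L` is orthogonal to all eigenvectors with eigenvalue `≤ c`, so the inner products with
them embed `L`. -/
theorem IsFormOperator.finrank_le (hA : IsFormOperator ι A) (hc : IsCompactOperator ι)
    (hι : DenseRange ι) {l : ℕ → ℝ} (hl : IsEigenvalueEnumeration A l) {c : ℝ}
    (L : Submodule ℂ Q) (hL : ∀ w ∈ L, ‖w‖ ^ 2 ≤ (1 + c) * ‖ι w‖ ^ 2) :
    Module.finrank ℂ L ≤ {k : ℕ | l k ≤ c}.ncard := by
  obtain ⟨e, he, hT, hspan⟩ := hA.exists_orthonormal hl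
  have hs := hA.orthogonal_eq_bot hc hι hspan
  have hfin : {k : ℕ | l k ≤ c}.Finite := by
    have h1 := (tendsto_atTop.1 hl.tendsto (c + 1))
    rw [← Nat.cofinite_eq_atTop, Filter.eventually_cofinite] at h1
    exact h1.subset fun k (hk : l k ≤ c) => by
      simp only [mem_ofPred_eq, not_le]; linarith
  have : Finite {k : ℕ | l k ≤ c} := hfin.to_subtype
  have : Fintype {k : ℕ | l k ≤ c} := Fintype.ofFinite _
  let Φ : L →ₗ[ℂ] ({k : ℕ | l k ≤ c} → ℂ) :=
    LinearMap.pi fun k => (innerSL ℂ (e k) : H →ₗ[ℂ] ℂ) ∘ₗ (ι : Q →ₗ[ℂ] H) ∘ₗ L.subtype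
  have hΦ : Function.Injective Φ := by
    rw [injective_iff_map_eq_zero]
    rintro ⟨w, hw⟩ h
    have h0 : ∀ k, l k ≤ c → inner ℂ (e k) (ι w) = 0 := fun k hk => congrFun h ⟨k, hk⟩
    have h1 := hL w hw
    by_cases hιw : ι w = 0
    · rw [hιw] at h1
      have h2 : ‖w‖ ^ 2 ≤ 0 := by simpa using h1
      have h3 := norm_eq_zero.1 (pow_eq_zero_iff two_ne_zero |>.1 (le_antisymm h2 (by positivity)))
      exact Subtype.ext h3
    · exact absurd h1 (not_le.2 (norm_sq_gt_of_inner_eq_zero he hT hs hιw h0))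
  have := LinearMap.finrank_le_finrank_of_injective hΦ
  rwa [Module.finrank_fintype_fun_eq_card, ← Nat.card_eq_fintype_card] at this

/-- The sesquilinear form of `A - c`. -/
def shiftedForm (ι : Q →L[ℂ] H) (c : ℝ) (v w : Q) : ℂ :=
  inner ℂ v w - (1 + c) * inner ℂ (ι v) (ι w)

theorem shiftedForm_add_left (c : ℝ) (v v' w : Q) :
    shiftedForm ι c (v + v') w = shiftedForm ι c v w + shiftedForm ι c v' w := by
  simp only [shiftedForm, map_add, inner_add_left]; ring

theorem shiftedForm_smul_left (c : ℝ) (a : ℂ) (v w : Q) :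
    shiftedForm ι c (a • v) w = starRingEnd ℂ a * shiftedForm ι c v w := by
  simp only [shiftedForm, map_smul, inner_smul_left]; ring

theorem shiftedForm_conj (c : ℝ) (v w : Q) :
    starRingEnd ℂ (shiftedForm ι c v w) = shiftedForm ι c w v := by
  simp only [shiftedForm, map_sub, map_mul, inner_conj_symm, map_add, map_one, Complex.conj_ofReal]

theorem shiftedForm_add_right (c : ℝ) (v w w' : Q) :
    shiftedForm ι c v (w + w') = shiftedForm ι c v w + shiftedForm ι c v w' := by
  simp only [shiftedForm, map_add, inner_add_right]; ring

theorem shiftedForm_smul_right (c : ℝ) (a : ℂ) (v w : Q) :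
    shiftedForm ι c v (a • w) = a * shiftedForm ι c v w := by
  simp only [shiftedForm, map_smul, inner_smul_right]; ring

theorem shiftedForm_self (c : ℝ) (v : Q) :
    shiftedForm ι c v v = ((‖v‖ ^ 2 - (1 + c) * ‖ι v‖ ^ 2 : ℝ) : ℂ) := by
  simp only [shiftedForm, inner_self_eq_norm_sq_to_K]
  push_cast; rfl

/-- The weak eigenvalue equation: eigenvectors for `c` span a subspace of the radical of the form
shifted by `c`. -/
theorem shiftedForm_eigenvector {c : ℝ} {u : H}
    (hu : formResolvent ι (((c : ℂ) + 1) • u) = u) (v : Q) :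
    shiftedForm ι c (((c : ℂ) + 1) • ContinuousLinearMap.adjoint ι u) v = 0 := by
  rw [shiftedForm, inner_smul_adjoint, map_smul_adjoint hu]; ring

/-- On the span of the first `j + 1` eigenvectors the form of `A - l j` is nonpositive. -/
theorem shiftedForm_sum_eigenvectors {l : ℕ → ℝ} (hl : Monotone l) {e : ℕ → H}
    (he : Orthonormal ℂ e) (hT : ∀ k, formResolvent ι (((l k : ℂ) + 1) • e k) = e k) (j : ℕ)
    (a : Fin (j + 1) → ℂ) :
    ‖∑ k, a k • (((l k : ℂ) + 1) • ContinuousLinearMap.adjoint ι (e k))‖ ^ 2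
      ≤ (1 + l j) * ‖ι (∑ k, a k • (((l k : ℂ) + 1) • ContinuousLinearMap.adjoint ι (e k)))‖ ^ 2 := by
  set f : Q := ∑ k, a k • (((l k : ℂ) + 1) • ContinuousLinearMap.adjoint ι (e k)) with hf
  have hιf : ι f = ∑ k, a k • e k := by
    rw [hf, map_sum]
    exact Finset.sum_congr rfl fun k _ => by rw [map_smul, map_smul_adjoint (hT k)]
  have he' : Orthonormal ℂ (fun k : Fin (j + 1) => e k) := he.comp _ Fin.val_injective
  have h1 : ∀ k : Fin (j + 1), inner ℂ (e k) (ι f) = a k := fun k => by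
    rw [hιf]; exact he'.inner_right_fintype a k
  have hn1 : ‖f‖ ^ 2 = ∑ k : Fin (j + 1), (l k + 1) * ‖a k‖ ^ 2 := by
    have h2 : inner ℂ f f = ∑ k : Fin (j + 1), starRingEnd ℂ (a k) * (((l k : ℂ) + 1) * a k) := by
      conv_lhs => rw [hf, sum_inner]
      refine Finset.sum_congr rfl fun k _ => ?_
      rw [inner_smul_left, inner_smul_adjoint, h1]
    rw [inner_self_eq_norm_sq_to_K] at h2
    have h3 : ((‖f‖ ^ 2 : ℝ) : ℂ) = ((∑ k : Fin (j + 1), (l k + 1) * ‖a k‖ ^ 2 : ℝ) : ℂ) := by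
      push_cast
      refine h2.trans (Finset.sum_congr rfl fun k _ => ?_)
      rw [mul_left_comm, Complex.conj_mul']
    exact_mod_cast h3
  have hn2 : ‖ι f‖ ^ 2 = ∑ k : Fin (j + 1), ‖a k‖ ^ 2 := by
    have h2 : inner ℂ (ι f) (ι f) = ∑ k : Fin (j + 1), starRingEnd ℂ (a k) * a k := by
      conv_lhs => rw [hιf, sum_inner]
      refine Finset.sum_congr rfl fun k _ => ?_
      rw [inner_smul_left, ← hιf, h1]
    rw [inner_self_eq_norm_sq_to_K] at h2
    have h3 : ((‖ι f‖ ^ 2 : ℝ) : ℂ) = ((∑ k : Fin (j + 1), ‖a k‖ ^ 2 : ℝ) : ℂ) := by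
      push_cast
      refine h2.trans (Finset.sum_congr rfl fun k _ => ?_)
      rw [Complex.conj_mul']
    exact_mod_cast h3
  rw [hn1, hn2, Finset.mul_sum]
  refine Finset.sum_le_sum fun k _ => mul_le_mul_of_nonneg_right ?_ (by positivity)
  have := hl (Nat.lt_succ_iff.1 k.2)
  linarith

/-- Comparison of the eigenvalues of the operators associated with a form on `Q` and with its
restriction to a closed subspace `D`. -/
theorem IsFormOperator.enumeration_lt {AN AD : H →ₗ.[ℂ] H} {D : Submodule ℂ Q} [CompleteSpace D]
    (hN : IsFormOperator ι AN) (hD : IsFormOperator (ι ∘L D.subtypeL) AD)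
    (hc : IsCompactOperator ι) (hι : DenseRange ι) {lD lN : ℕ → ℝ}
    (hlD : IsEigenvalueEnumeration AD lD) (hlN : IsEigenvalueEnumeration AN lN) (j : ℕ) {U U' : Q}
    (hU : ∀ d ∈ D, shiftedForm ι (lD j) d U = 0) (hUU : shiftedForm ι (lD j) U U = 0)
    (hU' : ∀ d ∈ D, shiftedForm ι (lD j) d U' = 0) (hUU' : shiftedForm ι (lD j) U U' ≠ 0)
    (hK : ∀ d ∈ D, (∀ v, shiftedForm ι (lD j) d v = 0) → d = 0) : lN (j + 1) < lD j := by
  obtain ⟨e, he, hT, -⟩ := hD.exists_orthonormal hlD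
  have hmono := shiftedForm_sum_eigenvectors hlD.monotone he hT j
  set c := lD j with hcdef
  have hfd := hlN.finiteDimensional c
  let ê : ℕ → D := fun k => ((lD k : ℂ) + 1) • ContinuousLinearMap.adjoint (ι ∘L D.subtypeL) (e k)
  let P : (Fin (j + 1) → ℂ) →ₗ[ℂ] D := Fintype.linearCombination ℂ (fun k : Fin (j + 1) => ê k)
  have hP : ∀ a, P a = ∑ k, a k • ê k := fun a => rfl
  let R : eigenspace AN c →ₗ[ℂ] Q :=
    (((c : ℂ) + 1) • ((ContinuousLinearMap.adjoint ι : H →L[ℂ] Q) : H →ₗ[ℂ] Q)) ∘ₗ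
      (eigenspace AN c).subtype
  have hR : ∀ u, R u = ((c : ℂ) + 1) • ContinuousLinearMap.adjoint ι (u : H) := fun u => rfl
  have hR0 : ∀ u v, shiftedForm ι c (R u) v = 0 := fun u v =>
    shiftedForm_eigenvector (hN.mem_eigenspace_iff.1 u.2) v
  have hR0' : ∀ u v, shiftedForm ι c v (R u) = 0 := fun u v => by
    rw [← shiftedForm_conj, hR0, map_zero]
  have hιR : ∀ u, ι (R u) = u := fun u => map_smul_adjoint (hN.mem_eigenspace_iff.1 u.2)
  have hιP : ∀ a, ι (P a) = ∑ k : Fin (j + 1), a k • e k := fun a => by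
    have h0 : ∀ d : D, ι d = (ι ∘L D.subtypeL) d := fun d => rfl
    rw [h0, hP, map_sum]
    exact Finset.sum_congr rfl fun k _ => by rw [map_smul, map_smul_adjoint (hT k)]
  -- The test space: the first `j + 1` Dirichlet eigenvectors, the wave `U`, and the Neumann
  -- eigenspace for `c`.
  let M : ((Fin (j + 1) → ℂ) × ℂ × eigenspace AN c) →ₗ[ℂ] Q :=
    (D.subtype ∘ₗ P).coprod (((LinearMap.id : ℂ →ₗ[ℂ] ℂ).smulRight U).coprod R)
  have hM : ∀ a b u, M (a, b, u) = (P a : Q) + (b • U + R u) := fun a b u => rfl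
  have hinj : Function.Injective M := by
    rw [injective_iff_map_eq_zero]
    rintro ⟨a, b, u⟩ h
    rw [hM] at h
    -- Pairing with `U'` annihilates `D` and the Neumann eigenvectors, but not `U`.
    have hb : b = 0 := by
      have h1 : shiftedForm ι c ((P a : Q) + (b • U + R u)) U' = 0 := by
        rw [h]; simp [shiftedForm]
      rw [shiftedForm_add_left, shiftedForm_add_left, shiftedForm_smul_left, hR0,
        hU' _ (P a).2, zero_add, add_zero] at h1
      simpa using (mul_eq_zero.1 h1).resolve_right hUU'
    rw [hb, zero_smul, zero_add] at h
    have h2 : (P a : Q) = - R u := eq_neg_of_add_eq_zero_left h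
    -- The remaining relation puts an element of `D` into the radical of the form, which `hK`
    -- excludes unless it is zero.
    have h3 : (P a : Q) = 0 := by
      refine hK _ (P a).2 fun v => ?_
      have h4 : (P a : Q) = (-1 : ℂ) • R u := by rw [h2]; simp
      rw [h4, shiftedForm_smul_left, hR0, mul_zero]
    have h5 : R u = 0 := by rw [h3] at h2; simpa using h2.symm
    have hu : u = 0 := by
      apply Subtype.ext
      rw [← hιR u, h5, map_zero]; rfl
    have ha : a = 0 := by
      have h6 := hιP a
      rw [h3, map_zero] at h6
      have he' : Orthonormal ℂ (fun k : Fin (j + 1) => e k) := he.comp _ Fin.val_injective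
      funext k
      have h7 := he'.inner_right_fintype a k
      rw [← h6, inner_zero_right] at h7
      exact h7.symm
    rw [ha, hb, hu]; rfl
  have hle := hN.finrank_le hc hι hlN (c := c) (LinearMap.range M) (by
    rintro _ ⟨⟨a, b, u⟩, rfl⟩
    rw [hM]
    set f : Q := (P a : Q) with hfdef
    -- All terms except the Dirichlet one drop out, so the sign is that of the form on the Dirichlet
    -- eigenvectors.
    have h1 : shiftedForm ι c (f + (b • U + R u)) (f + (b • U + R u)) = shiftedForm ι c f f := by
      have h2 : shiftedForm ι c f U = 0 := hU _ (P a).2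
      have h3 : shiftedForm ι c U f = 0 := by rw [← shiftedForm_conj, h2, map_zero]
      simp only [shiftedForm_add_left, shiftedForm_add_right, shiftedForm_smul_left,
        shiftedForm_smul_right, hR0, hR0', hUU, h2, h3]
      ring
    rw [shiftedForm_self, shiftedForm_self] at h1
    have h1' := Complex.ofReal_injective h1
    have h4 : ‖f‖ ^ 2 ≤ (1 + c) * ‖ι f‖ ^ 2 := hmono a
    linarith)
  rw [LinearMap.finrank_range_of_inj hinj] at hle
  simp only [Module.finrank_prod, Module.finrank_fintype_fun_eq_card, Fintype.card_fin,
    Module.finrank_self] at hle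
  by_contra hlt
  rw [not_lt] at hlt
  have hfin : {k : ℕ | (lN k : ℂ) = (c : ℂ)}.Finite := by
    have h1 := (tendsto_atTop.1 hlN.tendsto (c + 1))
    rw [← Nat.cofinite_eq_atTop, Filter.eventually_cofinite] at h1
    exact h1.subset fun k hk => by
      have hk : lN k = c := by exact_mod_cast hk
      simp [hk]
  -- Indices start at `0`. If `c ≤ lN (j + 1)`, an index with `lN k ≤ c` is one of `0, …, j` or has
  -- `lN k = c`. There are then at most `j + 1 + dim ker` of them, one less than the dimension of
  -- the test space.
  have hsub : {k : ℕ | lN k ≤ c} ⊆ ↑(Finset.range (j + 1)) ∪ {k : ℕ | (lN k : ℂ) = (c : ℂ)} := by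
    intro k hk
    by_cases hkj : k < j + 1
    · exact Or.inl (by simpa using hkj)
    · have : lN k = c := le_antisymm hk (hlt.trans (hlN.monotone (not_lt.1 hkj)))
      exact Or.inr (by simp [this])
  have h1 := Set.ncard_le_ncard hsub ((Finset.finite_toSet _).union hfin)
  have h2 := Set.ncard_union_le (↑(Finset.range (j + 1)) : Set ℕ) {k : ℕ | (lN k : ℂ) = (c : ℂ)}
  rw [Set.ncard_coe_finset, Finset.card_range, ← hlN.multiplicity] at h2
  omega

end Forms

end Carnot

end


noncomputable section

namespace Carnot

/-! ### Weak derivatives: uniqueness, locality, closedness, linearity in the field. -/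

section Sobolev

variable {E : Type*} [NormedAddCommGroup E] [NormedSpace ℝ E] [FiniteDimensional ℝ E]
  {G : Type*} [TopologicalSpace G] [T2Space G] [SecondCountableTopology G]
  [ChartedSpace E G] [Group G] [LieGroup 𝓘(ℝ, E) ∞ G] [MeasurableSpace G] [BorelSpace G]
  {μ : Measure G} [IsFiniteMeasureOnCompacts μ] {Ω : Set G}

theorem integral_mul_eq_inner (u : L2 μ Ω) {f : G → ℂ} (hf : MemLp f 2 (μ.restrict Ω)) :
    ∫ x in Ω, u x * f x ∂μ = inner ℂ (hf.star.toLp _) u := by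
  rw [L2.inner_def]
  refine integral_congr_ae (hf.star.coeFn_toLp.mono fun x hx => ?_)
  simp only [hx, RCLike.inner_apply, Pi.star_apply, RCLike.star_def, RCLike.conj_conj]

theorem inner_eq_integral (u : L2 μ Ω) {f : G → ℂ} (hf : MemLp f 2 (μ.restrict Ω)) :
    inner ℂ (hf.toLp f) u = ∫ x in Ω, u x * starRingEnd ℂ (f x) ∂μ := by
  rw [L2.inner_def]
  refine integral_congr_ae (hf.coeFn_toLp.mono fun x hx => ?_)
  simp only [hx, RCLike.inner_apply]

variable (E) in
theorem ae_eq_zero_of_forall_test (u : L2 μ Ω) {U : Set G} (hU : IsOpen U)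
    (h : ∀ φ, IsTestFunction E U φ → ∫ x in Ω, u x * φ x ∂μ = 0) :
    ∀ᵐ x ∂(μ.restrict Ω), x ∈ U → u x = 0 := by
  have := ChartedSpace.locallyCompactSpace E G
  have : IsManifold 𝓘(ℝ, E) ∞ G := inferInstance
  refine hU.ae_eq_zero_of_integral_contMDiff_smul_eq_zero 𝓘(ℝ, E)
    (((Lp.memLp u).locallyIntegrable one_le_two).locallyIntegrableOn U) fun g hg hgc hgs => ?_
  have h1 : IsTestFunction E U (fun x => (g x : ℂ)) := by
    refine ⟨?_, hgc.comp_left (g := fun t : ℝ => (t : ℂ)) rfl, ?_⟩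
    · exact (Complex.ofRealCLM.contDiff.contMDiff (n := ∞)).comp hg
    · refine (closure_mono fun x hx => ?_ : tsupport (fun x => (g x : ℂ)) ⊆ tsupport g).trans hgs
      intro h0
      exact hx (by simp [h0])
  rw [← h _ h1]
  refine integral_congr_ae (Eventually.of_forall fun x => ?_)
  simp only [Complex.real_smul, mul_comm]

variable (E) in
theorem eq_zero_of_forall_test (hΩ : IsOpen Ω) (u : L2 μ Ω)
    (h : ∀ φ, IsTestFunction E Ω φ → ∫ x in Ω, u x * φ x ∂μ = 0) : u = 0 := by
  refine Lp.ext ?_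
  filter_upwards [ae_eq_zero_of_forall_test E u hΩ h, ae_restrict_mem hΩ.measurableSet,
    Lp.coeFn_zero ℂ 2 (μ.restrict Ω)] with x hx hxΩ h0
  rw [hx hxΩ, h0]; rfl

theorem IsTestFunction.memLp {U : Set G} {φ : G → ℂ} (h : IsTestFunction E U φ) :
    MemLp φ 2 (μ.restrict Ω) :=
  memLp_two_of_continuous h.smooth.continuous h.compact_supp Ω

theorem IsTestFunction.memLp_invDeriv {U : Set G} {φ : G → ℂ} (h : IsTestFunction E U φ)
    (Y : GroupLieAlgebra 𝓘(ℝ, E) G) : MemLp (invDeriv Y φ) 2 (μ.restrict Ω) :=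
  memLp_two_of_continuous (continuous_invDeriv Y h.smooth)
    (hasCompactSupport_invDeriv Y h.compact_supp) Ω

theorem IsTestFunction.mono {U U' : Set G} {φ : G → ℂ} (h : IsTestFunction E U φ) (hU : U ⊆ U') :
    IsTestFunction E U' φ := ⟨h.1, h.2, h.3.trans hU⟩

theorem IsWeakDeriv.sub {Y : GroupLieAlgebra 𝓘(ℝ, E) G} {u v u' v' : L2 μ Ω}
    (h : IsWeakDeriv μ Ω Y u v) (h' : IsWeakDeriv μ Ω Y u' v') :
    IsWeakDeriv μ Ω Y (u - u') (v - v') := by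
  have := h.add (h'.smul (-1))
  simpa [sub_eq_add_neg] using this

theorem IsWeakDeriv.unique (hΩ : IsOpen Ω) {Y : GroupLieAlgebra 𝓘(ℝ, E) G} {u v v' : L2 μ Ω}
    (h : IsWeakDeriv μ Ω Y u v) (h' : IsWeakDeriv μ Ω Y u v') : v = v' := by
  rw [← sub_eq_zero]
  refine eq_zero_of_forall_test E hΩ _ fun φ hφ => ?_
  have h1 := h.sub h' φ hφ
  rw [sub_self] at h1
  have h2 : ∫ x in Ω, (0 : L2 μ Ω) x * invDeriv Y φ x ∂μ = 0 := by
    rw [integral_mul_eq_inner _ (hφ.memLp_invDeriv Y), inner_zero_right]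
  rw [h2] at h1
  exact neg_eq_zero.1 h1.symm

/-- A weak derivative vanishes on open sets where the function does. -/
theorem IsWeakDeriv.ae_eq_zero {Y : GroupLieAlgebra 𝓘(ℝ, E) G} {u v : L2 μ Ω}
    (h : IsWeakDeriv μ Ω Y u v) {U : Set G} (hU : IsOpen U) (hUΩ : U ⊆ Ω)
    (hu : ∀ᵐ x ∂(μ.restrict Ω), x ∈ U → u x = 0) :
    ∀ᵐ x ∂(μ.restrict Ω), x ∈ U → v x = 0 := by
  refine ae_eq_zero_of_forall_test E v hU fun φ hφ => ?_
  have h1 := h φ (hφ.mono hUΩ)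
  have h2 : ∫ x in Ω, u x * invDeriv Y φ x ∂μ = 0 := by
    rw [integral_congr_ae (g := fun _ => (0 : ℂ)), integral_zero]
    filter_upwards [hu] with x hx
    by_cases hxU : x ∈ U
    · rw [hx hxU, zero_mul]
    · have h3 : φ =ᶠ[𝓝 x] fun _ => 0 :=
        notMem_tsupport_iff_eventuallyEq.1 fun hh => hxU (hφ.supp_subset hh)
      rw [invDeriv, h3.mfderiv_eq, mfderiv_const]
      exact mul_zero _
  rw [h2] at h1
  exact neg_eq_zero.1 h1.symm

/-- Against a fixed test function, both sides are `L²` inner products, hence continuous. -/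
theorem isClosed_setOf_isWeakDeriv {α : Type*} [TopologicalSpace α] {u v : α → L2 μ Ω}
    (hu : Continuous u) (hv : Continuous v) (Y : GroupLieAlgebra 𝓘(ℝ, E) G) :
    IsClosed {a | IsWeakDeriv μ Ω Y (u a) (v a)} := by
  simp only [IsWeakDeriv, ofPred_forall]
  refine isClosed_iInter fun φ => isClosed_iInter fun hφ => ?_
  simp only [integral_mul_eq_inner _ (hφ.memLp_invDeriv Y), integral_mul_eq_inner _ hφ.memLp]
  exact isClosed_eq (continuous_const.inner hu) (continuous_const.inner hv).neg

theorem invDeriv_add_left (Y Z : GroupLieAlgebra 𝓘(ℝ, E) G) (φ : G → ℂ) (x : G) :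
    invDeriv (Y + Z) φ x = invDeriv Y φ x + invDeriv Z φ x := by
  simp only [invDeriv, mulInvariantVectorField, map_add]
  exact (mfderiv 𝓘(ℝ, E) 𝓘(ℝ, ℂ) φ x).map_add _ _

theorem invDeriv_smul_left (c : ℝ) (Y : GroupLieAlgebra 𝓘(ℝ, E) G) (φ : G → ℂ) (x : G) :
    invDeriv (c • Y) φ x = c * invDeriv Y φ x := by
  simp only [invDeriv, mulInvariantVectorField, map_smul]
  exact ((mfderiv 𝓘(ℝ, E) 𝓘(ℝ, ℂ) φ x).map_smul c _).trans Complex.real_smul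

theorem IsWeakDeriv.add_left {Y Z : GroupLieAlgebra 𝓘(ℝ, E) G} {u v w : L2 μ Ω}
    (h : IsWeakDeriv μ Ω Y u v) (h' : IsWeakDeriv μ Ω Z u w) :
    IsWeakDeriv μ Ω (Y + Z) u (v + w) := by
  intro φ hφ
  have e1 := h φ hφ
  have e2 := h' φ hφ
  rw [integral_mul_eq_inner _ hφ.memLp] at e1 e2 ⊢
  rw [inner_add_right, neg_add, ← e1, ← e2]
  refine Eq.trans ?_ (integral_add ((Lp.memLp u).integrable_mul (hφ.memLp_invDeriv Y))
    ((Lp.memLp u).integrable_mul (hφ.memLp_invDeriv Z)))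
  refine integral_congr_ae (Eventually.of_forall fun x => ?_)
  simp only [invDeriv_add_left, mul_add]

theorem IsWeakDeriv.smul_left {Y : GroupLieAlgebra 𝓘(ℝ, E) G} {u v : L2 μ Ω} (c : ℝ)
    (h : IsWeakDeriv μ Ω Y u v) : IsWeakDeriv μ Ω (c • Y) u ((c : ℂ) • v) := by
  intro φ hφ
  have e1 := h φ hφ
  rw [integral_mul_eq_inner _ hφ.memLp] at e1 ⊢
  rw [inner_smul_right, ← mul_neg, ← e1, ← integral_const_mul]
  refine integral_congr_ae (Eventually.of_forall fun x => ?_)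
  simp only [invDeriv_smul_left]
  ring

theorem mem_S1_iff {V₁ : Submodule ℝ (GroupLieAlgebra 𝓘(ℝ, E) G)} {m : ℕ}
    (X : Module.Basis (Fin m) ℝ V₁) {u : L2 μ Ω} :
    u ∈ S1 μ Ω V₁ ↔ ∃ p, IsWeakGradient μ Ω X u p := by
  constructor
  · intro h
    choose p hp using fun i => h (X i) (X i).2
    exact ⟨p, hp⟩
  · rintro ⟨p, hp⟩ Y hY
    have h1 : (⟨Y, hY⟩ : V₁) ∈ Submodule.span ℝ (range X) := by rw [X.span_eq]; trivial
    refine Submodule.span_induction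
      (p := fun (Z : V₁) _ => ∃ v, IsWeakDeriv μ Ω (Z : GroupLieAlgebra 𝓘(ℝ, E) G) u v)
      ?_ ?_ ?_ ?_ h1
    · rintro _ ⟨i, rfl⟩
      exact ⟨p i, hp i⟩
    · refine ⟨0, fun φ hφ => ?_⟩
      rw [integral_mul_eq_inner _ hφ.memLp, inner_zero_right]
      have : ∀ x, invDeriv (0 : GroupLieAlgebra 𝓘(ℝ, E) G) φ x = 0 := fun x => by
        simp only [invDeriv, mulInvariantVectorField, map_zero]
        exact (mfderiv 𝓘(ℝ, E) 𝓘(ℝ, ℂ) φ x).map_zero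
      simp only [Submodule.coe_zero, this, mul_zero, integral_zero, neg_zero]
    · rintro Z Z' _ _ ⟨v, hv⟩ ⟨v', hv'⟩
      exact ⟨v + v', hv.add_left hv'⟩
    · rintro c Z _ ⟨v, hv⟩
      exact ⟨(c : ℂ) • v, hv.smul_left c⟩

end Sobolev

end Carnot

end


noncomputable section

namespace Carnot

/-! ### The form domains as closed spaces of pairs of a function and its gradient. -/

section FormDomain

variable {E : Type*} [NormedAddCommGroup E] [NormedSpace ℝ E] [FiniteDimensional ℝ E]
  {G : Type*} [TopologicalSpace G] [T2Space G] [SecondCountableTopology G]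
  [ChartedSpace E G] [Group G] [LieGroup 𝓘(ℝ, E) ∞ G] [MeasurableSpace G] [BorelSpace G]
  {μ : Measure G} [IsFiniteMeasureOnCompacts μ] {Ω : Set G}
  {V₁ : Submodule ℝ (GroupLieAlgebra 𝓘(ℝ, E) G)} {m : ℕ}

variable (μ Ω m) in
/-- The Hilbert space of pairs `(u, p)` of a function and a horizontal vector field in `L²(Ω)`. -/
abbrev GradSpace : Type _ := PiLp 2 (fun _ : Option (Fin m) => L2 μ Ω)

/-- The pair `(u, p)`. -/
def gradPair (u : L2 μ Ω) (p : Fin m → L2 μ Ω) : GradSpace μ Ω m :=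
  WithLp.toLp 2 fun o => o.elim u p

@[simp] theorem gradPair_none (u : L2 μ Ω) (p : Fin m → L2 μ Ω) : gradPair u p none = u := rfl

@[simp] theorem gradPair_some (u : L2 μ Ω) (p : Fin m → L2 μ Ω) (i : Fin m) :
    gradPair u p (some i) = p i := rfl

theorem gradSpace_inner (a b : GradSpace μ Ω m) :
    inner ℂ a b = inner ℂ (a none) (b none) + ∑ i, inner ℂ (a (some i)) (b (some i)) := by
  rw [PiLp.inner_apply, Fintype.sum_option]

theorem gradSpace_norm_sq (a : GradSpace μ Ω m) :
    ‖a‖ ^ 2 = ‖a none‖ ^ 2 + ∑ i, ‖a (some i)‖ ^ 2 := by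
  rw [PiLp.norm_sq_eq_of_L2, Fintype.sum_option]

/-- The pairs `(u, ∇u)` with `u ∈ Q`, where `∇` is the horizontal gradient. -/
def formDomain (X : Module.Basis (Fin m) ℝ V₁) (Q : Submodule ℂ (L2 μ Ω)) :
    Submodule ℂ (GradSpace μ Ω m) where
  carrier := {a | a none ∈ Q ∧ IsWeakGradient μ Ω X (a none) fun i => a (some i)}
  zero_mem' := ⟨zero_mem _, fun _ => isWeakDeriv_zero⟩
  add_mem' := fun ha hb => ⟨add_mem ha.1 hb.1, fun i => (ha.2 i).add (hb.2 i)⟩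
  smul_mem' := fun c _ ha => ⟨Submodule.smul_mem _ c ha.1, fun i => (ha.2 i).smul c⟩

theorem mem_formDomain_S1 {X : Module.Basis (Fin m) ℝ V₁} {a : GradSpace μ Ω m} :
    a ∈ formDomain X (S1 μ Ω V₁) ↔ IsWeakGradient μ Ω X (a none) fun i => a (some i) :=
  ⟨fun h => h.2, fun h => ⟨(mem_S1_iff X).2 ⟨_, h⟩, h⟩⟩

theorem continuous_gradSpace_apply (o : Option (Fin m)) :
    Continuous fun a : GradSpace μ Ω m => a o :=
  (PiLp.proj 2 (fun _ : Option (Fin m) => L2 μ Ω) (𝕜 := ℂ) o).continuous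

theorem isClosed_formDomain_S1 (X : Module.Basis (Fin m) ℝ V₁) :
    IsClosed (formDomain (μ := μ) (Ω := Ω) X (S1 μ Ω V₁) : Set (GradSpace μ Ω m)) := by
  have : (formDomain (μ := μ) (Ω := Ω) X (S1 μ Ω V₁) : Set (GradSpace μ Ω m))
      = ⋂ i, {a | IsWeakDeriv μ Ω (X i : GroupLieAlgebra 𝓘(ℝ, E) G) (a none) (a (some i))} := by
    ext a
    simp only [SetLike.mem_coe, mem_formDomain_S1, mem_iInter]
    rfl
  rw [this]
  exact isClosed_iInter fun i => isClosed_setOf_isWeakDeriv (continuous_gradSpace_apply _)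
    (continuous_gradSpace_apply _) _

variable (μ Ω) in
/-- The functions in `L²(Ω)` that vanish outside of a compact subset of `Ω`. -/
def compactlySupported : Submodule ℂ (L2 μ Ω) where
  carrier := {u | VanishesOutsideCompact μ Ω u}
  zero_mem' := vanishesOutsideCompact_zero
  add_mem' := fun hu hw => hu.add hw
  smul_mem' := fun c _ hu => hu.smul c

/-- The norm defining S¹₀(Ω) is the norm of the pair `(u, ∇u)`. Consequently closed conditions on
pairs need checking only for functions that vanish outside a compact subset of Ω. -/
theorem formDomain_S10 (X : Module.Basis (Fin m) ℝ V₁) :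
    formDomain X (S10 μ Ω X) = (formDomain X (compactlySupported μ Ω)).topologicalClosure := by
  ext a
  rw [← SetLike.mem_coe (p := (formDomain X (compactlySupported μ Ω)).topologicalClosure),
    Submodule.topologicalClosure_coe, Metric.mem_closure_iff]
  constructor
  · rintro ⟨⟨-, h⟩, ha⟩ ε hε
    obtain ⟨w, hw, hwc, p, hp, hlt⟩ := h ε hε
    refine ⟨a - gradPair (a none - w) p, ⟨?_, fun i => ?_⟩, ?_⟩
    · change VanishesOutsideCompact μ Ω (a none - (a none - w))
      rwa [sub_sub_cancel]
    · exact (ha i).sub (hp i)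
    · rw [dist_eq_norm, sub_sub_cancel]
      refine lt_of_pow_lt_pow_left₀ 2 hε.le ?_
      rw [gradSpace_norm_sq]
      exact hlt
  · intro h
    have ha : a ∈ formDomain X (S1 μ Ω V₁) := by
      rw [← SetLike.mem_coe, ← (isClosed_formDomain_S1 X).closure_eq, Metric.mem_closure_iff]
      intro ε hε
      obtain ⟨b, hb, hlt⟩ := h ε hε
      exact ⟨b, mem_formDomain_S1.2 hb.2, hlt⟩
    refine ⟨⟨ha.1, fun ε hε => ?_⟩, ha.2⟩
    obtain ⟨b, hb, hlt⟩ := h ε hε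
    refine ⟨b none, (mem_formDomain_S1.2 hb.2).1, hb.1, fun i => (a - b) (some i),
      fun i => (ha.2 i).sub (hb.2 i), ?_⟩
    have h1 := gradSpace_norm_sq (a - b)
    rw [PiLp.sub_apply] at h1
    rw [← h1]
    rw [dist_eq_norm] at hlt
    gcongr

/-- The operator defined by `formGraph` is associated with the form in the sense of
`IsFormOperator`. -/
theorem isFormOperator_toLinearPMap (hΩ : IsOpen Ω) (X : Module.Basis (Fin m) ℝ V₁)
    {Q : Submodule ℂ (L2 μ Ω)} (hQS : Q ≤ S1 μ Ω V₁) (hQ : Dense (Q : Set (L2 μ Ω)))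
    {F : Type*} [NormedAddCommGroup F] [InnerProductSpace ℂ F] [CompleteSpace F]
    (J : F →ₗᵢ[ℂ] GradSpace μ Ω m) (hJ : LinearMap.range J.toLinearMap = formDomain X Q) :
    IsFormOperator (PiLp.proj 2 (fun _ : Option (Fin m) => L2 μ Ω) none ∘L J.toContinuousLinearMap)
      (formGraph μ Ω X Q).toLinearPMap := by
  have hJmem : ∀ q, J q ∈ formDomain X Q := fun q => by
    rw [← hJ]; exact ⟨q, rfl⟩
  have hJex : ∀ a ∈ formDomain X Q, ∃ q, J q = a := fun a ha => by
    rw [← hJ] at ha; exact ha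
  set ι : F →L[ℂ] L2 μ Ω :=
    PiLp.proj 2 (fun _ : Option (Fin m) => L2 μ Ω) none ∘L J.toContinuousLinearMap with hι
  have hιa : ∀ q, ι q = J q none := fun q => rfl
  -- The relation is single-valued: weak gradients are unique and `Q` is dense. This makes
  -- `toLinearPMap` have exactly the given graph.
  have hgraph : ∀ x ∈ formGraph μ Ω X Q, x.1 = 0 → x.2 = 0 := by
    rintro ⟨u, f⟩ ⟨hu, p, hp, h⟩ rfl
    have hp0 : ∀ i, p i = 0 := fun i => (hp i).unique hΩ isWeakDeriv_zero
    have hmem : f ∈ Qᗮ := (Submodule.mem_orthogonal _ _).2 fun v hv => by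
      obtain ⟨q, hq⟩ := (mem_S1_iff X).1 (hQS hv)
      rw [← h v hv q hq]
      simp [hp0]
    rwa [Submodule.topologicalClosure_eq_top_iff.1
      (Submodule.dense_iff_topologicalClosure_eq_top.1 hQ), Submodule.mem_bot] at hmem
  intro u f
  have h1 : (∃ h : u ∈ (formGraph μ Ω X Q).toLinearPMap.domain,
      (formGraph μ Ω X Q).toLinearPMap ⟨u, h⟩ = f) ↔ (u, f) ∈ formGraph μ Ω X Q := by
    have hg : (u, f) ∈ (formGraph μ Ω X Q).toLinearPMap.graph ↔ (u, f) ∈ formGraph μ Ω X Q := by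
      rw [Submodule.toLinearPMap_graph_eq _ hgraph]
    rw [← hg, LinearPMap.mem_graph_iff]
    constructor
    · rintro ⟨h, h'⟩
      exact ⟨⟨u, h⟩, rfl, h'⟩
    · rintro ⟨⟨y, hy⟩, h, h'⟩
      simp only at h
      subst h
      exact ⟨hy, h'⟩
  rw [h1]
  -- Adding `⟨v, u⟩` to both sides of the form equation turns it into an identity for the inner
  -- product of pairs; the element representing `v ↦ ⟨v, f + u⟩` is `ι* (f + u)`.
  have hadj : ∀ v, inner ℂ v (ContinuousLinearMap.adjoint ι (f + u))
      = inner ℂ (J v none) f + inner ℂ (J v none) u := fun v => by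
    rw [ContinuousLinearMap.adjoint_inner_right, hιa, inner_add_right]
  constructor
  · rintro ⟨hu, p, hp, h⟩
    obtain ⟨q, hq⟩ := hJex (gradPair u p) ⟨hu, hp⟩
    have h2 : ContinuousLinearMap.adjoint ι (f + u) = q := by
      refine ext_inner_left ℂ fun v => ?_
      rw [hadj, ← J.inner_map_map v q, hq, gradSpace_inner, add_comm]
      congr 1
      exact (h _ (hJmem v).1 _ (hJmem v).2).symm
    rw [formResolvent, ContinuousLinearMap.comp_apply, h2, hιa, hq]
    rfl
  · intro h
    rw [formResolvent, ContinuousLinearMap.comp_apply] at h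
    set q := ContinuousLinearMap.adjoint ι (f + u) with hq
    rw [hιa] at h
    have hqm := hJmem q
    refine ⟨?_, fun i => J q (some i), ?_, fun v hv p hp => ?_⟩
    · rw [← h]; exact hqm.1
    · rw [← h]; exact hqm.2
    · obtain ⟨w, hw⟩ := hJex (gradPair v p) ⟨hv, hp⟩
      have h2 := hadj w
      rw [← J.inner_map_map, hw, gradSpace_inner, h, add_comm] at h2
      exact add_right_cancel h2

end FormDomain

/-! ### Smooth functions and integration by parts. -/

section SmoothFunctions

variable {E : Type*} [NormedAddCommGroup E] [NormedSpace ℝ E] [FiniteDimensional ℝ E]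
  {G : Type*} [TopologicalSpace G] [T2Space G] [SecondCountableTopology G]
  [ChartedSpace E G] [Group G] [LieGroup 𝓘(ℝ, E) ∞ G] [MeasurableSpace G] [BorelSpace G]
  {μ : Measure G} [IsFiniteMeasureOnCompacts μ] {Ω : Set G}
  {V₁ : Submodule ℝ (GroupLieAlgebra 𝓘(ℝ, E) G)} {m : ℕ}

variable (E μ) in
/-- Left-invariant vector fields are divergence free with respect to `μ`. -/
def IsDivergenceFree : Prop :=
  ∀ (Y : GroupLieAlgebra 𝓘(ℝ, E) G) (f : G → ℂ), ContMDiff 𝓘(ℝ, E) 𝓘(ℝ, ℂ) ∞ f →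
    HasCompactSupport f → ∫ x, invDeriv Y f x ∂μ = 0

theorem invDeriv_congr {f g : G → ℂ} {x : G} (h : f =ᶠ[𝓝 x] g) (Y : GroupLieAlgebra 𝓘(ℝ, E) G) :
    invDeriv Y f x = invDeriv Y g x := by
  simp only [invDeriv]
  rw [h.mfderiv_eq]
  rfl

theorem invDeriv_const (c : ℂ) (x : G) (Y : GroupLieAlgebra 𝓘(ℝ, E) G) :
    invDeriv Y (fun _ : G => c) x = 0 := by
  rw [invDeriv, mfderiv_const]
  rfl

theorem contMDiff_mul_complex {f g : G → ℂ} (hf : ContMDiff 𝓘(ℝ, E) 𝓘(ℝ, ℂ) ∞ f)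
    (hg : ContMDiff 𝓘(ℝ, E) 𝓘(ℝ, ℂ) ∞ g) :
    ContMDiff 𝓘(ℝ, E) 𝓘(ℝ, ℂ) ∞ (fun x => f x * g x) :=
  ((ContinuousLinearMap.mul ℝ ℂ).isBoundedBilinearMap.contDiff.contMDiff).comp
    (hf.prodMk_space hg)

theorem invDeriv_mul_of_smooth {f g : G → ℂ} (hf : ContMDiff 𝓘(ℝ, E) 𝓘(ℝ, ℂ) ∞ f)
    (hg : ContMDiff 𝓘(ℝ, E) 𝓘(ℝ, ℂ) ∞ g) (Y : GroupLieAlgebra 𝓘(ℝ, E) G) (x : G) :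
    invDeriv Y (fun x => f x * g x) x = invDeriv Y f x * g x + f x * invDeriv Y g x :=
  invDeriv_mul (hf.mdifferentiable (by simp) x) (hg.mdifferentiable (by simp) x)
    ((contMDiff_mul_complex hf hg).mdifferentiable (by simp) x) Y

theorem IsTestFunction.mul_left {U : Set G} {φ f : G → ℂ} (hφ : IsTestFunction E U φ)
    (hf : ContMDiff 𝓘(ℝ, E) 𝓘(ℝ, ℂ) ∞ f) : IsTestFunction E U (fun x => f x * φ x) :=
  ⟨contMDiff_mul_complex hf hφ.smooth, hφ.compact_supp.mul_left,
    (tsupport_mul_subset_right (f := f) (g := φ)).trans hφ.supp_subset⟩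

/-- The product `f φ` is smooth with compact support, so `Y (f φ)` has integral zero; expand by the
Leibniz rule. -/
theorem isWeakDeriv_of_smooth (hμ : IsDivergenceFree E μ) {f : G → ℂ}
    (hf : ContMDiff 𝓘(ℝ, E) 𝓘(ℝ, ℂ) ∞ f) (Y : GroupLieAlgebra 𝓘(ℝ, E) G)
    (h1 : MemLp f 2 (μ.restrict Ω)) (h2 : MemLp (invDeriv Y f) 2 (μ.restrict Ω)) :
    IsWeakDeriv μ Ω Y (h1.toLp f) (h2.toLp (invDeriv Y f)) := by
  intro φ hφ
  have e1 : ∫ x in Ω, h1.toLp f x * invDeriv Y φ x ∂μ = ∫ x in Ω, f x * invDeriv Y φ x ∂μ :=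
    integral_congr_ae (h1.coeFn_toLp.mono fun x hx => by simp only [hx])
  have e2 : ∫ x in Ω, h2.toLp (invDeriv Y f) x * φ x ∂μ = ∫ x in Ω, invDeriv Y f x * φ x ∂μ :=
    integral_congr_ae (h2.coeFn_toLp.mono fun x hx => by simp only [hx])
  rw [e1, e2, eq_neg_iff_add_eq_zero]
  refine (integral_add (h1.integrable_mul (hφ.memLp_invDeriv Y))
    (h2.integrable_mul hφ.memLp)).symm.trans ?_
  have hfφ := hφ.mul_left hf
  refine Eq.trans ?_ (hμ Y _ hfφ.smooth hfφ.compact_supp)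
  refine Eq.trans ?_ (setIntegral_eq_integral_of_forall_compl_eq_zero (s := Ω) ?_)
  · refine integral_congr_ae (Eventually.of_forall fun x => ?_)
    simp only [invDeriv_mul_of_smooth hf hφ.smooth, Pi.mul_apply]
    ring
  · intro x hx
    have h3 : (fun x => f x * φ x) =ᶠ[𝓝 x] fun _ => 0 :=
      notMem_tsupport_iff_eventuallyEq.1 fun hh => hx (hfφ.supp_subset hh)
    rw [invDeriv_congr h3, invDeriv_const]

/-- Test functions belong to the form domain. -/
theorem IsTestFunction.mem_formDomain (hμ : IsDivergenceFree E μ) (X : Module.Basis (Fin m) ℝ V₁)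
    {φ : G → ℂ} (hφ : IsTestFunction E Ω φ) :
    gradPair (hφ.memLp.toLp φ) (fun i => (hφ.memLp_invDeriv
      (X i : GroupLieAlgebra 𝓘(ℝ, E) G)).toLp (invDeriv (X i : GroupLieAlgebra 𝓘(ℝ, E) G) φ))
      ∈ formDomain (μ := μ) X (compactlySupported μ Ω) := by
  refine ⟨⟨tsupport φ, hφ.compact_supp, hφ.supp_subset, ?_⟩, fun i =>
    isWeakDeriv_of_smooth hμ hφ.smooth _ hφ.memLp (hφ.memLp_invDeriv _)⟩
  filter_upwards [(hφ.memLp (μ := μ) (Ω := Ω)).coeFn_toLp] with x hx hxK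
  rw [gradPair_none, hx]
  exact image_eq_zero_of_notMem_tsupport hxK

theorem compactlySupported_le_S10 (X : Module.Basis (Fin m) ℝ V₁) {a : GradSpace μ Ω m}
    (ha : a ∈ formDomain X (compactlySupported μ Ω)) : a ∈ formDomain X (S10 μ Ω X) := by
  rw [formDomain_S10]
  exact Submodule.le_topologicalClosure _ ha

theorem IsTestFunction.conj {U : Set G} {φ : G → ℂ} (hφ : IsTestFunction E U φ) :
    IsTestFunction E U (fun x => starRingEnd ℂ (φ x)) := by
  refine ⟨(Complex.conjCLE.contDiff.contMDiff (n := ∞)).comp hφ.smooth,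
    hφ.compact_supp.comp_left (map_zero _), ?_⟩
  refine (closure_mono fun x hx => ?_ : _ ⊆ tsupport φ).trans hφ.supp_subset
  intro h0
  exact hx (by simp [h0])

theorem dense_S10 (hΩ : IsOpen Ω) (hμ : IsDivergenceFree E μ) (X : Module.Basis (Fin m) ℝ V₁) :
    Dense (S10 μ Ω X : Set (L2 μ Ω)) := by
  rw [Submodule.dense_iff_topologicalClosure_eq_top, Submodule.topologicalClosure_eq_top_iff,
    eq_bot_iff]
  intro w hw
  refine eq_zero_of_forall_test E hΩ w fun φ hφ => ?_
  have h1 := (compactlySupported_le_S10 X (hφ.conj.mem_formDomain (μ := μ) hμ X)).1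
  have h2 := (Submodule.mem_orthogonal _ _).1 hw _ h1
  rw [gradPair_none, inner_eq_integral] at h2
  simpa using h2

/-- Integration by parts of a function in `S¹₀(Ω)` against a smooth function. -/
theorem integral_mul_invDeriv_of_mem_S10 (hΩ : IsOpen Ω) (X : Module.Basis (Fin m) ℝ V₁)
    {a : GradSpace μ Ω m} (ha : a ∈ formDomain X (S10 μ Ω X)) {f : G → ℂ}
    (hf : ContMDiff 𝓘(ℝ, E) 𝓘(ℝ, ℂ) ∞ f) (i : Fin m) (h1 : MemLp f 2 (μ.restrict Ω))
    (h2 : MemLp (invDeriv (X i : GroupLieAlgebra 𝓘(ℝ, E) G) f) 2 (μ.restrict Ω)) :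
    ∫ x in Ω, a none x * invDeriv (X i : GroupLieAlgebra 𝓘(ℝ, E) G) f x ∂μ =
      - ∫ x in Ω, a (some i) x * f x ∂μ := by
  have := ChartedSpace.locallyCompactSpace E G
  rw [formDomain_S10, ← SetLike.mem_coe, Submodule.topologicalClosure_coe] at ha
  -- The identity is a closed condition on the pair, so it may be checked for functions vanishing
  -- off a compact set.
  refine closure_minimal (t := {a : GradSpace μ Ω m |
    ∫ x in Ω, a none x * invDeriv (X i : GroupLieAlgebra 𝓘(ℝ, E) G) f x ∂μ =
      - ∫ x in Ω, a (some i) x * f x ∂μ}) ?_ ?_ ha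
  swap
  · simp only [integral_mul_eq_inner _ h1, integral_mul_eq_inner _ h2]
    exact isClosed_eq (continuous_const.inner (continuous_gradSpace_apply _))
      (continuous_const.inner (continuous_gradSpace_apply _)).neg
  rintro b ⟨⟨K, hK, hKΩ, hb⟩, hgrad⟩
  obtain ⟨L, hL, hKL, hLΩ⟩ := exists_compact_between hK hΩ hKΩ
  -- `f` need not be a test function. A cutoff equal to one near `K` makes it one and changes
  -- neither integral, since the function and its weak derivative vanish off `K`.
  obtain ⟨χ, hχ1, hχ0, -⟩ := exists_contMDiffMap_one_nhds_of_subset_interior (n := ⊤) 𝓘(ℝ, E)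
    hK.isClosed hKL
  have hsupp : tsupport χ ⊆ L := closure_minimal
    (fun x hx => by by_contra h; exact hx (hχ0 x h)) hL.isClosed
  have hχt : IsTestFunction E Ω (fun x => (χ x : ℂ)) := by
    have h0 : tsupport (fun x => (χ x : ℂ)) ⊆ L :=
      (closure_mono fun x hx => mt (fun h0 : χ x = 0 => by simp [h0]) hx : _ ⊆ tsupport χ).trans
        hsupp
    refine ⟨(Complex.ofRealCLM.contDiff.contMDiff (n := ∞)).comp χ.contMDiff,
      hL.of_isClosed_subset (isClosed_tsupport _) h0, h0.trans hLΩ⟩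
  have hw := hgrad i _ (hχt.mul_left hf)
  have hp : ∀ᵐ x ∂(μ.restrict Ω), x ∈ Ω \ K → b (some i) x = 0 :=
    (hgrad i).ae_eq_zero (hΩ.sdiff hK.isClosed) sdiff_subset
      (hb.mono fun x hx hxK => hx hxK.2)
  have hχK : ∀ x ∈ K, (fun x => f x * (χ x : ℂ)) =ᶠ[𝓝 x] f := fun x hx => by
    have := hχ1.filter_mono (nhds_le_nhdsSet hx)
    filter_upwards [this] with y hy
    rw [hy]; simp
  refine Eq.trans ?_ (hw.trans (congrArg Neg.neg ?_))
  · refine integral_congr_ae ?_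
    filter_upwards [hb] with x hx
    by_cases hxK : x ∈ K
    · rw [invDeriv_congr (hχK x hxK)]
    · rw [hx hxK, zero_mul, zero_mul]
  · refine integral_congr_ae ?_
    filter_upwards [hp, ae_restrict_mem hΩ.measurableSet] with x hx hxΩ
    by_cases hxK : x ∈ K
    · rw [(hχK x hxK).eq_of_nhds]
    · rw [hx ⟨hxΩ, hxK⟩, zero_mul, zero_mul]

end SmoothFunctions

end Carnot

end


noncomputable section

namespace Carnot

open scoped Pointwise

/-! ### Convolution of an indicator function with a smooth function. -/

section Convolution

variable {G : Type*} [TopologicalSpace G] [T2Space G] [SecondCountableTopology G]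
  [Group G] [IsTopologicalGroup G] [LocallyCompactSpace G] [MeasurableSpace G] [BorelSpace G]
  {μ : Measure G} [μ.IsHaarMeasure] {Ω : Set G}

/-- The convolution `1_A * k`. -/
def indicatorConv (μ : Measure G) (A : Set G) (k : G → ℂ) (x : G) : ℂ := ∫ y in A, k (y⁻¹ * x) ∂μ

variable {A : Set G} {k : G → ℂ}

theorem hasCompactSupport_comp_inv_mul (hc : HasCompactSupport k) (x : G) :
    HasCompactSupport fun y => k (y⁻¹ * x) := by
  exact hc.comp_homeomorph ((Homeomorph.inv G).trans (Homeomorph.mulRight x))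

theorem continuous_comp_inv_mul (hk : Continuous k) :
    Continuous fun p : G × G => k (p.1⁻¹ * p.2) := by
  fun_prop

theorem integrable_comp_inv_mul (hk : Continuous k) (hc : HasCompactSupport k) (x : G) :
    Integrable (fun y => k (y⁻¹ * x)) μ :=
  ((continuous_comp_inv_mul hk).comp (by fun_prop :
    Continuous fun y => (y, x))).integrable_of_hasCompactSupport
      (hasCompactSupport_comp_inv_mul hc x)

theorem integral_comp_inv_mul {F : Type*} [NormedAddCommGroup F] [NormedSpace ℝ F] (f : G → F)
    (x : G) : ∫ y, f (y⁻¹ * x) ∂μ = ∫ y, f y⁻¹ ∂μ := by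
  rw [← integral_mul_left_eq_self (fun y => f (y⁻¹ * x)) x]
  simp

theorem norm_indicatorConv_le (hk : Continuous k) (hc : HasCompactSupport k) (x : G) :
    ‖indicatorConv μ A k x‖ ≤ ∫ y, ‖k y⁻¹‖ ∂μ := by
  rw [← integral_comp_inv_mul (fun z => ‖k z‖) x]
  refine (norm_integral_le_integral_norm _).trans ?_
  exact setIntegral_le_integral (integrable_comp_inv_mul hk hc x).norm
    (Eventually.of_forall fun y => norm_nonneg _)

theorem indicatorConv_eq_zero {x : G} (h : ∀ y ∈ A, k (y⁻¹ * x) = 0) :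
    indicatorConv μ A k x = 0 :=
  setIntegral_eq_zero_of_forall_eq_zero h

theorem indicatorConv_eq {x : G} (h : ∀ y ∉ A, k (y⁻¹ * x) = 0) :
    indicatorConv μ A k x = ∫ y, k y⁻¹ ∂μ := by
  rw [indicatorConv, setIntegral_eq_integral_of_forall_compl_eq_zero h, integral_comp_inv_mul]

theorem stronglyMeasurable_indicatorConv (hk : Continuous k) :
    StronglyMeasurable (indicatorConv μ A k) := by
  have h : StronglyMeasurable fun p : G × G => k (p.2⁻¹ * p.1) :=
    ((continuous_comp_inv_mul hk).comp continuous_swap).stronglyMeasurable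
  exact h.integral_prod_right (ν := μ.restrict A)

variable {E : Type*} [NormedAddCommGroup E] [NormedSpace ℝ E] [FiniteDimensional ℝ E]
  [ChartedSpace E G] [LieGroup 𝓘(ℝ, E) ∞ G]

/-- Left-invariant fields commute with the left translations `x ↦ y⁻¹ x`, so the derivative falls on
`k`. Fubini reduces the claim to integration by parts for each fixed `y`. -/
theorem isWeakDeriv_indicatorConv (hμ : IsDivergenceFree E μ) (hA : IsCompact A)
    (hk : ContMDiff 𝓘(ℝ, E) 𝓘(ℝ, ℂ) ∞ k) (hc : HasCompactSupport k)
    (Y : GroupLieAlgebra 𝓘(ℝ, E) G) (h1 : MemLp (indicatorConv μ A k) 2 (μ.restrict Ω))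
    (h2 : MemLp (indicatorConv μ A (invDeriv Y k)) 2 (μ.restrict Ω)) :
    IsWeakDeriv μ Ω Y (h1.toLp _) (h2.toLp _) := by
  intro φ hφ
  have hAfin : IsFiniteMeasure (μ.restrict A) := ⟨by simpa using hA.measure_lt_top⟩
  have hswap : ∀ (f g : G → ℂ), Continuous f → HasCompactSupport f → Continuous g →
      HasCompactSupport g → (∀ x ∉ Ω, g x = 0) →
      ∫ x in Ω, indicatorConv μ A f x * g x ∂μ = ∫ y in A, ∫ x, f (y⁻¹ * x) * g x ∂μ ∂μ := by
    intro f g hf hfc hg hgc hgΩ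
    rw [setIntegral_eq_integral_of_forall_compl_eq_zero fun x hx => by rw [hgΩ x hx, mul_zero],
      integral_integral_swap (f := fun y x => f (y⁻¹ * x) * g x)]
    · refine integral_congr_ae (Eventually.of_forall fun x => ?_)
      simp only [indicatorConv]
      rw [integral_mul_const]
    · obtain ⟨C, hC⟩ := hfc.exists_bound_of_continuous hf
      have hint : Integrable (fun p : G × G => C * ‖g p.2‖) ((μ.restrict A).prod μ) :=
        (integrable_const C).mul_prod (hg.integrable_of_hasCompactSupport hgc).norm
      refine hint.mono' ?_ (Eventually.of_forall fun p => ?_)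
      · exact ((continuous_comp_inv_mul hf).mul (hg.comp continuous_snd)).aestronglyMeasurable
      · simp only [Function.uncurry, norm_mul]
        exact mul_le_mul_of_nonneg_right (hC _) (norm_nonneg _)
  have hYφ : ∀ x ∉ Ω, invDeriv Y φ x = 0 := fun x hx => by
    rw [invDeriv_congr (notMem_tsupport_iff_eventuallyEq.1 fun hh => hx (hφ.supp_subset hh)),
      show (0 : G → ℂ) = fun _ => 0 from rfl, invDeriv_const]
  have hφΩ : ∀ x ∉ Ω, φ x = 0 := fun x hx =>
    image_eq_zero_of_notMem_tsupport fun hh => hx (hφ.supp_subset hh)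
  have e1 : ∫ x in Ω, h1.toLp _ x * invDeriv Y φ x ∂μ
      = ∫ x in Ω, indicatorConv μ A k x * invDeriv Y φ x ∂μ :=
    integral_congr_ae (h1.coeFn_toLp.mono fun x hx => by simp only [hx])
  have e2 : ∫ x in Ω, h2.toLp _ x * φ x ∂μ
      = ∫ x in Ω, indicatorConv μ A (invDeriv Y k) x * φ x ∂μ :=
    integral_congr_ae (h2.coeFn_toLp.mono fun x hx => by simp only [hx])
  rw [e1, e2, hswap _ _ hk.continuous hc (continuous_invDeriv Y hφ.smooth)
    (hasCompactSupport_invDeriv Y hφ.compact_supp) hYφ,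
    hswap _ _ (continuous_invDeriv Y hk) (hasCompactSupport_invDeriv Y hc) hφ.smooth.continuous
    hφ.compact_supp hφΩ, ← integral_neg]
  refine integral_congr_ae (Eventually.of_forall fun y => ?_)
  have hky : ContMDiff 𝓘(ℝ, E) 𝓘(ℝ, ℂ) ∞ (fun x => k (y⁻¹ * x)) := hk.comp contMDiff_mul_left
  have hprod := hφ.mul_left hky
  have h0 := hμ Y _ hprod.smooth hprod.compact_supp
  simp only [invDeriv_mul_of_smooth hky hφ.smooth, invDeriv_comp_mul_left hk] at h0
  have hi1 : Integrable (fun x => invDeriv Y k (y⁻¹ * x) * φ x) μ :=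
    (((continuous_invDeriv Y hk).comp (continuous_const.mul continuous_id)).mul
      hφ.smooth.continuous).integrable_of_hasCompactSupport hφ.compact_supp.mul_left
  have hi2 : Integrable (fun x => k (y⁻¹ * x) * invDeriv Y φ x) μ :=
    ((hky.continuous).mul (continuous_invDeriv Y hφ.smooth)).integrable_of_hasCompactSupport
      (hasCompactSupport_invDeriv Y hφ.compact_supp).mul_left
  rw [integral_add hi1 hi2] at h0
  exact eq_neg_of_add_eq_zero_right h0

end Convolution

/-! ### Exhaustion by powers of a neighbourhood and their volume growth. -/

section Exhaustion

variable {G : Type*} [TopologicalSpace G] [Group G] [IsTopologicalGroup G]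

/-- The union is an open subgroup, hence also closed, and the group is connected. -/
theorem iUnion_pow_eq_univ [ConnectedSpace G] {W : Set G} (hW : W ∈ 𝓝 (1 : G)) (hinv : W⁻¹ = W) :
    ⋃ n : ℕ, W ^ n = univ := by
  let S : Subgroup G :=
    { carrier := ⋃ n : ℕ, W ^ n
      mul_mem' := fun {a b} ha hb => by
        obtain ⟨n, hn⟩ := mem_iUnion.1 ha
        obtain ⟨k, hk⟩ := mem_iUnion.1 hb
        exact mem_iUnion.2 ⟨n + k, by rw [pow_add]; exact mul_mem_mul hn hk⟩
      one_mem' := mem_iUnion.2 ⟨0, by simp⟩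
      inv_mem' := fun {a} ha => by
        obtain ⟨n, hn⟩ := mem_iUnion.1 ha
        refine mem_iUnion.2 ⟨n, ?_⟩
        rw [← hinv, inv_pow]
        exact Set.inv_mem_inv.2 hn }
  have hS : IsOpen (S : Set G) := S.isOpen_of_mem_nhds (g := 1)
    (Filter.mem_of_superset hW fun x hx => mem_iUnion.2 ⟨1, by simpa using hx⟩)
  exact IsClopen.eq_univ ⟨S.isClosed_of_isOpen hS, hS⟩ ⟨1, S.one_mem⟩

theorem isCompact_pow {W : Set G} (hW : IsCompact W) (n : ℕ) : IsCompact (W ^ n) := by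
  induction n with
  | zero => rw [pow_zero]; exact isCompact_singleton
  | succ n ih => rw [pow_succ]; exact ih.mul hW

variable [MeasurableSpace G] [BorelSpace G] (μ : Measure G) [μ.IsHaarMeasure]

/-- The powers of a compact neighbourhood of the identity grow at most exponentially. -/
theorem exists_measure_pow_le {W : Set G} (hW : W ∈ 𝓝 (1 : G)) (hc : IsCompact W) :
    ∃ q : ℕ, ∀ n, μ (W ^ (n + 1)) ≤ (q : ENNReal) ^ n * μ W := by
  -- Cover `W²` by finitely many left translates of `W`. Multiplying on the right by `W ^ n` shows
  -- that each further factor multiplies the volume by at most their number.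
  obtain ⟨F, hF⟩ : ∃ F : Finset G, W * W ⊆ ⋃ g ∈ F, g • interior W := by
    have h1 : W * W ⊆ ⋃ g : G, g • interior W := fun x _ =>
      mem_iUnion.2 ⟨x, mem_smul_set_iff_inv_smul_mem.2 (by
        simpa using mem_interior_iff_mem_nhds.2 hW)⟩
    exact (hc.mul hc).elim_finite_subcover _ (fun g => isOpen_interior.smul g) h1
  refine ⟨F.card, fun n => ?_⟩
  induction n with
  | zero => simp
  | succ n ih =>
    have h1 : W ^ (n + 2) ⊆ ⋃ g ∈ F, g • W ^ (n + 1) := by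
      intro x hx
      rw [show n + 2 = 2 + n by ring, pow_add, pow_two] at hx
      obtain ⟨a, ha, b, hb, rfl⟩ := mem_mul.1 hx
      obtain ⟨g, hg, c, hc', rfl⟩ := mem_iUnion₂.1 (hF ha)
      refine mem_iUnion₂.2 ⟨g, hg, c * b, ?_, ?_⟩
      · rw [pow_succ']
        exact mul_mem_mul (interior_subset hc') hb
      · simp [mul_assoc]
    calc μ (W ^ (n + 1 + 1)) ≤ ∑ g ∈ F, μ (g • W ^ (n + 1)) :=
          (measure_mono h1).trans (measure_biUnion_finset_le _ _)
      _ = F.card * μ (W ^ (n + 1)) := by simp [measure_smul]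
      _ ≤ F.card * (F.card ^ n * μ W) := by gcongr
      _ = _ := by rw [pow_succ]; ring

end Exhaustion

/-- A sequence of at most exponential growth that tends to infinity satisfies a doubling
condition infinitely often. -/
theorem exists_doubling {a : ℕ → ℝ} {C q : ℝ} (hq : 0 ≤ q) (hle : ∀ n, a (n + 1) ≤ C * q ^ n)
    (ht : Tendsto a atTop atTop) :
    ∀ N, ∃ n, N ≤ n ∧ 1 ≤ a n ∧ a (n + 2) ≤ (q ^ 2 + 1) * a n := by
  intro N
  by_contra hcon
  push Not at hcon
  obtain ⟨K, hK⟩ := eventually_atTop.1 (tendsto_atTop.1 ht 1)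
  set P := max (max N K) 1 with hP
  have hPN : N ≤ P := (le_max_left _ _).trans (le_max_left _ _)
  have hPK : K ≤ P := (le_max_right _ _).trans (le_max_left _ _)
  obtain ⟨P', hP'⟩ : ∃ P', P = P' + 1 := ⟨P - 1, by have : 1 ≤ P := le_max_right _ _; omega⟩
  -- If doubling fails from `P` on, two steps multiply `a` by more than `q² + 1`, whereas the upper
  -- bound grows only by `q²` in two steps.
  have h1 : ∀ k, (q ^ 2 + 1) ^ k ≤ a (P + 2 * k) := by
    intro k
    induction k with
    | zero => simpa using hK P hPK
    | succ k ih =>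
      have h2 := hcon (P + 2 * k) (by omega) (hK _ (by omega))
      rw [show P + 2 * (k + 1) = P + 2 * k + 2 by ring, pow_succ']
      refine le_trans ?_ h2.le
      gcongr
  have h2 : ∀ k, (q ^ 2 + 1) ^ k ≤ C * q ^ P' * (q ^ 2) ^ k := fun k => by
    refine (h1 k).trans ?_
    rw [hP', show P' + 1 + 2 * k = (P' + 2 * k) + 1 by ring]
    refine (hle _).trans (le_of_eq ?_)
    rw [pow_add, ← pow_mul]; ring
  rcases eq_or_lt_of_le hq with hq0 | hq0
  · have := h2 1
    rw [← hq0] at this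
    norm_num at this
  · have h3 : 1 < (q ^ 2 + 1) / q ^ 2 := by
      rw [one_lt_div (by positivity)]; linarith
    obtain ⟨k, hk⟩ := pow_unbounded_of_one_lt (C * q ^ P') h3
    rw [div_pow, lt_div_iff₀ (by positivity)] at hk
    exact absurd (h2 k) (not_le.2 hk)

/-! ### Compact embedding and `L²` estimates for bounded functions. -/

section FiniteVolume

variable {E : Type*} [NormedAddCommGroup E] [NormedSpace ℝ E] [FiniteDimensional ℝ E]
  {G : Type*} [TopologicalSpace G] [T2Space G] [SecondCountableTopology G]
  [ChartedSpace E G] [Group G] [LieGroup 𝓘(ℝ, E) ∞ G] [MeasurableSpace G] [BorelSpace G]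
  {μ : Measure G} {Ω : Set G}
  {V₁ : Submodule ℝ (GroupLieAlgebra 𝓘(ℝ, E) G)} {m : ℕ}

variable (μ Ω) in
/-- The embedding of `S¹(Ω)` into `L²(Ω)` is compact, in sequential form. -/
def IsRellich [IsFiniteMeasureOnCompacts μ] (X : Module.Basis (Fin m) ℝ V₁) : Prop :=
  ∀ a : ℕ → GradSpace μ Ω m, (∀ n, a n ∈ formDomain X (S1 μ Ω V₁)) → ∀ C : ℝ, (∀ n, ‖a n‖ ≤ C) →
    ∃ u, ∃ φ : ℕ → ℕ, StrictMono φ ∧ Tendsto (fun n => a (φ n) none) atTop (𝓝 u)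

theorem L2_norm_sq (u : L2 μ Ω) : ‖u‖ ^ 2 = ∫ x in Ω, ‖u x‖ ^ 2 ∂μ := by
  have h : ((‖u‖ ^ 2 : ℝ) : ℂ) = ((∫ x in Ω, ‖u x‖ ^ 2 ∂μ : ℝ) : ℂ) := by
    rw [← integral_complex_ofReal]
    have := inner_self_eq_norm_sq_to_K (𝕜 := ℂ) u
    push_cast
    refine this.symm.trans ?_
    rw [L2.inner_def]
    refine integral_congr_ae (Eventually.of_forall fun x => ?_)
    simp only [inner_self_eq_norm_sq_to_K]
    rfl
  exact_mod_cast h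

theorem memLp_of_bound_of_eq_zero {f : G → ℂ} (hf : StronglyMeasurable f) {c : ℝ} {B : Set G}
    (hB : MeasurableSet B) (hfin : μ (B ∩ Ω) ≠ ⊤) (hc : ∀ x, ‖f x‖ ≤ c) (h0 : ∀ x ∉ B, f x = 0) :
    MemLp f 2 (μ.restrict Ω) := by
  have h1 : MemLp (B.indicator fun _ => c) 2 (μ.restrict Ω) :=
    memLp_indicator_const 2 hB c (Or.inr (by rwa [Measure.restrict_apply hB]))
  refine h1.mono hf.aestronglyMeasurable (Eventually.of_forall fun x => ?_)
  by_cases hx : x ∈ B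
  · rw [indicator_of_mem hx]
    exact (hc x).trans (le_abs_self c)
  · rw [h0 x hx]; simp

theorem norm_sq_toLp_le {f : G → ℂ} {c : ℝ} {B : Set G}
    (hB : MeasurableSet B) (hfin : μ (B ∩ Ω) ≠ ⊤) (hc : ∀ x, ‖f x‖ ≤ c) (h0 : ∀ x ∉ B, f x = 0)
    (hf : MemLp f 2 (μ.restrict Ω)) : ‖hf.toLp f‖ ^ 2 ≤ c ^ 2 * μ.real (B ∩ Ω) := by
  have hc' : ∀ x, ‖f x‖ ^ 2 ≤ B.indicator (fun _ => c ^ 2) x := fun x => by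
    by_cases hx : x ∈ B
    · rw [indicator_of_mem hx]
      have := hc x
      gcongr
    · rw [h0 x hx, indicator_of_notMem hx]; simp
  rw [L2_norm_sq]
  have hi : Integrable (B.indicator fun _ => c ^ 2) (μ.restrict Ω) :=
    (integrable_indicator_iff hB).2 (integrableOn_const (by rwa [Measure.restrict_apply hB]))
  refine (integral_mono_of_nonneg (Eventually.of_forall fun x => by positivity) hi ?_).trans ?_
  · filter_upwards [hf.coeFn_toLp] with x hx
    rw [hx]; exact hc' x
  · rw [integral_indicator_const _ hB, measureReal_restrict_apply hB, smul_eq_mul, mul_comm]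

theorem le_norm_sq_toLp {f : G → ℂ} {c : ℝ} (hc0 : 0 ≤ c) {B : Set G}
    (hB : MeasurableSet B) (hc : ∀ x ∈ B, c ≤ ‖f x‖)
    (hf : MemLp f 2 (μ.restrict Ω)) : c ^ 2 * μ.real (B ∩ Ω) ≤ ‖hf.toLp f‖ ^ 2 := by
  rw [L2_norm_sq]
  have hi : Integrable (fun x => ‖hf.toLp f x‖ ^ 2) (μ.restrict Ω) :=
    (Lp.memLp (hf.toLp f)).integrable_norm_pow two_ne_zero
  refine le_trans (le_of_eq ?_) (integral_mono_of_nonneg (f := B.indicator fun _ => c ^ 2)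
    (Eventually.of_forall fun x => indicator_nonneg (fun _ _ => by positivity) x) hi ?_)
  · rw [integral_indicator_const _ hB, measureReal_restrict_apply hB, smul_eq_mul, mul_comm]
  · filter_upwards [hf.coeFn_toLp] with x hx
    by_cases hxB : x ∈ B
    · rw [indicator_of_mem hxB, hx]
      have := hc x hxB
      gcongr
    · rw [indicator_of_notMem hxB]; positivity

/-- A sequence in `L²` that converges to `0` uniformly and converges in `L²` converges to `0`. -/
theorem eq_zero_of_tendsto_of_bound {u : ℕ → L2 μ Ω} {w : L2 μ Ω} (hu : Tendsto u atTop (𝓝 w))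
    {c : ℕ → ℝ} (hc : Tendsto c atTop (𝓝 0)) (hb : ∀ n, ∀ᵐ x ∂(μ.restrict Ω), ‖u n x‖ ≤ c n) :
    w = 0 := by
  obtain ⟨φ, hφ, hae⟩ := (tendstoInMeasure_of_tendsto_Lp hu).exists_seq_tendsto_ae
  refine Lp.ext ?_
  filter_upwards [hae, ae_all_iff.2 hb, Lp.coeFn_zero ℂ 2 (μ.restrict Ω)] with x hx hbx h0
  rw [h0]
  refine tendsto_nhds_unique hx (squeeze_zero_norm (fun n => hbx (φ n)) ?_)
  exact hc.comp hφ.tendsto_atTop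

end FiniteVolume

end Carnot

end


noncomputable section

namespace Carnot

open scoped Pointwise

/-! ### A compact embedding forces finite volume. -/

section FiniteVolume

variable {E : Type*} [NormedAddCommGroup E] [NormedSpace ℝ E] [FiniteDimensional ℝ E]
  {G : Type*} [TopologicalSpace G] [T2Space G] [SecondCountableTopology G]
  [ChartedSpace E G] [Group G] [LieGroup 𝓘(ℝ, E) ∞ G] [MeasurableSpace G] [BorelSpace G]
  {μ : Measure G} [μ.IsHaarMeasure] {Ω : Set G}
  {V₁ : Submodule ℝ (GroupLieAlgebra 𝓘(ℝ, E) G)} {m : ℕ}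

variable (E G) in
/-- A symmetric compact neighbourhood of the identity with a smooth bump function supported in it. -/
theorem exists_bump : ∃ (W : Set G) (k : G → ℝ), IsCompact W ∧ W ∈ 𝓝 (1 : G) ∧ W⁻¹ = W ∧
    ContMDiff 𝓘(ℝ, E) 𝓘(ℝ, ℝ) ∞ k ∧ tsupport k ⊆ W ∧ k 1 = 1 ∧ ∀ x, 0 ≤ k x := by
  have := ChartedSpace.locallyCompactSpace E G
  have := topologicalGroup_of_lieGroup 𝓘(ℝ, E) ∞ (G := G)
  obtain ⟨K, hK, hK1⟩ := exists_compact_mem_nhds (1 : G)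
  have hc : IsCompact (K ∩ K⁻¹) := hK.inter hK.inv
  have hn : K ∩ K⁻¹ ∈ 𝓝 (1 : G) := inter_mem hK1 (by
    have := inv_mem_nhds_one G hK1
    exact this)
  obtain ⟨χ, hχ1, hχ0, hχ⟩ := exists_contMDiffMap_one_nhds_of_subset_interior (n := ⊤) 𝓘(ℝ, E)
    (isClosed_singleton (x := (1 : G)))
    (singleton_subset_iff.2 (mem_interior_iff_mem_nhds.2 hn))
  refine ⟨K ∩ K⁻¹, χ, hc, hn, by rw [inter_inv, inv_inv, inter_comm], χ.contMDiff, ?_, ?_,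
    fun x => (hχ x).1⟩
  · exact closure_minimal (fun x hx => by by_contra h; exact hx (hχ0 x h)) hc.isClosed
  · exact (hχ1.filter_mono (nhds_le_nhdsSet (mem_singleton _))).self_of_nhds

set_option maxHeartbeats 1000000 in
/-- A set with compact Sobolev embedding has finite volume. -/
theorem IsRellich.measure_lt_top [ConnectedSpace G] (hμ : IsDivergenceFree E μ)
    {X : Module.Basis (Fin m) ℝ V₁} (hR : IsRellich μ Ω X) : μ Ω < ⊤ := by
  have := ChartedSpace.locallyCompactSpace E G
  have := topologicalGroup_of_lieGroup 𝓘(ℝ, E) ∞ (G := G)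
  by_contra htop
  have htop : μ Ω = ⊤ := by simpa using htop
  obtain ⟨W, k, hW, hW1, hWinv, hk, hkW, hk1, hk0⟩ := exists_bump E G
  have h1W : (1 : G) ∈ W := mem_of_mem_nhds hW1
  have hWn : ∀ n, IsCompact (W ^ n) := isCompact_pow hW
  have hWmeas : ∀ n, MeasurableSet (W ^ n) := fun n => (hWn n).measurableSet
  have hWfin : ∀ n, μ (W ^ n ∩ Ω) ≠ ⊤ := fun n =>
    ((measure_mono inter_subset_left).trans_lt (hWn n).measure_lt_top).ne
  have hmono : Monotone fun n => W ^ n := Set.pow_right_monotone h1W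
  -- The convolution of the indicator of `W ^ (n + 1)` with a bump supported in `W` is at least `c >
  -- 0` in modulus on `W ^ n` and vanishes off `W ^ (n + 2)`; it and its gradient are bounded
  -- uniformly in `n`. Divide it by `√(a n)` at indices with `a (n + 2) ≤ M * a n`. The results are
  -- bounded in S¹(Ω), have `L²` norm at least `c`, and tend to zero uniformly if `a n → ∞`. This
  -- contradicts compactness.
  let a : ℕ → ℝ := fun n => μ.real (W ^ n ∩ Ω)
  have hatop : Tendsto a atTop atTop := by
    rw [← ENNReal.tendsto_ofReal_nhds_top]
    have h1 : ∀ n, ENNReal.ofReal (a n) = μ (W ^ n ∩ Ω) := fun n => ENNReal.ofReal_toReal (hWfin n)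
    simp only [h1]
    have h2 := tendsto_measure_iUnion_atTop (μ := μ) (s := fun n => W ^ n ∩ Ω)
      fun i j hij => inter_subset_inter_left _ (hmono hij)
    rwa [← iUnion_inter, iUnion_pow_eq_univ hW1 hWinv, univ_inter, htop] at h2
  obtain ⟨q, hq⟩ := exists_measure_pow_le μ hW1 hW
  have hgrow : ∀ n, a (n + 1) ≤ μ.real W * (q : ℝ) ^ n := fun n => by
    have h1 : μ (W ^ (n + 1) ∩ Ω) ≤ (q : ENNReal) ^ n * μ W :=
      (measure_mono inter_subset_left).trans (hq n)
    have h2 := ENNReal.toReal_mono (ENNReal.mul_ne_top (by simp) hW.measure_lt_top.ne) h1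
    rw [ENNReal.toReal_mul, ENNReal.toReal_pow, ENNReal.toReal_natCast, mul_comm] at h2
    exact h2
  have hdoub := exists_doubling (Nat.cast_nonneg q) hgrow hatop
  choose ν hνge hν1 hνd using hdoub
  set M : ℝ := (q : ℝ) ^ 2 + 1
  -- the bump function and its convolutions
  let κ : G → ℂ := fun x => (k x : ℂ)
  have hκ : ContMDiff 𝓘(ℝ, E) 𝓘(ℝ, ℂ) ∞ κ := (Complex.ofRealCLM.contDiff.contMDiff (n := ∞)).comp hk
  have hκW : tsupport κ ⊆ W :=
    (closure_mono fun x hx => mt (fun h0 : k x = 0 => by simp [κ, h0]) hx : _ ⊆ tsupport k).trans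
      hkW
  have hκc : HasCompactSupport κ := hW.of_isClosed_subset (isClosed_tsupport _) hκW
  have hsupp : ∀ f : G → ℂ, (∀ x ∉ W, f x = 0) → ∀ n, ∀ x ∉ W ^ (n + 2),
      indicatorConv μ (W ^ (n + 1)) f x = 0 := fun f hf n x hx => by
    refine indicatorConv_eq_zero fun y hy => hf _ fun hyx => hx ?_
    rw [show x = y * (y⁻¹ * x) by group, pow_succ]
    exact mul_mem_mul hy hyx
  have hκ0 : ∀ x ∉ W, κ x = 0 := fun x hx => image_eq_zero_of_notMem_tsupport fun h => hx (hκW h)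
  have hκ0' : ∀ i, ∀ x ∉ W, invDeriv (X i : GroupLieAlgebra 𝓘(ℝ, E) G) κ x = 0 := fun i x hx => by
    rw [invDeriv_congr (notMem_tsupport_iff_eventuallyEq.1 fun hh => hx (hκW hh)),
      show (0 : G → ℂ) = fun _ => 0 from rfl, invDeriv_const]
  have hbd : ∀ f : G → ℂ, Continuous f → HasCompactSupport f → (∀ x ∉ W, f x = 0) → ∀ n,
      MemLp (indicatorConv μ (W ^ (n + 1)) f) 2 (μ.restrict Ω) := fun f hf hfc h0 n =>
    memLp_of_bound_of_eq_zero (stronglyMeasurable_indicatorConv hf) (hWmeas (n + 2))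
      (hWfin (n + 2)) (norm_indicatorConv_le hf hfc) (hsupp f h0 n)
  have hbd' : ∀ (f : G → ℂ) (hf : Continuous f) (hfc : HasCompactSupport f)
      (h0 : ∀ x ∉ W, f x = 0) (n : ℕ),
      ‖(hbd f hf hfc h0 n).toLp _‖ ^ 2 ≤ (∫ y, ‖f y⁻¹‖ ∂μ) ^ 2 * a (n + 2) := fun f hf hfc h0 n =>
    norm_sq_toLp_le (hWmeas (n + 2)) (hWfin (n + 2)) (norm_indicatorConv_le hf hfc)
      (hsupp f h0 n) _
  let c : ℝ := ∫ y, k y⁻¹ ∂μ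
  have hc : 0 < c := by
    refine Continuous.integral_pos_of_hasCompactSupport_nonneg_nonzero
      (hk.continuous.comp continuous_inv) ?_ (fun x => hk0 _) (x := 1) (by simp [hk1])
    have hkc : HasCompactSupport k := hW.of_isClosed_subset (isClosed_tsupport _) hkW
    exact hkc.comp_homeomorph (Homeomorph.inv G)
  -- For `x ∈ W ^ n`, symmetry of `W` puts the support of `y ↦ κ (y⁻¹ x)` inside `W ^ (n + 1)`, so
  -- the full integral survives.
  have hκnorm : ∀ n, ∀ x ∈ W ^ n, c ≤ ‖indicatorConv μ (W ^ (n + 1)) κ x‖ := fun n x hx => by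
    rw [indicatorConv_eq]
    · simp only [κ]
      rw [integral_complex_ofReal, Complex.norm_real]
      exact le_abs_self _
    · intro y hy
      refine hκ0 _ fun h => hy ?_
      rw [show y = x * (y⁻¹ * x)⁻¹ by group, pow_succ]
      refine mul_mem_mul hx ?_
      rw [← hWinv]; exact Set.inv_mem_inv.2 h
  let u : ℕ → L2 μ Ω := fun n => (hbd κ hκ.continuous hκc hκ0 n).toLp _
  let p : ℕ → Fin m → L2 μ Ω := fun n i => (hbd _
    (continuous_invDeriv (X i : GroupLieAlgebra 𝓘(ℝ, E) G) hκ) (hasCompactSupport_invDeriv _ hκc) (hκ0' i) n).toLp _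
  let s : ℕ → ℝ := fun j => (Real.sqrt (a (ν j)))⁻¹
  have hs : ∀ j, s j ^ 2 = (a (ν j))⁻¹ := fun j => by
    simp only [s]
    rw [inv_pow, Real.sq_sqrt (zero_le_one.trans (hν1 j))]
  let b : ℕ → GradSpace μ Ω m := fun j => (s j : ℂ) • gradPair (u (ν j)) (p (ν j))
  have hgrad : ∀ n i, IsWeakDeriv μ Ω (X i : GroupLieAlgebra 𝓘(ℝ, E) G) (u n) (p n i) := fun n i =>
    isWeakDeriv_indicatorConv hμ (hWn (n + 1)) hκ hκc _ (hbd κ hκ.continuous hκc hκ0 n)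
      (hbd _ (continuous_invDeriv (X i : GroupLieAlgebra 𝓘(ℝ, E) G) hκ)
        (hasCompactSupport_invDeriv _ hκc) (hκ0' i) n)
  have hbmem : ∀ j, b j ∈ formDomain X (S1 μ Ω V₁) := fun j =>
    Submodule.smul_mem _ _ (mem_formDomain_S1.2 (hgrad (ν j)))
  set B : ℝ := (∫ y, ‖κ y⁻¹‖ ∂μ) ^ 2
    + ∑ i, (∫ y, ‖invDeriv (X i : GroupLieAlgebra 𝓘(ℝ, E) G) κ y⁻¹‖ ∂μ) ^ 2
  have hB0 : 0 ≤ B := add_nonneg (sq_nonneg _) (Finset.sum_nonneg fun i _ => sq_nonneg _)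
  have hbn : ∀ j, ‖b j‖ ^ 2 ≤ B * M := fun j => by
    have ha0 : 0 < a (ν j) := zero_lt_one.trans_le (hν1 j)
    simp only [b]
    rw [norm_smul, mul_pow, Complex.norm_real, Real.norm_eq_abs, sq_abs, hs, gradSpace_norm_sq]
    have h1 : ‖u (ν j)‖ ^ 2 + ∑ i, ‖p (ν j) i‖ ^ 2 ≤ B * a (ν j + 2) := by
      rw [add_mul, Finset.sum_mul]
      refine add_le_add (hbd' κ hκ.continuous hκc hκ0 _) (Finset.sum_le_sum fun i _ => ?_)
      exact hbd' _ (continuous_invDeriv (X i : GroupLieAlgebra 𝓘(ℝ, E) G) hκ)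
        (hasCompactSupport_invDeriv _ hκc) (hκ0' i) _
    simp only [gradPair_none, gradPair_some]
    rw [inv_mul_le_iff₀ ha0]
    refine h1.trans ?_
    calc B * a (ν j + 2) ≤ B * (M * a (ν j)) := by gcongr; exact hνd j
      _ = _ := by ring
  obtain ⟨w, φ, hφ, hw⟩ := hR b hbmem (Real.sqrt (B * M)) fun j =>
    Real.le_sqrt_of_sq_le (hbn j)
  have hνt : Tendsto (fun j => ν (φ j)) atTop atTop :=
    tendsto_atTop_mono (fun j => hνge (φ j)) hφ.tendsto_atTop
  have hst : Tendsto (fun j => s (φ j)) atTop (𝓝 0) :=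
    tendsto_inv_atTop_zero.comp (Real.tendsto_sqrt_atTop.comp (hatop.comp hνt))
  have hw0 : w = 0 := by
    refine eq_zero_of_tendsto_of_bound hw (c := fun j => s (φ j) * ∫ y, ‖κ y⁻¹‖ ∂μ)
      (by simpa using hst.mul_const (∫ y, ‖κ y⁻¹‖ ∂μ)) fun j => ?_
    filter_upwards [Lp.coeFn_smul (s (φ j) : ℂ) (u (ν (φ j))),
      (hbd κ hκ.continuous hκc hκ0 (ν (φ j))).coeFn_toLp] with x hx hx'
    change ‖((s (φ j) : ℂ) • u (ν (φ j))) x‖ ≤ _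
    rw [hx, Pi.smul_apply, norm_smul, Complex.norm_real, Real.norm_of_nonneg (by positivity), hx']
    gcongr
    exact norm_indicatorConv_le hκ.continuous hκc x
  have hlow : ∀ j, c ^ 2 ≤ ‖b j none‖ ^ 2 := fun j => by
    have ha0 : 0 < a (ν j) := zero_lt_one.trans_le (hν1 j)
    have h1 : c ^ 2 * a (ν j) ≤ ‖u (ν j)‖ ^ 2 := le_norm_sq_toLp hc.le (hWmeas _) (hκnorm _) _
    have h2 : b j none = (s j : ℂ) • u (ν j) := rfl
    rw [h2, norm_smul, mul_pow, Complex.norm_real, Real.norm_eq_abs, sq_abs, hs,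
      le_inv_mul_iff₀ ha0, mul_comm]
    exact h1
  have hlim := ge_of_tendsto' (hw.norm.pow 2) fun j => hlow (φ j)
  rw [hw0, norm_zero] at hlim
  nlinarith

end FiniteVolume

end Carnot

end


noncomputable section

namespace Carnot

/-! ### Invariance under small translations from compactness. -/

section Invariance

variable {H F : Type*} [NormedAddCommGroup H] [InnerProductSpace ℂ H] [CompleteSpace H]
  [NormedAddCommGroup F] [InnerProductSpace ℂ F] [CompleteSpace F]

/-- Let `N` be a closed subspace of `F` on which the norm of `F` is equivalent to that of `H` and
let `K ⊆ N` be the part in the range of the projection `P`. If `P` is compact on `N`, then `K` is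
eventually invariant under isometries that preserve `N` and converge strongly to the identity. -/
theorem exists_invariant_of_compact {N : Submodule ℂ F} (hN : IsClosed (N : Set F))
    (π : F →L[ℂ] H) (P : H →L[ℂ] H) (hP : ∀ x, P (P x) = P x) {C : ℝ}
    (hC : ∀ a ∈ N, ‖a‖ ^ 2 = C * ‖π a‖ ^ 2)
    (hcpt : ∀ a : ℕ → F, (∀ n, a n ∈ N) → (∀ n, ‖a n‖ ≤ 1) →
      ∃ y, ∃ φ : ℕ → ℕ, StrictMono φ ∧ Tendsto (fun n => P (π (a (φ n)))) atTop (𝓝 y))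
    (S S' : ℕ → H →ₗᵢ[ℂ] H) (T T' : ℕ → F →ₗᵢ[ℂ] F)
    (hS'S : ∀ n x, S' n (S n x) = x) (hπ : ∀ n a, π (T n a) = S n (π a))
    (hπ' : ∀ n a, π (T' n a) = S' n (π a)) (hT : ∀ n, ∀ a ∈ N, T n a ∈ N)
    (hT' : ∀ n, ∀ a ∈ N, T' n a ∈ N)
    (hcomm : ∀ n x, P x = x → P (S n (P (S' n x))) = S n (P (S' n x)))
    (hcont : ∀ x, Tendsto (fun n => S n x) atTop (𝓝 x)) :
    ∃ n, ∀ b ∈ N, P (π b) = π b → P (π (T n b)) = π (T n b) := by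
  by_contra hcon
  push Not at hcon
  choose b hbN hbP hbT using hcon
  let K : Submodule ℂ F := N ⊓ LinearMap.ker
    ((P ∘L π - π : F →L[ℂ] H) : F →ₗ[ℂ] H)
  have hK : ∀ a, a ∈ K ↔ a ∈ N ∧ P (π a) = π a := fun a => by
    simp only [K, Submodule.mem_inf, LinearMap.mem_ker]
    refine and_congr_right fun _ => ?_
    change P (π a) - π a = 0 ↔ _
    exact sub_eq_zero
  have hKc : IsClosed (K : Set F) := by
    have : (K : Set F) = (N : Set F) ∩ {a | P (π a) = π a} := by
      ext a; exact hK a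
    rw [this]
    exact hN.inter (isClosed_eq (P.continuous.comp π.continuous) π.continuous)
  have : CompleteSpace K := hKc.completeSpace_coe
  -- If `T n (b n)` leaves `K`, its normalized component orthogonal to `K` is the unit vector `a n`.
  -- A limit point of these will lie both in `K` and in its orthogonal complement.
  let c : ℕ → F := fun n => K.starProjection (T n (b n))
  have hcK : ∀ n, c n ∈ K := fun n => Submodule.starProjection_apply_mem _ _
  let w : ℕ → F := fun n => T n (b n) - c n
  have hwK : ∀ n, w n ∈ Kᗮ := fun n => Submodule.sub_starProjection_mem_orthogonal _
  have hw0 : ∀ n, w n ≠ 0 := fun n h => by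
    have h1 : T n (b n) ∈ K := by rw [sub_eq_zero.1 h]; exact hcK n
    exact hbT n ((hK _).1 h1).2
  let β : ℕ → ℂ := fun n => ((‖w n‖⁻¹ : ℝ) : ℂ)
  let a : ℕ → F := fun n => β n • w n
  have ha1 : ∀ n, ‖a n‖ = 1 := fun n => by
    simp only [a, β, norm_smul, Complex.norm_real, norm_inv, norm_norm]
    exact inv_mul_cancel₀ (norm_ne_zero_iff.2 (hw0 n))
  have haN : ∀ n, a n ∈ N := fun n => Submodule.smul_mem _ _
    (sub_mem (hT n _ (hbN n)) ((hK _).1 (hcK n)).1)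
  have haK : ∀ n, a n ∈ Kᗮ := fun n => Submodule.smul_mem _ _ (hwK n)
  -- For indicator multiplications this says that `π (a n)` lives on the union of Ω and its
  -- translate: split it into the part on Ω and the part on the translate only.
  have hdec : ∀ n, π (a n) = P (π (a n))
      + (S n (P (S' n (π (a n)))) - P (S n (P (S' n (π (a n)))))) := fun n => by
    have h1 : π (a n) = S n (π (β n • b n)) - π (β n • c n) := by
      simp only [a, w]
      rw [map_smul, map_sub, hπ, map_smul, map_smul, map_smul, smul_sub]
    have h2 : P (π (β n • c n)) = π (β n • c n) := by
      rw [map_smul, map_smul, ((hK _).1 (hcK n)).2]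
    have h3 : P (π (β n • b n)) = π (β n • b n) := by
      rw [map_smul, map_smul, hbP]
    have h4 : S n (P (S' n (π (a n)))) = S n (π (β n • b n)) - S n (P (S' n (π (β n • c n)))) := by
      rw [h1, map_sub, hS'S, map_sub, h3, map_sub]
    rw [h4, map_sub P, hcomm n _ h2, h1, map_sub P, h2]
    abel
  obtain ⟨y₁, φ₁, hφ₁, hy₁⟩ := hcpt a haN fun n => (ha1 n).le
  obtain ⟨y₂, φ₂, hφ₂, hy₂⟩ := hcpt (fun n => T' (φ₁ n) (a (φ₁ n))) (fun n => hT' _ _ (haN _))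
    fun n => by rw [(T' _).norm_map]; exact (ha1 _).le
  let ψ : ℕ → ℕ := fun n => φ₁ (φ₂ n)
  have hψ : Tendsto ψ atTop atTop := hφ₁.tendsto_atTop.comp hφ₂.tendsto_atTop
  have hlim1 : Tendsto (fun n => P (π (a (ψ n)))) atTop (𝓝 y₁) := hy₁.comp hφ₂.tendsto_atTop
  have hlim2 : Tendsto (fun n => S (ψ n) (P (S' (ψ n) (π (a (ψ n)))))) atTop (𝓝 y₂) := by
    simp only [hπ'] at hy₂
    rw [tendsto_iff_norm_sub_tendsto_zero] at hy₂ ⊢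
    have h1 := tendsto_iff_norm_sub_tendsto_zero.1 ((hcont y₂).comp hψ)
    refine squeeze_zero (fun n => norm_nonneg _) (fun n => ?_) (by simpa using hy₂.add h1)
    have e : S (ψ n) (P (S' (ψ n) (π (a (ψ n))))) - y₂
        = S (ψ n) (P (S' (ψ n) (π (a (ψ n)))) - y₂) + (S (ψ n) y₂ - y₂) := by
      rw [map_sub]; abel
    rw [e]
    refine (norm_add_le _ _).trans (add_le_add ?_ le_rfl)
    rw [(S (ψ n)).norm_map]
  have hPy₁ : P y₁ = y₁ := by
    have h1 := (P.continuous.tendsto y₁).comp hlim1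
    simp only [Function.comp_def, hP] at h1
    exact tendsto_nhds_unique h1 hlim1
  have hPy₂ : P y₂ = y₂ := by
    have h1 := (P.continuous.tendsto y₂).comp hy₂
    simp only [Function.comp_def, hP] at h1
    exact tendsto_nhds_unique h1 hy₂
  -- Both compact pieces converge along a subsequence. Since `P y₂ = y₂`, the part off the range of
  -- `P` disappears in the limit.
  have hlim : Tendsto (fun n => π (a (ψ n))) atTop (𝓝 y₁) := by
    have h1 := hlim1.add (hlim2.sub ((P.continuous.tendsto y₂).comp hlim2))
    rw [hPy₂, sub_self, add_zero] at h1
    exact h1.congr fun n => (hdec (ψ n)).symm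
  -- On `N` the norm of `F` is a multiple of that of `π`, so convergence lifts from `H` to `F`.
  have hcau : CauchySeq fun n => a (ψ n) := by
    have h1 := hlim.cauchySeq
    have h2 : ∀ n k, dist (a (ψ n)) (a (ψ k)) ≤
        Real.sqrt |C| * dist (π (a (ψ n))) (π (a (ψ k))) := fun n k => by
      rw [dist_eq_norm, dist_eq_norm, ← map_sub]
      refine (pow_le_pow_iff_left₀ (norm_nonneg _) (by positivity) two_ne_zero).1 ?_
      rw [hC _ (sub_mem (haN _) (haN _)), mul_pow, Real.sq_sqrt (abs_nonneg C)]
      gcongr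
      exact le_abs_self C
    rw [Metric.cauchySeq_iff] at h1 ⊢
    intro ε hε
    obtain ⟨M, hM⟩ := h1 (ε / (Real.sqrt |C| + 1)) (by positivity)
    refine ⟨M, fun n hn k hk => ?_⟩
    have h3 := hM n hn k hk
    rw [lt_div_iff₀ (by positivity)] at h3
    refine (h2 n k).trans_lt (lt_of_le_of_lt ?_ h3)
    nlinarith [dist_nonneg (x := π (a (ψ n))) (y := π (a (ψ k)))]
  obtain ⟨z, hz⟩ := cauchySeq_tendsto_of_complete hcau
  have hzK : z ∈ K := by
    refine (hK z).2 ⟨hN.mem_of_tendsto hz (Eventually.of_forall fun n => haN _), ?_⟩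
    rw [tendsto_nhds_unique ((π.continuous.tendsto z).comp hz) hlim, hPy₁]
  have h1 : Tendsto (fun n => inner ℂ z (a (ψ n))) atTop (𝓝 (inner ℂ z z)) :=
    tendsto_const_nhds.inner hz
  have h2 : inner ℂ z z = 0 := by
    refine tendsto_nhds_unique h1 ?_
    simp only [(Submodule.mem_orthogonal _ _).1 (haK _) z hzK]
    exact tendsto_const_nhds
  have h3 := tendsto_nhds_unique hz.norm (by simp only [ha1]; exact tendsto_const_nhds)
  rw [inner_self_eq_zero.1 h2, norm_zero] at h3
  exact zero_ne_one h3

end Invariance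

end Carnot

end


noncomputable section

namespace Carnot

/-! ### Extension by zero and restriction. -/

section Extension

variable {G : Type*} [MeasurableSpace G] {μ : Measure G} {Ω : Set G}

theorem ae_restrict_univ_iff {p : G → Prop} :
    (∀ᵐ x ∂(μ.restrict univ), p x) ↔ ∀ᵐ x ∂μ, p x := by rw [Measure.restrict_univ]

theorem memLp_indicator_univ (hΩ : MeasurableSet Ω) (u : L2 μ Ω) :
    MemLp (Ω.indicator u) 2 (μ.restrict univ) := by
  rw [Measure.restrict_univ]
  exact (memLp_indicator_iff_restrict hΩ).2 (Lp.memLp u)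

variable (μ) in
theorem ae_indicator_congr (hΩ : MeasurableSet Ω) {f g : G → ℂ} (h : f =ᵐ[μ.restrict Ω] g) :
    Ω.indicator f =ᵐ[μ.restrict univ] Ω.indicator g := by
  rw [Measure.restrict_univ]
  exact (ae_eq_restrict_iff_indicator_ae_eq hΩ).1 h

/-- Extension of functions by zero. -/
def extendZero (hΩ : MeasurableSet Ω) : L2 μ Ω →ₗᵢ[ℂ] L2 μ (univ : Set G) where
  toFun u := (memLp_indicator_univ hΩ u).toLp _
  map_add' u v := by
    rw [← MemLp.toLp_add]
    refine MemLp.toLp_congr _ _ ?_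
    refine (ae_indicator_congr μ hΩ (Lp.coeFn_add u v)).trans ?_
    rw [indicator_add']
  map_smul' c u := by
    rw [RingHom.id_apply, ← MemLp.toLp_const_smul]
    refine MemLp.toLp_congr _ _ ?_
    refine (ae_indicator_congr μ hΩ (Lp.coeFn_smul c u)).trans ?_
    refine Eventually.of_forall fun x => ?_
    by_cases hx : x ∈ Ω <;> simp [hx]
  norm_map' u := by
    change ‖(memLp_indicator_univ hΩ u).toLp _‖ = ‖u‖
    rw [Lp.norm_toLp, Measure.restrict_univ, eLpNorm_indicator_eq_eLpNorm_restrict hΩ, Lp.norm_def]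

theorem coeFn_extendZero (hΩ : MeasurableSet Ω) (u : L2 μ Ω) :
    extendZero hΩ u =ᵐ[μ.restrict univ] Ω.indicator u :=
  (memLp_indicator_univ hΩ u).coeFn_toLp

theorem memLp_restrict_of_univ (u : L2 μ (univ : Set G)) : MemLp u 2 (μ.restrict Ω) :=
  (Lp.memLp u).mono_measure (Measure.restrict_mono (subset_univ Ω) le_rfl)

/-- Restriction of functions to `Ω`. -/
def restrictL2 (hΩ : MeasurableSet Ω) : L2 μ (univ : Set G) →L[ℂ] L2 μ Ω :=
  ContinuousLinearMap.adjoint (extendZero hΩ).toContinuousLinearMap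

theorem inner_restrictL2 (hΩ : MeasurableSet Ω) (v : L2 μ Ω) (u : L2 μ (univ : Set G)) :
    inner ℂ v (restrictL2 hΩ u) = inner ℂ (extendZero hΩ v) u :=
  ContinuousLinearMap.adjoint_inner_right _ _ _

theorem restrictL2_eq (hΩ : MeasurableSet Ω) (u : L2 μ (univ : Set G)) :
    restrictL2 hΩ u = (memLp_restrict_of_univ u).toLp u := by
  refine ext_inner_left ℂ fun v => ?_
  rw [inner_restrictL2, L2.inner_def, L2.inner_def]
  have h1 : ∫ x in univ, inner ℂ (extendZero hΩ v x) (u x) ∂μ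
      = ∫ x in univ, Ω.indicator (fun x => inner ℂ (v x) (u x)) x ∂μ := by
    refine integral_congr_ae ((coeFn_extendZero hΩ v).mono fun x hx => ?_)
    simp only [hx]
    by_cases hxΩ : x ∈ Ω
    · simp [hxΩ]
    · simp [hxΩ]
  rw [h1, setIntegral_univ, integral_indicator hΩ]
  refine integral_congr_ae ((memLp_restrict_of_univ u).coeFn_toLp.mono fun x hx => ?_)
  simp only [hx]

theorem coeFn_restrictL2 (hΩ : MeasurableSet Ω) (u : L2 μ (univ : Set G)) :
    restrictL2 hΩ u =ᵐ[μ.restrict Ω] u := by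
  rw [restrictL2_eq]
  exact (memLp_restrict_of_univ u).coeFn_toLp

theorem restrictL2_extendZero (hΩ : MeasurableSet Ω) (u : L2 μ Ω) :
    restrictL2 hΩ (extendZero hΩ u) = u :=
  ext_inner_left ℂ fun v => by rw [inner_restrictL2, LinearIsometry.inner_map_map]

theorem coeFn_extendZero_restrictL2 (hΩ : MeasurableSet Ω) (u : L2 μ (univ : Set G)) :
    extendZero hΩ (restrictL2 hΩ u) =ᵐ[μ.restrict univ] Ω.indicator u :=
  (coeFn_extendZero hΩ _).trans (ae_indicator_congr μ hΩ (coeFn_restrictL2 hΩ u))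

end Extension

/-! ### Left translations on `L²(G)`. -/

section Translation

variable {G : Type*} [TopologicalSpace G] [T2Space G] [SecondCountableTopology G]
  [Group G] [IsTopologicalGroup G] [LocallyCompactSpace G] [MeasurableSpace G] [BorelSpace G]
  {μ : Measure G} [μ.IsHaarMeasure]

variable (μ) in
theorem measurePreserving_inv_mul (g : G) :
    MeasurePreserving (g⁻¹ * ·) (μ.restrict univ) (μ.restrict univ) := by
  rw [Measure.restrict_univ]
  exact measurePreserving_mul_left μ g⁻¹

variable (μ) in
/-- The left regular representation on `L²(G)`. -/
def translate (g : G) : L2 μ (univ : Set G) →ₗᵢ[ℂ] L2 μ (univ : Set G) :=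
  Lp.compMeasurePreservingₗᵢ ℂ (g⁻¹ * ·) (measurePreserving_inv_mul μ g)

theorem coeFn_translate (g : G) (u : L2 μ (univ : Set G)) :
    translate μ g u =ᵐ[μ.restrict univ] fun x => u (g⁻¹ * x) :=
  Lp.coeFn_compMeasurePreserving u (measurePreserving_inv_mul μ g)

theorem translate_mul (g h : G) (u : L2 μ (univ : Set G)) :
    translate μ g (translate μ h u) = translate μ (g * h) u := by
  refine Lp.ext ?_
  have h1 := (measurePreserving_inv_mul μ g).quasiMeasurePreserving.ae_eq_comp
    (coeFn_translate h u)
  filter_upwards [coeFn_translate g (translate μ h u), h1, coeFn_translate (g * h) u]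
    with x hx hx1 hx2
  rw [hx, hx2]
  simp only [Function.comp] at hx1
  rw [hx1, mul_inv_rev, mul_assoc]

theorem translate_one (u : L2 μ (univ : Set G)) : translate μ 1 u = u := by
  refine Lp.ext ?_
  filter_upwards [coeFn_translate 1 u] with x hx
  rw [hx]; simp

theorem tendsto_translate (u : L2 μ (univ : Set G)) {g : ℕ → G}
    (hg : Tendsto g atTop (𝓝 1)) : Tendsto (fun n => translate μ (g n) u) atTop (𝓝 u) := by
  have : TopologicalSpace.MetrizableSpace G := TopologicalSpace.metrizableSpace_of_t3_secondCountable G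
  let c : G → C(G, G) := fun h => ⟨fun x => h⁻¹ * x, by fun_prop⟩
  have hc : Continuous c :=
    ContinuousMap.continuous_of_continuous_uncurry _ (by
      change Continuous fun p : G × G => p.1⁻¹ * p.2
      fun_prop)
  have h1 : Tendsto (fun n => c (g n)) atTop (𝓝 (c 1)) := (hc.tendsto 1).comp hg
  have h2 := (tendsto_const_nhds (x := u) (f := atTop)).compMeasurePreservingLp h1
    (fun n => measurePreserving_inv_mul μ (g n)) (measurePreserving_inv_mul μ 1) (by simp)
  have h3 : Lp.compMeasurePreserving (c 1) (measurePreserving_inv_mul μ 1) u = u := translate_one u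
  rw [h3] at h2
  exact h2

/-- Multiplication by the indicator functions of `Ω` and of `g Ω` commute. -/
theorem extendZero_restrictL2_translate {Ω : Set G} (hΩ : MeasurableSet Ω) (g : G)
    {u : L2 μ (univ : Set G)} (hu : extendZero hΩ (restrictL2 hΩ u) = u) :
    extendZero hΩ (restrictL2 hΩ (translate μ g (extendZero hΩ (restrictL2 hΩ
      (translate μ g⁻¹ u))))) = translate μ g (extendZero hΩ (restrictL2 hΩ (translate μ g⁻¹ u))) := by
  have hu0 : ∀ᵐ x ∂(μ.restrict univ), x ∉ Ω → u x = 0 := by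
    have h := coeFn_extendZero_restrictL2 hΩ u
    rw [hu] at h
    filter_upwards [h] with x hx hxΩ
    rw [hx, indicator_of_notMem hxΩ]
  set w := translate μ g (extendZero hΩ (restrictL2 hΩ (translate μ g⁻¹ u))) with hw
  have hq := (measurePreserving_inv_mul μ g).quasiMeasurePreserving
  refine Lp.ext ?_
  filter_upwards [coeFn_extendZero_restrictL2 hΩ w, hu0,
    coeFn_translate g (extendZero hΩ (restrictL2 hΩ (translate μ g⁻¹ u))),
    hq.ae_eq_comp (coeFn_extendZero_restrictL2 hΩ (translate μ g⁻¹ u)),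
    hq.ae_eq_comp (coeFn_translate g⁻¹ u)] with x h1 h2 h3 h4 h5
  rw [h1]
  by_cases hx : x ∈ Ω
  · rw [indicator_of_mem hx]
  · rw [indicator_of_notMem hx, hw, h3]
    simp only [Function.comp] at h4 h5
    rw [h4]
    by_cases hgx : g⁻¹ * x ∈ Ω
    · rw [indicator_of_mem hgx, h5]
      simp [h2 hx]
    · rw [indicator_of_notMem hgx]

/-- If all translates of `u ∈ L²(G)` vanish outside of a set of finite measure, then `u = 0`. -/
theorem eq_zero_of_forall_translate [NoncompactSpace G] {Ω : Set G} (hΩ : MeasurableSet Ω)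
    (hfin : μ Ω < ⊤) (u : L2 μ (univ : Set G))
    (hu : ∀ g, extendZero hΩ (restrictL2 hΩ (translate μ g u)) = translate μ g u) : u = 0 := by
  have hsm := Lp.stronglyMeasurable u
  have hm : MeasurableSet {p : G × G | p.2 ∉ Ω ∧ u (p.1⁻¹ * p.2) ≠ 0} := by
    refine (measurable_snd hΩ.compl).inter ?_
    have h1 : Measurable fun p : G × G => u (p.1⁻¹ * p.2) :=
      hsm.measurable.comp (by fun_prop : Continuous fun p : G × G => p.1⁻¹ * p.2).measurable
    exact h1 (measurableSet_singleton 0).compl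
  -- By Fubini, `u (g⁻¹ x) = 0` for almost all pairs with `x ∉ Ω`; hence a single point `x` outside
  -- Ω works for almost every `g`.
  have h0 : (μ.prod μ) {p : G × G | p.2 ∉ Ω ∧ u (p.1⁻¹ * p.2) ≠ 0} = 0 := by
    rw [Measure.measure_prod_null hm]
    refine Eventually.of_forall fun g => ?_
    have h1 := coeFn_extendZero_restrictL2 hΩ (translate μ g u)
    rw [hu g] at h1
    have h2 : ∀ᵐ x ∂μ, x ∉ Ω → u (g⁻¹ * x) = 0 := by
      have h3 := coeFn_translate (μ := μ) g u
      refine ae_restrict_univ_iff.1 ?_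
      filter_upwards [h1, h3] with x h1 h3 hx
      rw [← h3, h1, indicator_of_notMem hx]
    refine measure_mono_null (fun x hx => ?_) (ae_iff.1 h2)
    have hx : x ∉ Ω ∧ u (g⁻¹ * x) ≠ 0 := hx
    exact fun h => hx.2 (h hx.1)
  have h1 := Measure.ae_ae_of_ae_prod (μ := μ) (ν := μ)
    (p := fun p : G × G => ¬ (p.1 ∉ Ω ∧ u (p.2⁻¹ * p.1) ≠ 0)) (by
      have h2 := (Measure.measurePreserving_swap (μ := μ) (ν := μ)).measure_preimage
        hm.nullMeasurableSet
      rw [h0] at h2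
      rw [ae_iff]
      simpa using h2)
  have h2 : ∃ x, x ∉ Ω ∧ ∀ᵐ g ∂μ, ¬ (x ∉ Ω ∧ u (g⁻¹ * x) ≠ 0) := by
    by_contra hcon
    push Not at hcon
    have h3 : μ Ωᶜ = 0 := by
      refine measure_mono_null (fun x hx => ?_) (ae_iff.1 h1)
      intro h
      exact hcon x hx (by simpa using h)
    -- A noncompact group has infinite volume, so the complement of Ω is not a null set.
    have h4 := measure_univ_of_isMulLeftInvariant μ
    rw [← measure_add_measure_compl hΩ, h3, add_zero] at h4
    exact hfin.ne h4
  obtain ⟨x, hx, hg⟩ := h2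
  have h3 : μ {y | u y ≠ 0} = 0 := by
    -- The map `g ↦ g⁻¹ x` preserves null sets, being an inversion followed by a right translation.
    have h4 : μ ((fun g => g * x) ⁻¹' {y | u y ≠ 0})⁻¹ = 0 := by
      refine measure_mono_null (fun g hgx => ?_) (ae_iff.1 hg)
      have : u (g⁻¹ * x) ≠ 0 := hgx
      exact fun h => h ⟨hx, this⟩
    rwa [measure_inv_null, measure_mul_right_null] at h4
  refine Lp.ext ?_
  have h4 : ∀ᵐ y ∂(μ.restrict univ), u y = 0 :=
    ae_restrict_univ_iff.2 (ae_iff.2 h3)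
  filter_upwards [h4, Lp.coeFn_zero ℂ 2 (μ.restrict univ)] with y hy h0
  rw [hy, h0]; rfl

end Translation

end Carnot

end


noncomputable section

namespace Carnot

open scoped Pointwise

/-! ### A substitute for unique continuation of eigenfunctions. -/

section UniqueContinuation

variable {E : Type*} [NormedAddCommGroup E] [NormedSpace ℝ E] [FiniteDimensional ℝ E]
  {G : Type*} [TopologicalSpace G] [T2Space G] [SecondCountableTopology G]
  [ChartedSpace E G] [Group G] [LieGroup 𝓘(ℝ, E) ∞ G] [MeasurableSpace G] [BorelSpace G]
  [IsTopologicalGroup G] [LocallyCompactSpace G]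
  {μ : Measure G} [μ.IsHaarMeasure] {Ω : Set G}
  {V₁ : Submodule ℝ (GroupLieAlgebra 𝓘(ℝ, E) G)} {m : ℕ}

theorem integral_translate_mul (g : G) (u : L2 μ (univ : Set G)) (f : G → ℂ) :
    ∫ x in univ, translate μ g u x * f x ∂μ = ∫ x in univ, u x * f (g * x) ∂μ := by
  have h1 : ∫ x in univ, translate μ g u x * f x ∂μ = ∫ x in univ, u (g⁻¹ * x) * f x ∂μ :=
    integral_congr_ae ((coeFn_translate g u).mono fun x hx => by simp only [hx])
  rw [h1, setIntegral_univ, setIntegral_univ,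
    ← integral_mul_left_eq_self (fun x => u (g⁻¹ * x) * f x) g]
  simp

theorem IsWeakDeriv.translate {Y : GroupLieAlgebra 𝓘(ℝ, E) G} {u v : L2 μ (univ : Set G)}
    (h : IsWeakDeriv μ univ Y u v) (g : G) :
    IsWeakDeriv μ univ Y (translate μ g u) (translate μ g v) := by
  intro φ hφ
  have hφg : IsTestFunction E univ fun x => φ (g * x) :=
    ⟨hφ.smooth.comp contMDiff_mul_left, hφ.compact_supp.comp_homeomorph (Homeomorph.mulLeft g),
      subset_univ _⟩
  have h1 := h _ hφg
  simp only [invDeriv_comp_mul_left hφ.smooth] at h1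
  rw [integral_translate_mul, integral_translate_mul, h1]

theorem IsWeakDeriv.restrict (hΩ : MeasurableSet Ω) {Y : GroupLieAlgebra 𝓘(ℝ, E) G}
    {u v : L2 μ (univ : Set G)} (h : IsWeakDeriv μ univ Y u v) :
    IsWeakDeriv μ Ω Y (restrictL2 hΩ u) (restrictL2 hΩ v) := by
  have key : ∀ (w : L2 μ (univ : Set G)) (f : G → ℂ), (∀ x ∉ Ω, f x = 0) →
      ∫ x in Ω, restrictL2 hΩ w x * f x ∂μ = ∫ x in univ, w x * f x ∂μ := fun w f hf => by
    have h1 : ∫ x in Ω, restrictL2 hΩ w x * f x ∂μ = ∫ x in Ω, w x * f x ∂μ :=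
      integral_congr_ae ((coeFn_restrictL2 hΩ w).mono fun x hx => by simp only [hx])
    rw [h1, setIntegral_univ]
    exact setIntegral_eq_integral_of_forall_compl_eq_zero fun x hx => by rw [hf x hx, mul_zero]
  intro φ hφ
  rw [key, key]
  · exact h φ (hφ.mono (subset_univ _))
  · exact fun x hx => image_eq_zero_of_notMem_tsupport fun hh => hx (hφ.supp_subset hh)
  · intro x hx
    rw [invDeriv_congr (notMem_tsupport_iff_eventuallyEq.1 fun hh => hx (hφ.supp_subset hh)),
      show (0 : G → ℂ) = fun _ => 0 from rfl, invDeriv_const]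

/-- Functions in `S¹₀(Ω)` extended by zero belong to `S¹(G)`. -/
theorem isWeakDeriv_extendZero (hΩ : IsOpen Ω) (X : Module.Basis (Fin m) ℝ V₁)
    {d : GradSpace μ Ω m} (hd : d ∈ formDomain X (S10 μ Ω X)) (i : Fin m) :
    IsWeakDeriv μ univ (X i : GroupLieAlgebra 𝓘(ℝ, E) G) (extendZero hΩ.measurableSet (d none))
      (extendZero hΩ.measurableSet (d (some i))) := by
  have key : ∀ (w : L2 μ Ω) (f : G → ℂ),
      ∫ x in univ, extendZero hΩ.measurableSet w x * f x ∂μ = ∫ x in Ω, w x * f x ∂μ := fun w f => by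
    refine Eq.trans ?_ (integral_indicator hΩ.measurableSet)
    refine Eq.trans ?_ setIntegral_univ
    refine integral_congr_ae ((coeFn_extendZero hΩ.measurableSet w).mono fun x hx => ?_)
    simp only [hx]
    by_cases hxΩ : x ∈ Ω <;> simp [hxΩ]
  intro φ hφ
  rw [key, key]
  exact integral_mul_invDeriv_of_mem_S10 hΩ X hd hφ.smooth i hφ.memLp (hφ.memLp_invDeriv _)

variable (μ m) in
/-- Translation of a function together with its horizontal gradient. -/
def translateGrad (g : G) : GradSpace μ (univ : Set G) m →ₗᵢ[ℂ] GradSpace μ (univ : Set G) m where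
  toFun a := WithLp.toLp 2 fun o => translate μ g (a o)
  map_add' a b := PiLp.ext fun o => map_add (translate μ g) (a o) (b o)
  map_smul' c a := PiLp.ext fun o => map_smul (translate μ g) c (a o)
  norm_map' a := by
    change ‖(WithLp.toLp 2 fun o => translate μ g (a o) : GradSpace μ (univ : Set G) m)‖ = ‖a‖
    rw [← sq_eq_sq₀ (norm_nonneg _) (norm_nonneg _), PiLp.norm_sq_eq_of_L2, PiLp.norm_sq_eq_of_L2]
    exact Finset.sum_congr rfl fun o _ => by rw [← (translate μ g).norm_map (a o)]

theorem translateGrad_apply (g : G) (a : GradSpace μ (univ : Set G) m) (o : Option (Fin m)) :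
    translateGrad μ m g a o = translate μ g (a o) := rfl

theorem norm_restrictL2_le (hΩ : MeasurableSet Ω) (u : L2 μ (univ : Set G)) :
    ‖restrictL2 hΩ u‖ ≤ ‖u‖ := by
  refine (ContinuousLinearMap.le_opNorm _ _).trans ?_
  have h : ‖restrictL2 (μ := μ) hΩ‖ ≤ 1 := by
    rw [restrictL2, LinearIsometryEquiv.norm_map]
    exact LinearIsometry.norm_toContinuousLinearMap_le _
  exact mul_le_of_le_one_left (norm_nonneg _) h

/-- The pairs `(u, ∇u)` on `G` with `-Δ u = c u`. -/
def eigenDomain (μ : Measure G) [μ.IsHaarMeasure] (X : Module.Basis (Fin m) ℝ V₁) (c : ℝ) :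
    Submodule ℂ (GradSpace μ (univ : Set G) m) where
  carrier := {a | a ∈ formDomain X (S1 μ univ V₁) ∧ ∀ v ∈ formDomain X (S1 μ univ V₁),
    inner ℂ a v = (1 + c) * inner ℂ (a none) (v none)}
  zero_mem' := ⟨zero_mem _, fun v _ => by simp⟩
  add_mem' := fun {a b} ha hb => ⟨add_mem ha.1 hb.1, fun v hv => by
    rw [inner_add_left, ha.2 v hv, hb.2 v hv, PiLp.add_apply, inner_add_left]; ring⟩
  smul_mem' := fun z a ha => ⟨Submodule.smul_mem _ _ ha.1, fun v hv => by
    rw [inner_smul_left, ha.2 v hv, PiLp.smul_apply, inner_smul_left]; ring⟩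

theorem isClosed_eigenDomain (X : Module.Basis (Fin m) ℝ V₁) (c : ℝ) :
    IsClosed (eigenDomain μ X c : Set (GradSpace μ (univ : Set G) m)) := by
  have : (eigenDomain μ X c : Set (GradSpace μ (univ : Set G) m)) =
      (formDomain X (S1 μ univ V₁) : Set (GradSpace μ (univ : Set G) m)) ∩
      ⋂ v ∈ formDomain X (S1 μ univ V₁), {a : GradSpace μ (univ : Set G) m |
        inner ℂ a v = (1 + c) * inner ℂ (a none) (v none)} := by
    ext a
    simp only [mem_inter_iff, mem_iInter]
    rfl
  rw [this]
  refine (isClosed_formDomain_S1 X).inter (isClosed_biInter fun v _ => isClosed_eq ?_ ?_)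
  · exact continuous_id.inner continuous_const
  · exact continuous_const.mul ((continuous_gradSpace_apply none).inner continuous_const)

theorem translateGrad_mem_formDomain (X : Module.Basis (Fin m) ℝ V₁) (g : G)
    {a : GradSpace μ (univ : Set G) m} (ha : a ∈ formDomain X (S1 μ univ V₁)) :
    translateGrad μ m g a ∈ formDomain X (S1 μ univ V₁) :=
  mem_formDomain_S1.2 fun i => ((mem_formDomain_S1.1 ha) i).translate g

theorem translateGrad_inv (g : G) (a : GradSpace μ (univ : Set G) m) :
    translateGrad μ m g (translateGrad μ m g⁻¹ a) = a := by
  refine PiLp.ext fun o => ?_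
  change translate μ g (translate μ g⁻¹ (a o)) = a o
  rw [translate_mul, mul_inv_cancel, translate_one]

theorem translateGrad_mem_eigenDomain (X : Module.Basis (Fin m) ℝ V₁) {c : ℝ} (g : G)
    {a : GradSpace μ (univ : Set G) m} (ha : a ∈ eigenDomain μ X c) :
    translateGrad μ m g a ∈ eigenDomain μ X c := by
  refine ⟨translateGrad_mem_formDomain X g ha.1, fun v hv => ?_⟩
  have hw := translateGrad_mem_formDomain X g⁻¹ hv
  rw [← translateGrad_inv g v]
  rw [LinearIsometry.inner_map_map, ha.2 _ hw, translateGrad_apply g a, translateGrad_apply g,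
    LinearIsometry.inner_map_map]

theorem norm_sq_of_mem_eigenDomain {X : Module.Basis (Fin m) ℝ V₁} {c : ℝ}
    {a : GradSpace μ (univ : Set G) m} (ha : a ∈ eigenDomain μ X c) :
    ‖a‖ ^ 2 = (1 + c) * ‖a none‖ ^ 2 := by
  have h := ha.2 a ha.1
  rw [inner_self_eq_norm_sq_to_K, inner_self_eq_norm_sq_to_K] at h
  have h' : ((‖a‖ ^ 2 : ℝ) : ℂ) = (((1 + c) * ‖a none‖ ^ 2 : ℝ) : ℂ) := by
    push_cast
    exact h
  exact_mod_cast h'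

/-- A solution of the eigenvalue equation on `G` that vanishes outside of `Ω` is zero, if the
Sobolev embedding on `Ω` is compact. -/
theorem eq_zero_of_mem_eigenDomain [ConnectedSpace G] [NoncompactSpace G] (hΩ : MeasurableSet Ω)
    {X : Module.Basis (Fin m) ℝ V₁} (hR : IsRellich μ Ω X) (hfin : μ Ω < ⊤) {c : ℝ}
    {a : GradSpace μ (univ : Set G) m} (ha : a ∈ eigenDomain μ X c)
    (hsupp : extendZero hΩ (restrictL2 hΩ (a none)) = a none) : a = 0 := by
  let P : L2 μ (univ : Set G) →L[ℂ] L2 μ (univ : Set G) :=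
    (extendZero hΩ).toContinuousLinearMap ∘L restrictL2 hΩ
  have hP : ∀ u, P u = extendZero hΩ (restrictL2 hΩ u) := fun u => rfl
  let inv : Set G := {g | ∀ b ∈ eigenDomain μ X c, P (b none) = b none →
    P (translate μ g (b none)) = translate μ g (b none)}
  have hcpt : ∀ b : ℕ → GradSpace μ (univ : Set G) m, (∀ n, b n ∈ eigenDomain μ X c) →
      (∀ n, ‖b n‖ ≤ 1) → ∃ y, ∃ φ : ℕ → ℕ, StrictMono φ ∧
        Tendsto (fun n => P (b (φ n) none)) atTop (𝓝 y) := fun b hb hb1 => by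
    let r : ℕ → GradSpace μ Ω m := fun n => WithLp.toLp 2 fun o => restrictL2 hΩ (b n o)
    obtain ⟨y, φ, hφ, hy⟩ := hR r (fun n => mem_formDomain_S1.2 fun i =>
      ((mem_formDomain_S1.1 (hb n).1) i).restrict hΩ) 1 fun n => by
        refine le_trans ?_ (hb1 n)
        refine (pow_le_pow_iff_left₀ (norm_nonneg _) (norm_nonneg _) two_ne_zero).1 ?_
        rw [PiLp.norm_sq_eq_of_L2, PiLp.norm_sq_eq_of_L2]
        exact Finset.sum_le_sum fun o _ => by
          have := norm_restrictL2_le hΩ (b n o)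
          gcongr
    exact ⟨extendZero hΩ y, φ, hφ, ((extendZero hΩ).continuous.tendsto y).comp hy⟩
  -- Otherwise a sequence outside `inv` tends to the identity, and the invariance lemma, applied to
  -- these translations, gives a contradiction.
  have hnhds : inv ∈ 𝓝 (1 : G) := by
    have : TopologicalSpace.MetrizableSpace G :=
      TopologicalSpace.metrizableSpace_of_t3_secondCountable G
    by_contra hcon
    obtain ⟨g, hg, hgt⟩ : ∃ g : ℕ → G, (∀ n, g n ∉ inv) ∧ Tendsto g atTop (𝓝 1) := by
      have h1 : (1 : G) ∈ closure invᶜ := by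
        rw [closure_compl]
        exact fun h => hcon (mem_interior_iff_mem_nhds.1 h)
      obtain ⟨g, hg, hgt⟩ := mem_closure_iff_seq_limit.1 h1
      exact ⟨g, hg, hgt⟩
    obtain ⟨n, hn⟩ := exists_invariant_of_compact (isClosed_eigenDomain (μ := μ) X c)
      (PiLp.proj 2 (fun _ : Option (Fin m) => L2 μ (univ : Set G)) none) P
      (fun x => by rw [hP, hP, restrictL2_extendZero])
      (fun b hb => norm_sq_of_mem_eigenDomain hb) hcpt
      (fun n => translate μ (g n)) (fun n => translate μ (g n)⁻¹)
      (fun n => translateGrad μ m (g n)) (fun n => translateGrad μ m (g n)⁻¹)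
      (fun n x => by rw [translate_mul, inv_mul_cancel, translate_one])
      (fun n b => rfl) (fun n b => rfl)
      (fun n b hb => translateGrad_mem_eigenDomain X _ hb)
      (fun n b hb => translateGrad_mem_eigenDomain X _ hb)
      (fun n x hx => extendZero_restrictL2_translate hΩ (g n) hx)
      (fun x => tendsto_translate x hgt)
    exact hg n fun b hb hPb => hn b hb hPb
  have hW : inv ∩ inv⁻¹ ∈ 𝓝 (1 : G) := inter_mem hnhds (inv_mem_nhds_one G hnhds)
  have huniv := iUnion_pow_eq_univ hW (by rw [inter_inv, inv_inv, inter_comm])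
  -- The translates `translate μ k (b none)` with `k ∈ inv` come from elements of `eigenDomain`
  -- supported in Ω again, so invariance passes to products and, by connectedness, to the whole
  -- group.
  have hpow : ∀ n : ℕ, ∀ g ∈ (inv ∩ inv⁻¹) ^ n, g ∈ inv := by
    intro n
    induction n with
    | zero =>
      intro g hg
      rw [pow_zero, Set.mem_one] at hg
      subst hg
      intro b _ hb
      rwa [translate_one]
    | succ n ih =>
      intro g hg
      rw [pow_succ] at hg
      obtain ⟨h, hh, k, hk, rfl⟩ := mem_mul.1 hg
      intro b hb hPb
      have h1 := hk.1 b hb hPb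
      have h2 := ih h hh (translateGrad μ m k b) (translateGrad_mem_eigenDomain X k hb) h1
      change P (translate μ h (translate μ k (b none))) = translate μ h (translate μ k (b none)) at h2
      rwa [translate_mul] at h2
  have hall : ∀ g, g ∈ inv := fun g => by
    obtain ⟨n, hn⟩ := mem_iUnion.1 (huniv ▸ mem_univ g : g ∈ ⋃ n : ℕ, (inv ∩ inv⁻¹) ^ n)
    exact hpow n g hn
  have h0 : a none = 0 := eq_zero_of_forall_translate hΩ hfin (a none) fun g => hall g a ha hsupp
  have h1 := norm_sq_of_mem_eigenDomain ha
  rw [h0, norm_zero] at h1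
  have h2 : ‖a‖ ^ 2 = 0 := by rw [h1]; simp
  exact norm_eq_zero.1 (pow_eq_zero_iff two_ne_zero |>.1 h2)

/-- A function in `S¹₀(Ω)` cannot be a Neumann eigenfunction. -/
theorem eq_zero_of_mem_S10_of_neumann [ConnectedSpace G] [NoncompactSpace G] (hΩ : IsOpen Ω)
    {X : Module.Basis (Fin m) ℝ V₁} (hR : IsRellich μ Ω X) (hfin : μ Ω < ⊤) {c : ℝ}
    {d : GradSpace μ Ω m} (hd : d ∈ formDomain X (S10 μ Ω X))
    (h : ∀ v ∈ formDomain X (S1 μ Ω V₁), inner ℂ d v = (1 + c) * inner ℂ (d none) (v none)) :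
    d = 0 := by
  have hm := hΩ.measurableSet
  -- The extension by zero is a weak solution on all of `G`: testing it against `v` amounts to
  -- testing `d` against the restriction of `v`, which is allowed because `d` satisfies the equation
  -- against all of S¹(Ω).
  let a : GradSpace μ (univ : Set G) m := WithLp.toLp 2 fun o => extendZero hm (d o)
  have ha : a ∈ eigenDomain μ X c := by
    refine ⟨mem_formDomain_S1.2 fun i => isWeakDeriv_extendZero hΩ X hd i, fun v hv => ?_⟩
    have h1 := h (WithLp.toLp 2 fun o => restrictL2 hm (v o))
      (mem_formDomain_S1.2 fun i => ((mem_formDomain_S1.1 hv) i).restrict hm)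
    rw [PiLp.inner_apply] at h1 ⊢
    have h2 : ∀ o, inner ℂ (a o) (v o) = inner ℂ (d o) (restrictL2 hm (v o)) := fun o =>
      (inner_restrictL2 hm _ _).symm
    simp only [h2]
    exact h1
  have ha0 := eq_zero_of_mem_eigenDomain hm hR hfin ha (by
    change extendZero hm (restrictL2 hm (extendZero hm (d none))) = extendZero hm (d none)
    rw [restrictL2_extendZero])
  refine PiLp.ext fun o => ?_
  have h1 : extendZero hm (d o) = 0 := by
    have : a o = 0 := by rw [ha0]; rfl
    exact this
  exact (extendZero hm).injective (h1.trans (map_zero _).symm)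

end UniqueContinuation

end Carnot

end


noncomputable section

namespace Carnot

/-! ### Waves `exp(iF)` and their form inner products. -/

section Primitives

variable {E : Type*} [NormedAddCommGroup E] [NormedSpace ℝ E] [FiniteDimensional ℝ E]
  {G : Type*} [TopologicalSpace G] [T2Space G] [SecondCountableTopology G]
  [ChartedSpace E G] [Group G] [LieGroup 𝓘(ℝ, E) ∞ G] [MeasurableSpace G] [BorelSpace G]

/-- `F` is a smooth primitive of the left-invariant one-form `α`. -/
structure IsPrimitive (α : E →ₗ[ℝ] ℝ) (F : G → ℝ) : Prop where
  smooth : ContMDiff 𝓘(ℝ, E) 𝓘(ℝ, ℝ) ∞ F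
  hasDerivAt : ∀ (x : G) (v : E), HasDerivAt (fun s => F (x * idCurve G v s)) (α v) 0

theorem exists_isPrimitive [SimplyConnectedSpace G] (α : E →ₗ[ℝ] ℝ)
    (hα : ∀ x y : E, α (modelBracket G x y) = 0) : ∃ F : G → ℝ, IsPrimitive α F := by
  obtain ⟨F, hF, h⟩ := exists_global_primitive α hα
  refine ⟨F, hF, fun x v => ?_⟩
  rw [← h x v]
  exact hasDerivAt_mul_idCurve (hF.mdifferentiable (by simp) x) v

variable {α β : E →ₗ[ℝ] ℝ} {F F' : G → ℝ}

theorem IsPrimitive.add (h : IsPrimitive α F) (h' : IsPrimitive β F') :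
    IsPrimitive (α + β) (fun x => F x + F' x) :=
  ⟨h.smooth.add h'.smooth, fun x v => (h.hasDerivAt x v).add (h'.hasDerivAt x v)⟩

theorem IsPrimitive.const_mul (h : IsPrimitive α F) (c : ℝ) :
    IsPrimitive (c • α) (fun x => c * F x) :=
  ⟨(contDiff_const.mul contDiff_id : ContDiff ℝ ∞ fun t : ℝ => c * t).contMDiff.comp h.smooth,
    fun x v => (h.hasDerivAt x v).const_mul c⟩

/-- A primitive of a nonzero form has no critical point, whereas on a compact group it would attain
a maximum. -/
theorem IsPrimitive.noncompactSpace (h : IsPrimitive α F) {v : E} (hv : α v ≠ 0) :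
    NoncompactSpace G := by
  by_contra hc
  have hc : CompactSpace G := by rwa [← not_compactSpace_iff, not_not] at hc
  obtain ⟨x, -, hx⟩ := isCompact_univ.exists_isMaxOn (α := ℝ) ⟨(1 : G), mem_univ _⟩
    h.smooth.continuous.continuousOn
  refine hv (IsLocalMax.hasDerivAt_eq_zero (Eventually.of_forall fun s => ?_) (h.hasDerivAt x v))
  simpa using hx (mem_univ (x * idCurve G v s))

theorem IsPrimitive.infinite_of_isOpen (h : IsPrimitive α F) {v : E} (hv : α v ≠ 0) {Ω : Set G}
    (hΩ : IsOpen Ω) (hne : Ω.Nonempty) : Ω.Infinite := by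
  intro hfin
  obtain ⟨x, hx⟩ := hne
  have hs : IsOpen ({x} : Set G) := by
    have h1 : IsOpen (Ω \ (Ω \ {x})) := hΩ.sdiff (hfin.subset sdiff_subset).isClosed
    rwa [sdiff_sdiff_cancel_left (singleton_subset_iff.2 hx)] at h1
  have := topologicalGroup_of_lieGroup 𝓘(ℝ, E) ∞ (G := G)
  have hcont : Continuous fun s => x * idCurve G v s :=
    continuous_const.mul (contMDiff_idCurve (G := G) v).continuous
  have h2 : ∀ᶠ s in 𝓝 (0 : ℝ), F (x * idCurve G v s) = F x := by
    have := hcont.continuousAt (x := 0) (hs.mem_nhds (by simp))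
    filter_upwards [this] with s hs
    rw [show x * idCurve G v s = x from hs]
  exact hv ((h.hasDerivAt x v).unique ((hasDerivAt_const 0 (F x)).congr_of_eventuallyEq h2))

/-- The function `exp (i F)`. -/
def wave (F : G → ℝ) (x : G) : ℂ := Complex.exp (F x * Complex.I)

theorem norm_wave (F : G → ℝ) (x : G) : ‖wave F x‖ = 1 := Complex.norm_exp_ofReal_mul_I _

theorem conj_wave (F : G → ℝ) (x : G) :
    starRingEnd ℂ (wave F x) = wave (fun x => -1 * F x) x := by
  rw [wave, wave, ← Complex.exp_conj]
  simp

theorem IsPrimitive.contMDiff_wave (h : IsPrimitive α F) :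
    ContMDiff 𝓘(ℝ, E) 𝓘(ℝ, ℂ) ∞ (wave F) := by
  have h1 : ContDiff ℝ ∞ fun t : ℝ => Complex.exp (t * Complex.I) :=
    (Complex.ofRealCLM.contDiff.mul contDiff_const).cexp
  exact h1.contMDiff.comp h.smooth

theorem IsPrimitive.invDeriv_wave (h : IsPrimitive α F) (Y : GroupLieAlgebra 𝓘(ℝ, E) G) :
    invDeriv Y (wave F) = fun x => (α (Y : E) * Complex.I) * wave F x := by
  funext x
  have h1 := hasDerivAt_invDeriv (h.contMDiff_wave.mdifferentiable (by simp) x) Y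
  have h2 : ∀ v : E, HasDerivAt (fun s => wave F (x * idCurve G v s))
      (wave F x * (α v * Complex.I)) 0 := fun v => by
    have h3 := ((h.hasDerivAt x v).ofReal_comp.mul_const Complex.I).cexp
    rw [idCurve_zero, mul_one] at h3
    exact h3
  rw [h1.unique (h2 Y), mul_comm]

variable {μ : Measure G} {Ω : Set G}

theorem memLp_wave (hF : Continuous F) (hfin : μ Ω < ⊤) : MemLp (wave F) 2 (μ.restrict Ω) := by
  have : IsFiniteMeasure (μ.restrict Ω) := ⟨by simpa using hfin⟩
  have hc : Continuous (wave F) := by unfold wave; fun_prop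
  exact MemLp.of_bound hc.aestronglyMeasurable 1 (Eventually.of_forall fun x => (norm_wave F x).le)

variable [IsFiniteMeasureOnCompacts μ] {V₁ : Submodule ℝ (GroupLieAlgebra 𝓘(ℝ, E) G)} {m : ℕ}

/-- The function `exp (i F)` and its horizontal gradient. -/
def wavePair (X : Module.Basis (Fin m) ℝ V₁) (h : IsPrimitive α F) (hfin : μ Ω < ⊤) :
    GradSpace μ Ω m :=
  gradPair ((memLp_wave h.smooth.continuous hfin).toLp (wave F))
    (fun i => ((α ((X i : V₁) : GroupLieAlgebra 𝓘(ℝ, E) G) : ℂ) * Complex.I) •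
      (memLp_wave h.smooth.continuous hfin).toLp (wave F))

variable (X : Module.Basis (Fin m) ℝ V₁) (h : IsPrimitive α F) (h' : IsPrimitive β F')
  (hfin : μ Ω < ⊤)

theorem IsPrimitive.memLp_invDeriv_wave (h : IsPrimitive α F) (hfin : μ Ω < ⊤)
    (Y : GroupLieAlgebra 𝓘(ℝ, E) G) :
    MemLp (invDeriv Y (wave F)) 2 (μ.restrict Ω) := by
  rw [h.invDeriv_wave Y]
  exact (memLp_wave h.smooth.continuous hfin).const_mul _

theorem wavePair_mem (hμ : IsDivergenceFree E μ) :
    wavePair X h hfin ∈ formDomain X (S1 μ Ω V₁) := by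
  rw [mem_formDomain_S1]
  intro i
  have h1 := isWeakDeriv_of_smooth (Ω := Ω) hμ h.contMDiff_wave
    ((X i : V₁) : GroupLieAlgebra 𝓘(ℝ, E) G) (memLp_wave h.smooth.continuous hfin)
    (h.memLp_invDeriv_wave hfin _)
  refine Eq.subst (motive := fun z => IsWeakDeriv μ Ω _ _ z) ?_ h1
  simp only [wavePair, gradPair_some]
  rw [← MemLp.toLp_const_smul]
  exact MemLp.toLp_congr _ _ (Eventually.of_forall fun x => congrFun (h.invDeriv_wave _) x)

/-- The hypothesis `ha` moves the derivative from `a` to the wave. It holds for S¹₀(Ω) by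
integration by parts, and for another wave by its explicit gradient; both uses take the factor `c =
1`. -/
theorem inner_wavePair (a : GradSpace μ Ω m) (c : ℝ)
    (ha : ∀ i, inner ℂ (a (some i)) (wavePair X h hfin none) =
      (c * β ((X i : V₁) : GroupLieAlgebra 𝓘(ℝ, E) G) : ℝ) *
        (-Complex.I * inner ℂ (a none) (wavePair X h hfin none))) :
    inner ℂ a (wavePair X h hfin) = (1 + (c * ∑ i, β ((X i : V₁) : GroupLieAlgebra 𝓘(ℝ, E) G) *
      α ((X i : V₁) : GroupLieAlgebra 𝓘(ℝ, E) G) : ℝ)) *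
        inner ℂ (a none) (wavePair X h hfin none) := by
  have e : ∀ i, inner ℂ (a (some i)) (wavePair X h hfin (some i)) =
      (c * (β ((X i : V₁) : GroupLieAlgebra 𝓘(ℝ, E) G) *
      α ((X i : V₁) : GroupLieAlgebra 𝓘(ℝ, E) G)) : ℝ) *
        inner ℂ (a none) (wavePair X h hfin none) := fun i => by
    have e1 : wavePair X h hfin (some i) =
      ((α ((X i : V₁) : GroupLieAlgebra 𝓘(ℝ, E) G) : ℂ) * Complex.I) • wavePair X h hfin none := rfl
    rw [e1, inner_smul_right, ha i]
    push_cast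
    linear_combination (-(c * (β ((X i : V₁) : GroupLieAlgebra 𝓘(ℝ, E) G) *
      α ((X i : V₁) : GroupLieAlgebra 𝓘(ℝ, E) G)) : ℂ) *
        inner ℂ (a none) (wavePair X h hfin none)) * Complex.I_mul_I
  rw [gradSpace_inner, Finset.sum_congr rfl fun i _ => e i, ← Finset.sum_mul, Finset.mul_sum]
  push_cast
  ring

/-- Waves solve the Helmholtz equation weakly. -/
theorem inner_wavePair_of_mem_S10 (hΩ : IsOpen Ω) {d : GradSpace μ Ω m}
    (hd : d ∈ formDomain X (S10 μ Ω X)) :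
    inner ℂ d (wavePair X h hfin) =
      (1 + (∑ i, α ((X i : V₁) : GroupLieAlgebra 𝓘(ℝ, E) G) ^ 2 : ℝ)) *
        inner ℂ (d none) (wavePair X h hfin none) := by
  have hneg := h.const_mul (-1)
  rw [inner_wavePair X h hfin (β := α) d 1]
  · simp only [one_mul, sq]
  intro i
  have h1 := integral_mul_invDeriv_of_mem_S10 hΩ X hd hneg.contMDiff_wave i
    (memLp_wave hneg.smooth.continuous hfin) (hneg.memLp_invDeriv_wave hfin _)
  have h2 : ∀ u : L2 μ Ω, inner ℂ u (wavePair X h hfin none) =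
      starRingEnd ℂ (∫ x in Ω, u x * wave (fun x => -1 * F x) x ∂μ) := fun u => by
    rw [← inner_conj_symm]
    congr 1
    refine (inner_eq_integral u (memLp_wave h.smooth.continuous hfin)).trans ?_
    simp only [conj_wave]
  have h3 : ∫ x in Ω, d none x * invDeriv ((X i : V₁) : GroupLieAlgebra 𝓘(ℝ, E) G)
        (wave fun x => -1 * F x) x ∂μ =
      (-(α ((X i : V₁) : GroupLieAlgebra 𝓘(ℝ, E) G)) * Complex.I) *
        ∫ x in Ω, d none x * wave (fun x => -1 * F x) x ∂μ := by
    rw [← integral_const_mul, hneg.invDeriv_wave]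
    refine integral_congr_ae (Eventually.of_forall fun x => ?_)
    have h4 : ((-1 : ℝ) • α) ((X i : V₁) : GroupLieAlgebra 𝓘(ℝ, E) G) =
        -α ((X i : V₁) : GroupLieAlgebra 𝓘(ℝ, E) G) := neg_one_mul _
    simp only [h4]
    push_cast
    ring
  rw [h3] at h1
  rw [h2, h2, ← neg_eq_iff_eq_neg.2 h1, map_neg, map_mul, map_mul, map_neg, Complex.conj_ofReal,
    Complex.conj_I]
  push_cast
  ring

theorem inner_wavePair_wavePair :
    inner ℂ (wavePair X h' hfin) (wavePair X h hfin) =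
      (1 + (∑ i, β ((X i : V₁) : GroupLieAlgebra 𝓘(ℝ, E) G) *
        α ((X i : V₁) : GroupLieAlgebra 𝓘(ℝ, E) G) : ℝ)) *
        inner ℂ (wavePair X h' hfin none) (wavePair X h hfin none) := by
  rw [inner_wavePair X h hfin (β := β) _ 1]
  · simp only [one_mul]
  intro i
  have e1 : wavePair X h' hfin (some i) =
      ((β ((X i : V₁) : GroupLieAlgebra 𝓘(ℝ, E) G) : ℂ) * Complex.I) • wavePair X h' hfin none := rfl
  rw [e1, inner_smul_left, map_mul, Complex.conj_ofReal, Complex.conj_I]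
  push_cast
  ring

theorem inner_wavePair_none : inner ℂ (wavePair X h' hfin none) (wavePair X h hfin none) =
    ∫ x in Ω, wave (fun x => F x - F' x) x ∂μ := by
  refine (inner_eq_integral _ (memLp_wave h'.smooth.continuous hfin)).trans ?_
  refine integral_congr_ae ((memLp_wave h.smooth.continuous hfin).coeFn_toLp.mono fun x hx => ?_)
  change (memLp_wave h.smooth.continuous hfin).toLp (wave F) x * _ = _
  rw [hx, conj_wave, wave, wave, wave, ← Complex.exp_add]
  push_cast
  ring_nf

end Primitives

end Carnot

end


noncomputable section

namespace Carnot

/-! ### The Dirichlet and Neumann operators in the abstract setting. -/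

section SubLaplacians

variable {E : Type*} [NormedAddCommGroup E] [NormedSpace ℝ E] [FiniteDimensional ℝ E]
  {G : Type*} [TopologicalSpace G] [T2Space G] [SecondCountableTopology G]
  [ChartedSpace E G] [Group G] [LieGroup 𝓘(ℝ, E) ∞ G] [MeasurableSpace G] [BorelSpace G]
  {μ : Measure G} [μ.IsHaarMeasure] {Ω : Set G}
  {V₁ : Submodule ℝ (GroupLieAlgebra 𝓘(ℝ, E) G)} {m : ℕ}

/-- An infinite Hausdorff space contains infinitely many disjoint nonempty open sets; their
indicators are nonzero and orthogonal. -/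
theorem not_finiteDimensional_L2 (hΩ : IsOpen Ω) (hinf : Ω.Infinite) (hfin : μ Ω < ⊤) :
    ¬ FiniteDimensional ℂ (L2 μ Ω) := by
  intro hfd
  have : IsFiniteMeasure (μ.restrict Ω) := ⟨by simpa using hfin⟩
  have : Infinite Ω := hinf.to_subtype
  obtain ⟨U, hUi, hUo, hUd⟩ := exists_seq_infinite_isOpen_pairwise_disjoint Ω
  have hW : ∀ n, IsOpen ((↑) '' U n : Set G) := fun n => hΩ.isOpenMap_subtype_val _ (hUo n)
  let v : ℕ → L2 μ Ω := fun n =>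
    indicatorConstLp 2 (hW n).measurableSet (measure_ne_top (μ.restrict Ω) _) (1 : ℂ)
  have hv : ∀ n k, inner ℂ (v n) (v k) =
      (((μ.restrict Ω).real ((↑) '' U n ∩ (↑) '' U k) : ℝ) : ℂ) := fun n k => by
    refine (L2.inner_indicatorConstLp_indicatorConstLp (𝕜 := ℂ) (hW n).measurableSet
      (hW k).measurableSet _ _ (1 : ℂ) 1).trans ?_
    simp
  refine (linearIndependent_of_ne_zero_of_inner_eq_zero (𝕜 := ℂ) (v := v) (fun n h0 => ?_)
    fun n k hnk => ?_).finite.false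
  · have h1 := hv n n
    rw [h0, inner_zero_left, inter_self] at h1
    have h2 : (μ.restrict Ω).real ((↑) '' U n : Set G) = 0 := by exact_mod_cast h1.symm
    rw [measureReal_eq_zero_iff, Measure.restrict_apply (hW n).measurableSet,
      inter_eq_left.2 (Subtype.coe_image_subset Ω (U n))] at h2
    exact ((hW n).measure_pos μ ((hUi n).nonempty.image _)).ne' h2
  · change inner ℂ (v n) (v k) = 0
    rw [hv, (disjoint_image_iff Subtype.val_injective).2 (hUd hnk) |>.inter_eq]
    simp

theorem S10_le_S1 (X : Module.Basis (Fin m) ℝ V₁) : S10 μ Ω X ≤ S1 μ Ω V₁ := fun _ hu => hu.1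

theorem formDomain_mono (X : Module.Basis (Fin m) ℝ V₁) {Q Q' : Submodule ℂ (L2 μ Ω)}
    (h : Q ≤ Q') : formDomain X Q ≤ formDomain X Q' := fun _ ha => ⟨h ha.1, ha.2⟩

theorem dense_S1 (X : Module.Basis (Fin m) ℝ V₁) (hΩ : IsOpen Ω) (hμ : IsDivergenceFree E μ) :
    Dense (S1 μ Ω V₁ : Set (L2 μ Ω)) :=
  (dense_S10 hΩ hμ X).mono (S10_le_S1 X)

variable {Q : Type*} [NormedAddCommGroup Q] [InnerProductSpace ℂ Q] [CompleteSpace Q]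

/-- The map `(u, p) ↦ u` on a space of pairs. -/
def fstEmbedding (J : Q →ₗᵢ[ℂ] GradSpace μ Ω m) : Q →L[ℂ] L2 μ Ω :=
  PiLp.proj 2 (fun _ : Option (Fin m) => L2 μ Ω) none ∘L J.toContinuousLinearMap

theorem fstEmbedding_apply (J : Q →ₗᵢ[ℂ] GradSpace μ Ω m) (a : Q) :
    fstEmbedding J a = J a none := rfl

/-- The Dirichlet form domain as a subspace of a space of pairs. -/
def dirichletDomain (X : Module.Basis (Fin m) ℝ V₁) (J : Q →ₗᵢ[ℂ] GradSpace μ Ω m) :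
    Submodule ℂ Q :=
  (formDomain X (S10 μ Ω X)).comap J.toLinearMap

instance completeSpace_dirichletDomain (X : Module.Basis (Fin m) ℝ V₁)
    (J : Q →ₗᵢ[ℂ] GradSpace μ Ω m) : CompleteSpace (dirichletDomain X J) := by
  have h : IsClosed (formDomain X (S10 μ Ω X) : Set (GradSpace μ Ω m)) := by
    rw [formDomain_S10]; exact Submodule.isClosed_topologicalClosure _
  exact (h.preimage J.continuous : IsClosed (dirichletDomain X J : Set Q)).completeSpace_coe

variable {X : Module.Basis (Fin m) ℝ V₁} {J : Q →ₗᵢ[ℂ] GradSpace μ Ω m}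

theorem isFormOperator_neumann (hJ : LinearMap.range J.toLinearMap = formDomain X (S1 μ Ω V₁))
    (hΩ : IsOpen Ω) (hμ : IsDivergenceFree E μ) :
    IsFormOperator (fstEmbedding J) (neumannSubLaplacian μ Ω X) :=
  isFormOperator_toLinearPMap hΩ X le_rfl (dense_S1 X hΩ hμ) J hJ

theorem isFormOperator_dirichlet (hJ : LinearMap.range J.toLinearMap = formDomain X (S1 μ Ω V₁))
    (hΩ : IsOpen Ω) (hμ : IsDivergenceFree E μ) :
    IsFormOperator (fstEmbedding J ∘L (dirichletDomain X J).subtypeL)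
      (dirichletSubLaplacian μ Ω X) := by
  refine isFormOperator_toLinearPMap hΩ X (S10_le_S1 X) (dense_S10 hΩ hμ X)
    (J.comp (dirichletDomain X J).subtypeₗᵢ) ?_
  ext a
  constructor
  · rintro ⟨d, rfl⟩
    exact d.2
  · intro ha
    obtain ⟨q, rfl⟩ := hJ.ge (formDomain_mono X (S10_le_S1 X) ha)
    exact ⟨⟨q, ha⟩, rfl⟩

theorem denseRange_dirichlet (hJ : LinearMap.range J.toLinearMap = formDomain X (S1 μ Ω V₁))
    (hΩ : IsOpen Ω) (hμ : IsDivergenceFree E μ) :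
    DenseRange (fstEmbedding J ∘L (dirichletDomain X J).subtypeL) := by
  refine (dense_S10 hΩ hμ X).mono fun u hu => ?_
  obtain ⟨p, hp⟩ := (mem_S1_iff X).1 hu.1
  have hm : gradPair u p ∈ formDomain X (S10 μ Ω X) := ⟨hu, hp⟩
  obtain ⟨q, hq⟩ := hJ.ge (formDomain_mono X (S10_le_S1 X) hm)
  rw [← hq] at hm
  exact ⟨⟨q, hm⟩, congrArg (fun a : GradSpace μ Ω m => a none) hq⟩

theorem denseRange_neumann (hJ : LinearMap.range J.toLinearMap = formDomain X (S1 μ Ω V₁))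
    (hΩ : IsOpen Ω) (hμ : IsDivergenceFree E μ) : DenseRange (fstEmbedding J) := by
  refine (denseRange_dirichlet hJ hΩ hμ).mono ?_
  rintro _ ⟨d, rfl⟩
  exact ⟨d, rfl⟩

theorem isRellich_of_isCompactOperator
    (hJ : LinearMap.range J.toLinearMap = formDomain X (S1 μ Ω V₁))
    (hc : IsCompactOperator (fstEmbedding J)) : IsRellich μ Ω X := by
  intro a ha C hC
  have ha' : ∀ n, ∃ q, J q = a n := fun n => hJ.ge (ha n)
  choose q hq using ha'
  have hcpt := hc.isCompact_closure_image_closedBall (𝕜₁ := ℂ)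
    (f := (fstEmbedding J : Q →ₗ[ℂ] L2 μ Ω)) C
  obtain ⟨u, -, φ, hφ, hu⟩ := hcpt.tendsto_subseq (x := fun n => fstEmbedding J (q n)) fun n =>
    subset_closure ⟨q n, by simpa [← J.norm_map, hq] using hC n, rfl⟩
  refine ⟨u, φ, hφ, ?_⟩
  simpa only [Function.comp_def, fstEmbedding_apply, hq] using hu

/-- A function in the Dirichlet form domain that satisfies the Neumann eigenvalue equation
vanishes. -/
theorem eq_zero_of_mem_dirichletDomain [ConnectedSpace G] [NoncompactSpace G]
    (hJ : LinearMap.range J.toLinearMap = formDomain X (S1 μ Ω V₁)) (hΩ : IsOpen Ω)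
    (hR : IsRellich μ Ω X) (hfin : μ Ω < ⊤) {c : ℝ} {d : Q}
    (hd : d ∈ dirichletDomain X J) (h : ∀ v, shiftedForm (fstEmbedding J) c d v = 0) : d = 0 := by
  have := ChartedSpace.locallyCompactSpace E G
  have := topologicalGroup_of_lieGroup 𝓘(ℝ, E) ∞ (G := G)
  refine J.injective ((eq_zero_of_mem_S10_of_neumann hΩ hR hfin (c := c) hd fun v hv => ?_).trans
    (map_zero J).symm)
  obtain ⟨w, rfl⟩ := hJ.ge hv
  have h1 := sub_eq_zero.1 (h w)
  rw [← J.inner_map_map] at h1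
  exact h1

/-- If `c ≤ 0`, the eigenfunction has zero gradient and hence solves the Neumann equation with
eigenvalue `0`. Being in S¹₀(Ω), it vanishes. -/
theorem dirichlet_eigenvalue_pos [ConnectedSpace G] [NoncompactSpace G]
    (hJ : LinearMap.range J.toLinearMap = formDomain X (S1 μ Ω V₁)) (hΩ : IsOpen Ω)
    (hR : IsRellich μ Ω X) (hfin : μ Ω < ⊤) {c : ℝ} {u : L2 μ Ω} (hu : u ≠ 0)
    (he : formResolvent (fstEmbedding J ∘L (dirichletDomain X J).subtypeL)
      (((c : ℂ) + 1) • u) = u) : 0 < c := by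
  by_contra hc
  set ι := fstEmbedding J ∘L (dirichletDomain X J).subtypeL with hι
  set d : dirichletDomain X J := ((c : ℂ) + 1) • ContinuousLinearMap.adjoint ι u with hd
  have hdu : ι d = u := map_smul_adjoint he
  have h1 : ‖d‖ ^ 2 - (1 + c) * ‖ι d‖ ^ 2 = 0 := by
    have := shiftedForm_eigenvector he d
    rw [← hd, shiftedForm_self] at this
    exact_mod_cast this
  let a : GradSpace μ Ω m := J d
  have h2 : ‖d‖ ^ 2 = ‖a none‖ ^ 2 + ∑ i, ‖a (some i)‖ ^ 2 := by
    rw [← gradSpace_norm_sq, J.norm_map]; rfl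
  have h3 : ι d = a none := rfl
  have h4 : ∑ i, ‖a (some i)‖ ^ 2 = 0 := by
    refine le_antisymm ?_ (Finset.sum_nonneg fun i _ => sq_nonneg _)
    rw [h3] at h1
    nlinarith [sq_nonneg ‖a none‖]
  have h5 : ∀ i, a (some i) = 0 := fun i => by
    have := (Finset.sum_eq_zero_iff_of_nonneg fun i _ => sq_nonneg ‖a (some i)‖).1 h4 i
      (Finset.mem_univ i)
    simpa using this
  have h6 : (d : Q) = 0 := by
    refine eq_zero_of_mem_dirichletDomain hJ hΩ hR hfin (c := 0) d.2 fun v => ?_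
    have e : inner ℂ (d : Q) v = inner ℂ (a none) (J v none) := by
      rw [← J.inner_map_map]
      refine (gradSpace_inner a (J v)).trans ?_
      simp [h5]
    rw [shiftedForm, e, fstEmbedding_apply, fstEmbedding_apply]
    simp [a]
  apply hu
  rw [← hdu, Subtype.ext (a2 := (0 : dirichletDomain X J)) h6, map_zero]

/-- As `t → 0` the integral tends to the volume of Ω, which is positive, and finite so that
dominated convergence applies. -/
theorem exists_integral_wave_ne_zero (hΩ : IsOpen Ω) (hne : Ω.Nonempty) (hfin : μ Ω < ⊤)
    {F : ℝ → G → ℝ} (hF : ∀ t, Continuous (F t)) (hF' : ∀ x, Continuous fun t => F t x)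
    (h0 : ∀ x, F 0 x = 0) : ∃ t, 0 < t ∧ t < 1 ∧ ∫ x in Ω, wave (F t) x ∂μ ≠ 0 := by
  have : IsFiniteMeasure (μ.restrict Ω) := ⟨by simpa using hfin⟩
  have h1 : Tendsto (fun t => ∫ x in Ω, wave (F t) x ∂μ) (𝓝 0) (𝓝 (∫ x in Ω, wave (F 0) x ∂μ)) := by
    refine tendsto_integral_filter_of_dominated_convergence (fun _ => (1 : ℝ))
      (Eventually.of_forall fun t => ?_) (Eventually.of_forall fun t => Eventually.of_forall fun x =>
        (norm_wave _ x).le) (integrable_const _) (Eventually.of_forall fun x => ?_)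
    · have := hF t
      exact (by unfold wave; fun_prop : Continuous (wave (F t))).aestronglyMeasurable
    · have := hF' x
      exact (by unfold wave; fun_prop : Continuous fun t => wave (F t) x).tendsto 0
  have h2 : ∫ x in Ω, wave (F 0) x ∂μ ≠ 0 := by
    have e : wave (F 0) = fun _ => 1 := by funext x; simp [wave, h0]
    have hp : μ.real Ω ≠ 0 := (ENNReal.toReal_pos (hΩ.measure_pos μ hne).ne' hfin.ne).ne'
    simpa [e] using hp
  have h3 := (h1.eventually_ne h2).filter_mono (nhdsWithin_le_nhds (s := Ioi 0))
  obtain ⟨t, ht, ht0, ht1⟩ := (h3.and (Ioo_mem_nhdsGT (zero_lt_one (α := ℝ)))).exists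
  exact ⟨t, ht0, ht1, ht⟩

end SubLaplacians

end Carnot

end


noncomputable section

namespace Carnot

/-! ### Choice of the waves and the final comparison. -/

section Comparison

variable {E : Type*} [NormedAddCommGroup E] [NormedSpace ℝ E] [FiniteDimensional ℝ E]
  {G : Type*} [TopologicalSpace G] [T2Space G] [SecondCountableTopology G]
  [ChartedSpace E G] [Group G] [LieGroup 𝓘(ℝ, E) ∞ G] [MeasurableSpace G] [BorelSpace G]
  {μ : Measure G} [μ.IsHaarMeasure] {Ω : Set G}
  {V₁ : Submodule ℝ (GroupLieAlgebra 𝓘(ℝ, E) G)} {m : ℕ}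
  {X : Module.Basis (Fin m) ℝ V₁}
  {Q : Type*} [NormedAddCommGroup Q] [InnerProductSpace ℂ Q] [CompleteSpace Q]
  {J : Q →ₗᵢ[ℂ] GradSpace μ Ω m}

theorem sum_two_coords {k l : Fin m} (hkl : k ≠ l) (a b a' b' : ℝ) :
    ∑ i, ((if i = k then a else 0) + (if i = l then b else 0)) *
      ((if i = k then a' else 0) + (if i = l then b' else 0)) = a * a' + b * b' := by
  simp [add_mul, mul_add, Finset.sum_add_distrib, hkl, hkl.symm]

/-- For every `c > 0` there are two waves of energy `c` that are not orthogonal with respect to the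
form of the Neumann operator shifted by `c`. -/
theorem exists_waves (hJ : LinearMap.range J.toLinearMap = formDomain X (S1 μ Ω V₁))
    (hΩ : IsOpen Ω) (hne : Ω.Nonempty) (hμ : IsDivergenceFree E μ) (hfin : μ Ω < ⊤)
    {k l : Fin m} (hkl : k ≠ l) {α β : E →ₗ[ℝ] ℝ} {F F' : G → ℝ} (hF : IsPrimitive α F)
    (hF' : IsPrimitive β F')
    (hα : ∀ i, α ((X i : V₁) : GroupLieAlgebra 𝓘(ℝ, E) G) = if i = k then 1 else 0)
    (hβ : ∀ i, β ((X i : V₁) : GroupLieAlgebra 𝓘(ℝ, E) G) = if i = l then 1 else 0)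
    {c : ℝ} (hc : 0 < c) :
    ∃ U U' : Q, (∀ d ∈ dirichletDomain X J, shiftedForm (fstEmbedding J) c d U = 0) ∧
      shiftedForm (fstEmbedding J) c U U = 0 ∧
      (∀ d ∈ dirichletDomain X J, shiftedForm (fstEmbedding J) c d U' = 0) ∧
      shiftedForm (fstEmbedding J) c U U' ≠ 0 := by
  let P : ∀ a b : ℝ, IsPrimitive (a • α + b • β) (fun x => a * F x + b * F' x) := fun a b =>
    (hF.const_mul a).add (hF'.const_mul b)
  have hP : ∀ a b i, (a • α + b • β) ((X i : V₁) : GroupLieAlgebra 𝓘(ℝ, E) G) =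
      (if i = k then a else 0) + (if i = l then b else 0) := fun a b i => by
    have e : (a • α + b • β) ((X i : V₁) : GroupLieAlgebra 𝓘(ℝ, E) G) =
      a * α ((X i : V₁) : GroupLieAlgebra 𝓘(ℝ, E) G) +
        b * β ((X i : V₁) : GroupLieAlgebra 𝓘(ℝ, E) G) := rfl
    rw [e, hα, hβ]
    simp
  have hex : ∀ a b : ℝ, ∃ U : Q, J U = wavePair X (P a b) hfin := fun a b =>
    hJ.ge (wavePair_mem X (P a b) hfin hμ)
  choose U hU using hex
  have hsol : ∀ a b : ℝ, a ^ 2 + b ^ 2 = c → ∀ d ∈ dirichletDomain X J,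
      shiftedForm (fstEmbedding J) c d (U a b) = 0 := fun a b hab d hd => by
    have h1 := inner_wavePair_of_mem_S10 X (P a b) hfin hΩ hd
    simp only [hP, sq, sum_two_coords hkl] at h1
    rw [shiftedForm, ← J.inner_map_map, fstEmbedding_apply, fstEmbedding_apply, hU, ← hab]
    refine sub_eq_zero.2 (h1.trans ?_)
    simp only [sq]
    rfl
  have hform : ∀ a b a' b' : ℝ, shiftedForm (fstEmbedding J) c (U a b) (U a' b') =
      ((a * a' + b * b' - c : ℝ) : ℂ) *
        ∫ x in Ω, wave (fun x => a' * F x + b' * F' x - (a * F x + b * F' x)) x ∂μ :=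
    fun a b a' b' => by
      have h1 := inner_wavePair_wavePair X (P a' b') (P a b) hfin
      simp only [hP, sum_two_coords hkl] at h1
      rw [shiftedForm, ← J.inner_map_map, fstEmbedding_apply, fstEmbedding_apply, hU, hU, h1,
        inner_wavePair_none]
      push_cast
      ring
  -- Rotate the frequency `(√c, 0)` by a small angle `t`. The form between the two waves is `c (cos
  -- t - 1)` times the integral of the quotient wave, and both factors are nonzero.
  obtain ⟨t, ht0, ht1, ht⟩ := exists_integral_wave_ne_zero (μ := μ) hΩ hne hfin
    (F := fun t x => (√c * Real.cos t) * F x + (√c * Real.sin t) * F' x - (√c * F x + 0 * F' x))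
    (fun t => by have := hF.smooth.continuous; have := hF'.smooth.continuous; fun_prop)
    (fun x => by fun_prop) (fun x => by simp)
  have hsq : √c * √c = c := Real.mul_self_sqrt hc.le
  have hcos : Real.cos t < 1 := by
    have := Real.cos_lt_cos_of_nonneg_of_le_pi le_rfl (by linarith [Real.pi_gt_three]) ht0
    rwa [Real.cos_zero] at this
  refine ⟨U √c 0, U (√c * Real.cos t) (√c * Real.sin t), hsol _ _ ?_, ?_, hsol _ _ ?_, ?_⟩
  · rw [sq, hsq]; ring
  · rw [hform, hsq]; simp
  · linear_combination (Real.cos t ^ 2 + Real.sin t ^ 2) * hsq + c * Real.sin_sq_add_cos_sq t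
  · rw [hform]
    refine mul_ne_zero ?_ ht
    rw [Complex.ofReal_ne_zero]
    have e : √c * (√c * Real.cos t) + 0 * (√c * Real.sin t) - c = c * (Real.cos t - 1) := by
      linear_combination Real.cos t * hsq
    rw [e]
    exact mul_ne_zero hc.ne' (by linarith)

theorem exists_enumeration_and_lt (hJ : LinearMap.range J.toLinearMap = formDomain X (S1 μ Ω V₁))
    [SimplyConnectedSpace G] {r : ℕ} {V : ℕ → Submodule ℝ (GroupLieAlgebra 𝓘(ℝ, E) G)}
    (hV : IsStratification r V) (hV₁ : V 1 = V₁) (hm : 2 ≤ m) (hΩ : IsOpen Ω) (hne : Ω.Nonempty)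
    (hcpt : HasCompactResolvent (neumannSubLaplacian μ Ω X)) :
    (∃ lD, IsEigenvalueEnumeration (dirichletSubLaplacian μ Ω X) lD) ∧
    (∃ lN, IsEigenvalueEnumeration (neumannSubLaplacian μ Ω X) lN) ∧
    ∀ lD lN : ℕ → ℝ, IsEigenvalueEnumeration (dirichletSubLaplacian μ Ω X) lD →
      IsEigenvalueEnumeration (neumannSubLaplacian μ Ω X) lN → ∀ j : ℕ, lN (j + 1) < lD j := by
  subst hV₁
  have hμ : IsDivergenceFree E μ := fun Y f hf hc => hV.integral_invDeriv Y hf hc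
  have hN := isFormOperator_neumann hJ hΩ hμ
  have hD := isFormOperator_dirichlet hJ hΩ hμ
  have hc := hN.isCompactOperator hcpt
  have hR := isRellich_of_isCompactOperator hJ hc
  have hfin := hR.measure_lt_top hμ
  -- Two coordinate functionals on the first layer supply the plane in which frequencies are
  -- rotated.
  let k : Fin m := ⟨0, by omega⟩
  let l : Fin m := ⟨1, by omega⟩
  have hkl : k ≠ l := by simp [k, l]
  obtain ⟨α, hα, hα'⟩ := hV.exists_functional (X.coord k)
  obtain ⟨β, hβ, hβ'⟩ := hV.exists_functional (X.coord l)
  obtain ⟨F, hF⟩ := exists_isPrimitive (G := G) α hα'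
  obtain ⟨F', hF'⟩ := exists_isPrimitive (G := G) β hβ'
  have hcoord : ∀ k i, X.coord k (X i) = if i = k then 1 else 0 := fun k i => by
    rw [Module.Basis.coord_apply, Module.Basis.repr_self, Finsupp.single_apply]
  have hαi := fun i => (hα (X i)).trans (hcoord k i)
  have hβi := fun i => (hβ (X i)).trans (hcoord l i)
  have hk : α ((X k : V 1) : GroupLieAlgebra 𝓘(ℝ, E) G) ≠ 0 := by rw [hαi]; simp
  have := hF.noncompactSpace hk
  have hH := not_finiteDimensional_L2 (μ := μ) hΩ (hF.infinite_of_isOpen hk hΩ hne) hfin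
  refine ⟨hD.exists_enumeration (hc.comp_clm _) (denseRange_dirichlet hJ hΩ hμ) hH,
    hN.exists_enumeration hc (denseRange_neumann hJ hΩ hμ) hH, fun lD lN hlD hlN j => ?_⟩
  obtain ⟨e, he, hT, -⟩ := hD.exists_orthonormal hlD
  have hpos := dirichlet_eigenvalue_pos hJ hΩ hR hfin (he.ne_zero j) (hT j)
  obtain ⟨U, U', h1, h2, h3, h4⟩ := exists_waves hJ hΩ hne hμ hfin hkl hF hF' hαi hβi hpos
  exact hN.enumeration_lt hD hc (denseRange_neumann hJ hΩ hμ) hlD hlN j h1 h2 h3 h4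
    fun d hd h => eq_zero_of_mem_dirichletDomain hJ hΩ hR hfin hd h

end Comparison

end Carnot

end




theorem theorem1p1
    {E : Type*} [NormedAddCommGroup E] [NormedSpace ℝ E] [FiniteDimensional ℝ E]
    {G : Type*} [TopologicalSpace G] [T2Space G] [SecondCountableTopology G]
    [ChartedSpace E G] [Group G] [LieGroup 𝓘(ℝ, E) ∞ G] [SimplyConnectedSpace G]
    [MeasurableSpace G] [BorelSpace G] (μ : Measure G) [μ.IsHaarMeasure]
    (r : ℕ) (V : ℕ → Submodule ℝ (GroupLieAlgebra 𝓘(ℝ, E) G))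
    (hV : Carnot.IsStratification r V) (hdim : 2 ≤ Module.finrank ℝ (V 1))
    (ip : InnerProductSpace.Core ℝ (V 1))
    (m : ℕ) (X : Module.Basis (Fin m) ℝ (V 1))
    (hX : ∀ k l, ip.inner (X k) (X l) = if k = l then 1 else 0)
    (Ω : Set G) (hΩ : IsOpen Ω) (hne : Ω.Nonempty)
    (hcpt : Carnot.HasCompactResolvent (Carnot.neumannSubLaplacian μ Ω X)) :
    (∃ lD, Carnot.IsEigenvalueEnumeration (Carnot.dirichletSubLaplacian μ Ω X) lD) ∧
    (∃ lN, Carnot.IsEigenvalueEnumeration (Carnot.neumannSubLaplacian μ Ω X) lN) ∧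
    ∀ lD lN : ℕ → ℝ,
      Carnot.IsEigenvalueEnumeration (Carnot.dirichletSubLaplacian μ Ω X) lD →
      Carnot.IsEigenvalueEnumeration (Carnot.neumannSubLaplacian μ Ω X) lN →
      ∀ j : ℕ, lN (j + 1) < lD j := by
  have hm : 2 ≤ m := by simpa [Module.finrank_eq_card_basis X] using hdim
  have : CompleteSpace (Carnot.formDomain X (Carnot.S1 μ Ω (V 1))) :=
    (Carnot.isClosed_formDomain_S1 X).completeSpace_coe
  -- The abstract form domain is the space of pairs `(u, ∇u)` itself, complete because it is closed.
  exact Carnot.exists_enumeration_and_lt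
    (J := (Carnot.formDomain X (Carnot.S1 μ Ω (V 1))).subtypeₗᵢ) (Submodule.range_subtype _)
    hV rfl hm hΩ hne hcpt
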